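/- **Setting.** Let $T\ge 0$, $p,d\in\mathbb{N}$, and let $\mathbb{D}^p$ be the space of functions $[0,T]\to\mathbb{R}^p$ that are right continuous with left limits, with the norm $\|w\|=\sup_{0\le t\le T}|w(t)|$, where $|\cdot|$ is the Euclidean norm. $D,D^2$ denote Fréchet derivatives on $\mathbb{D}^p$. For a $k$-linear form $A$ on $\mathbb{D}^p$ write $A[w^{[k]}]=A[w,\dots,w]$ and $\|A\|=\sup_{\|w\|=1}|A[w^{[k]}]|$. For twice Fréchet differentiable $g\colon\mathbb{D}^p\to\mathbb{R}$ let $$\|g\|_M=\sup_w\frac{|g(w)|}{1+\|w\|^3}+\sup_w\frac{\|Dg(w)\|}{1+\|w\|^2}+\sup_w\frac{\|D^2g(w)\|}{1+\|w\|}+\sup_{w,\,h\ne 0}\frac{\|D^2g(w+h)-D^2g(w)\|}{\|h\|},$$ $$\|g\|_{M'}=\sup_w\frac{|g(w)|}{1+\|w\|^2}+\sup_w\frac{\|Dg(w)\|}{1+\|w\|}+\sup_w\|D^2g(w)\|+\sup_{w,\,h\ne 0}\frac{\|D^2g(w+h)-D^2g(w)\|}{\|h\|},$$ and let $M=\{g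 \text{ twice Fréchet differentiable}: \|g\|_M<\infty\}$ and $M'=\{g\in M:\sup_w\|D^2g(w)\|<\infty\}$. Let $\Lambda$ be a measure on $\mathbb{R}^d$ and let $J_u\in\mathbb{D}^p$, $u\in\mathbb{R}^d$, be such that $(u,s)\mapsto J_u(s)$ is measurable and $J_\cdot(s)\in L^2(\mathbb{R}^d\to\mathbb{R}^p,\Lambda)$ for every $s\in[0,T]$. Let $Z$ be a centred $\mathbb{R}^p$-valued Gaussian process on $[0,T]$ with almost surely continuous sample paths (and all sample paths in $\mathbb{D}^p$) and covariance $$\mathbb{E}[Z(s)Z(t)^\top]=\int_{\mathbb{R}^d}J_u(s)J_u(t)^\top\,\Lambda(du),\qquad s,t\in[0,T].$$ **Theorem.** Let $g\in M$ and define $f_g\colon\mathbb{D}^p\to\mathbb{R}$ by $$f_g(w)=-\int_0^\infty\Bigl(\mathbb{E}\bigl[g\bigl(we^{-s}+\sqrt{1-e^{-2s}}\,Z\bigr)\bigr]-\mathbb{E}[g(Z)]\Bigr)\,ds .$$ Then these expectations and the integral converge absolutely, $f_g\in M$, and for $k\in\{1,2\}$ and $w\in\mathbb{D}^p$ $$D^kf_g(w)=-\mathbb{E}\int_0^\infty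 e^{-ks}\,D^kg\bigl(we^{-s}+\sqrt{1-e^{-2s}}\,Z\bigr)\,ds ,$$ where the integrand is Bochner integrable, in the space of bounded $k$-linear forms, with respect to the product of the probability measure and $ds$. Furthermore, for $w,w',w_1,w_2\in\mathbb{D}^p$, $$\bigl|D^2f_g(w+w')[w_1,w_2]-D^2f_g(w)[w_1,w_2]\bigr|\le\|g\|_M\,\|w_1\|\,\|w_2\|\,\|w'\| ,$$ and if $g\in M'$, then $\|g\|_{M'}<\infty$ and $$\bigl|D^2f_g(w)[w_1,w_2]\bigr|\le\tfrac32\,\|g\|_{M'}\,\|w_1\|\,\|w_2\| .$$ Finally, for every $w\in\mathbb{D}^p$, the function $u\mapsto D^2f_g(w)[J_u,J_u]$ is $\Lambda$-integrable and $f_g$ satisfies the Stein equation $$\int_{\mathbb{R}^d}D^2f_g(w)[J_u,J_u]\,\Lambda(du)-Df_g(w)[w]=g(w)-\mathbb{E}[g(Z)] .$$ -/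

import Mathlib

open MeasureTheory ProbabilityTheory Filter Topology
open scoped ENNReal

noncomputable section

namespace GaussStein

/-! ### The space of càdlàg paths with the sup norm -/

/-- Right continuous on `[0,T]` with a left limit at each point
(at `t = 0` the filter `𝓝[<] t` on the subtype is `⊥`, so no condition is imposed there). -/
def IsCadlag {T : ℝ} {p : ℕ} (x : Set.Icc (0 : ℝ) T → EuclideanSpace ℝ (Fin p)) : Prop :=
  ∀ t, ContinuousWithinAt x (Set.Ici t) t ∧ ∃ l, Tendsto x (𝓝[<] t) (𝓝 l)

/-- A càdlàg function on `[0,T]` is bounded, so looking for càdlàg functions inside `ℓ^∞`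
is no restriction. -/
theorem IsCadlag.memℓp {T : ℝ} {p : ℕ}
    {x : Set.Icc (0 : ℝ) T → EuclideanSpace ℝ (Fin p)} (hx : IsCadlag x) : Memℓp x ∞ := by
  apply memℓp_infty
  have hloc : ∀ t : Set.Icc (0 : ℝ) T, t ∈ (Set.univ : Set (Set.Icc (0 : ℝ) T)) →
      ∃ U ∈ 𝓝[Set.univ] t, BddAbove ((fun i => ‖x i‖) '' U) := by
    intro t _
    obtain ⟨hr, l, hl⟩ := hx t
    have h1 : ∀ᶠ s in 𝓝[≥] t, ‖x s‖ < ‖x t‖ + 1 :=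
      hr.norm.eventually_lt_const (lt_add_one _)
    have h2 : ∀ᶠ s in 𝓝[<] t, ‖x s‖ < ‖l‖ + 1 :=
      hl.norm.eventually_lt_const (lt_add_one _)
    have h : ∀ᶠ s in 𝓝 t, ‖x s‖ < max (‖l‖ + 1) (‖x t‖ + 1) := by
      rw [← nhdsLT_sup_nhdsGE]
      refine eventually_sup.2 ⟨?_, ?_⟩
      · filter_upwards [h2] with s hs using lt_max_of_lt_left hs
      · filter_upwards [h1] with s hs using lt_max_of_lt_right hs
    refine ⟨_, by rw [nhdsWithin_univ]; exact h, ?_⟩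
    refine ⟨max (‖l‖ + 1) (‖x t‖ + 1), ?_⟩
    rintro _ ⟨s, hs, rfl⟩
    exact le_of_lt hs
  have := isCompact_univ.induction_on (p := fun U => BddAbove ((fun i => ‖x i‖) '' U))
    (by simp) (fun s t hst ht => ht.mono (Set.image_mono hst))
    (fun s t hs ht => by rw [Set.image_union]; exact hs.union ht) hloc
  rwa [Set.image_univ] at this

/-- The linear subspace of càdlàg functions in the space of bounded functions `[0,T] → ℝ^p`
with norm `‖x‖ = sup_t |x(t)|`, where `|·|` is the Euclidean norm. -/
def cadlagSubmodule (T : ℝ) (p : ℕ) :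
    Submodule ℝ (lp (fun _ : Set.Icc (0 : ℝ) T => EuclideanSpace ℝ (Fin p)) ∞) where
  carrier := {x | IsCadlag (fun t => x t)}
  zero_mem' := fun t => ⟨continuousWithinAt_const, 0, tendsto_const_nhds⟩
  add_mem' := by
    intro a b ha hb t
    obtain ⟨ha1, la, ha2⟩ := ha t
    obtain ⟨hb1, lb, hb2⟩ := hb t
    exact ⟨ha1.add hb1, la + lb, ha2.add hb2⟩
  smul_mem' := by
    intro c a ha t
    obtain ⟨ha1, la, ha2⟩ := ha t
    exact ⟨ha1.const_smul c, c • la, ha2.const_smul c⟩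

/-- `𝔻^p = 𝔻([0,T] → ℝ^p)`, with the sup norm. -/
def Dp (T : ℝ) (p : ℕ) : Type := cadlagSubmodule T p

instance (T : ℝ) (p : ℕ) : NormedAddCommGroup (Dp T p) :=
  inferInstanceAs (NormedAddCommGroup (cadlagSubmodule T p))

instance (T : ℝ) (p : ℕ) : NormedSpace ℝ (Dp T p) :=
  inferInstanceAs (NormedSpace ℝ (cadlagSubmodule T p))

instance (T : ℝ) (p : ℕ) :
    CoeFun (Dp T p) (fun _ => Set.Icc (0 : ℝ) T → EuclideanSpace ℝ (Fin p)) :=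
  ⟨fun x => ⇑x.1⟩

/-- Every càdlàg function is an element of `𝔻^p`. -/
def IsCadlag.toDp {T : ℝ} {p : ℕ} {x : Set.Icc (0 : ℝ) T → EuclideanSpace ℝ (Fin p)}
    (hx : IsCadlag x) : Dp T p :=
  ⟨⟨x, hx.memℓp⟩, hx⟩

theorem Dp.norm_eq {T : ℝ} {p : ℕ} (x : Dp T p) : ‖x‖ = ⨆ t, ‖x t‖ :=
  lp.norm_eq_ciSup x.1

/-! ### Test functions -/

section TestFunctions

variable {E : Type*} [NormedAddCommGroup E] [NormedSpace ℝ E]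

/-- Bochner integrability of a function with values in a normed space. It only fixes the norm
instance, which is not found by unification when `F` is a space of continuous bilinear forms. -/
abbrev BochnerIntegrable {S F : Type*} [MeasurableSpace S] [NormedAddCommGroup F]
    (f : S → F) (μ : Measure S) : Prop := Integrable f μ

/-- The second Fréchet derivative, as a bilinear form. -/
def D2 (g : E → ℝ) (w : E) : E →L[ℝ] E →L[ℝ] ℝ := fderiv ℝ (fderiv ℝ g) w

/-- `‖A‖ = sup_{‖w‖ = 1} |A[w]|` for a linear form. -/
def linNorm (A : E →L[ℝ] ℝ) : ℝ := ⨆ w : Metric.sphere (0 : E) 1, |A w|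

/-- `‖A‖ = sup_{‖w‖ = 1} |A[w, w]|` for a bilinear form (the supremum is over the diagonal only). -/
def bilNorm (A : E →L[ℝ] E →L[ℝ] ℝ) : ℝ := ⨆ w : Metric.sphere (0 : E) 1, |A w w|

/-- `g` is twice Fréchet differentiable. -/
def TwiceFrechetDifferentiable (g : E → ℝ) : Prop :=
  Differentiable ℝ g ∧ Differentiable ℝ (fderiv ℝ g)

/-- The best Lipschitz constant of `D²g`, possibly infinite
(for `h = 0` the quotient is `0 / 0 = 0`). -/
def lipD2 (g : E → ℝ) : ℝ≥0∞ :=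
  ⨆ (w : E) (h : E), ENNReal.ofReal (bilNorm (D2 g (w + h) - D2 g w) / ‖h‖)

/-- The norm `‖g‖_M`, possibly infinite. -/
def normM (g : E → ℝ) : ℝ≥0∞ :=
  (⨆ w : E, ENNReal.ofReal (|g w| / (1 + ‖w‖ ^ 3)))
    + (⨆ w : E, ENNReal.ofReal (linNorm (fderiv ℝ g w) / (1 + ‖w‖ ^ 2)))
    + (⨆ w : E, ENNReal.ofReal (bilNorm (D2 g w) / (1 + ‖w‖)))
    + lipD2 g

/-- The norm `‖g‖_{M'}`, possibly infinite. -/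
def normM' (g : E → ℝ) : ℝ≥0∞ :=
  (⨆ w : E, ENNReal.ofReal (|g w| / (1 + ‖w‖ ^ 2)))
    + (⨆ w : E, ENNReal.ofReal (linNorm (fderiv ℝ g w) / (1 + ‖w‖)))
    + (⨆ w : E, ENNReal.ofReal (bilNorm (D2 g w)))
    + lipD2 g

variable (E) in
/-- The space `M` of test functions. -/
def spaceM : Set (E → ℝ) := {g | TwiceFrechetDifferentiable g ∧ normM g < ∞}

variable (E) in
/-- The subspace `M'` of `M` of functions with bounded second derivative. -/
def spaceM' : Set (E → ℝ) :=
  {g | g ∈ spaceM E ∧ (⨆ w : E, ENNReal.ofReal (bilNorm (D2 g w))) < ∞}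

end TestFunctions

/-! ### The Stein solution and the Stein operator -/

section Stein

variable {T : ℝ} {p : ℕ}

/-- `w e^{-s} + √(1 - e^{-2s}) z`. -/
def ouPoint (w z : Dp T p) (s : ℝ) : Dp T p :=
  Real.exp (-s) • w + √(1 - Real.exp (-2 * s)) • z

/-- `f_g(w) = - ∫_0^∞ (E g(w e^{-s} + √(1 - e^{-2s}) Z) - E g(Z)) ds`. -/
def steinSol {Ω : Type*} [MeasurableSpace Ω] (P : Measure Ω) (Z : Ω → Dp T p)
    (g : Dp T p → ℝ) (w : Dp T p) : ℝ :=
  -∫ s in Set.Ioi (0 : ℝ), ((∫ ω, g (ouPoint w (Z ω) s) ∂P) - ∫ ω, g (Z ω) ∂P)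

/-- `𝒜 f(w) = ∫ D²f(w)[J_u, J_u] Λ(du) - Df(w)[w]`. -/
def steinOp {U : Type*} [MeasurableSpace U] (Λ : Measure U) (J : U → Dp T p)
    (f : Dp T p → ℝ) (w : Dp T p) : ℝ :=
  (∫ u, D2 f w (J u) (J u) ∂Λ) - fderiv ℝ f w w

end Stein

end GaussStein

end

/-!
The function `f_g` and its derivatives are integrals over `Ω × (0, ∞)` of `g`, `Dg`, `D²g` at the
Ornstein–Uhlenbeck interpolation `w e^{-s} + √(1 - e^{-2s}) Z`. A Lipschitz second derivative gives
cubic, quadratic and linear growth of `g`, `Dg`, `D²g` (`exists_growth`), so third moments of `‖Z‖`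
suffice to differentiate under the integral sign (`hasFDerivAt_steinIntegral`,
`hasFDerivAt_fderiv_steinIntegral`). The norm in the definition of `M` tests bilinear forms on the
diagonal only; for symmetric forms polarization loses a factor `2`, and `∫ e^{-2s} ds = 1/2` regains
it.

The third moments are Fernique's theorem. It applies although the space of càdlàg paths is not
separable: `Z` is an almost sure limit of its discretizations along finite sets of times
(`tendsto_discr_of_continuous`), so it is strongly measurable, lives in a separable closed subspace,
and each functional of `Z` is an almost sure limit of centred Gaussian variables, hence centred
Gaussian (`aestronglyMeasurable_and_centredGaussian`). The law of `Z` is then a Gaussian measure on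
a separable Banach space, and its square is invariant under rotations
(`CentredGaussian.rotationInvariant`). Differentiating a rotated pair gives the integration by parts
formula `integral_apply_eq_covTrace`, and the fundamental theorem of calculus along `s` gives the
Stein equation with the second order term in the form `𝔼 D²f_g(w)[Z', Z']`, for an independent copy
`Z'` of `Z` (`covTrace_D2_steinIntegral_sub`).

It remains to show `∫ B[J_u, J_u] Λ(du) = 𝔼 B[Z, Z]` for a bounded symmetric bilinear form `B`
(`integrable_apply_and_integral_eq_covTrace`). For discretized paths this is the covariance
hypothesis, but `J_u` is not continuous and `u ↦ J_u` need not be square integrable in norm, so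
neither the discretizations of `J_u` converge in norm nor is there an obvious dominating function.
Two facts help.
* Every bounded bilinear form has finer and finer discretizations along which it converges
  (`exists_tendsto_discr`). Step functions are dense, and `B` is right continuous along jump
  functions at all but countably many times (`countable_not_tendsto_jump`): for `ε > 0`, only
  boundedly many pairs of times without common components carry bumps of arbitrarily small support
  on which `|B|` exceeds `ε`, because sums of disjoint bumps with suitable signs stay bounded
  (`card_mul_le_of_badPair`). The exceptional times are added to the partitions.
* The `L¹(Λ)`-norm of `B[L₁ J_u, L₂ J_u]`, for linear functions `L₁`, `L₂` of finitely many
  coordinates, is at most `‖B‖ (𝔼‖L₁ Z‖²)^{1/2} (𝔼‖L₂ Z‖²)^{1/2}` (`integral_abs_apply_le`), by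
  splitting the Gaussian vector according to the sign of `B[L₁ J_u, L₂ J_u]`. Hence the discretized
  forms are Cauchy in `L¹(Λ)`, because the discretizations of `Z` converge in `L²`.
-/

noncomputable section

namespace GaussStein

set_option maxSynthPendingDepth 3

/-! ### Growth of test functions -/

section Growth

variable {E : Type*} [NormedAddCommGroup E] [NormedSpace ℝ E]

theorem TwiceFrechetDifferentiable.D2_symm {g : E → ℝ} (hg : TwiceFrechetDifferentiable g)
    (w x y : E) : D2 g w x y = D2 g w y x :=
  second_derivative_symmetric (fun z => (hg.1 z).hasFDerivAt) (hg.2 w).hasFDerivAt x y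

theorem bilNorm_nonneg (A : E →L[ℝ] E →L[ℝ] ℝ) : 0 ≤ bilNorm A :=
  Real.iSup_nonneg fun _ => abs_nonneg _

theorem abs_apply_apply_le_norm {F : Type*} [NormedAddCommGroup F] [NormedSpace ℝ F]
    (A : F →L[ℝ] E →L[ℝ] ℝ) (x : F) (y : E) : |A x y| ≤ ‖A‖ * ‖x‖ * ‖y‖ :=
  A.le_opNorm₂ x y

theorem bilNorm_le_norm (A : E →L[ℝ] E →L[ℝ] ℝ) : bilNorm A ≤ ‖A‖ := by
  refine Real.iSup_le (fun w => ?_) A.opNorm_nonneg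
  simpa [mem_sphere_zero_iff_norm.1 w.2] using abs_apply_apply_le_norm A (w : E) (w : E)

theorem linNorm_le_norm (A : E →L[ℝ] ℝ) : linNorm A ≤ ‖A‖ := by
  refine Real.iSup_le (fun w => ?_) (norm_nonneg _)
  simpa [mem_sphere_zero_iff_norm.1 w.2] using A.le_opNorm (w : E)

theorem abs_apply_self_le_bilNorm (A : E →L[ℝ] E →L[ℝ] ℝ) (w : E) :
    |A w w| ≤ bilNorm A * ‖w‖ ^ 2 := by
  rcases eq_or_ne w 0 with rfl | hw
  · simp
  have hw' : ‖w‖ ≠ 0 := norm_ne_zero_iff.2 hw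
  have hmem : ‖w‖⁻¹ • w ∈ Metric.sphere (0 : E) 1 := by
    simp [norm_smul, hw']
  have hbdd : BddAbove (Set.range fun w : Metric.sphere (0 : E) 1 => |A w w|) := by
    refine ⟨‖A‖, ?_⟩
    rintro _ ⟨v, rfl⟩
    simpa [mem_sphere_zero_iff_norm.1 v.2] using abs_apply_apply_le_norm A (v : E) (v : E)
  have h := le_ciSup hbdd ⟨_, hmem⟩
  have h' : ‖w‖⁻¹ * (‖w‖⁻¹ * |A w w|) ≤ bilNorm A := by
    simpa [bilNorm, abs_mul] using h
  have hpos : 0 < ‖w‖ := norm_pos_iff.2 hw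
  calc |A w w| = (‖w‖⁻¹ * (‖w‖⁻¹ * |A w w|)) * ‖w‖ ^ 2 := by field_simp
    _ ≤ _ := by gcongr

/-- Polarization: the supremum of a symmetric bilinear form over the diagonal controls its
operator norm, with the constant `2`. -/
theorem norm_le_two_mul_bilNorm {A : E →L[ℝ] E →L[ℝ] ℝ} (hA : ∀ x y, A x y = A y x) :
    ‖A‖ ≤ 2 * bilNorm A := by
  have hb := bilNorm_nonneg A
  have key : ∀ x y : E, ‖x‖ = 1 → ‖y‖ = 1 → |A x y| ≤ 2 * bilNorm A := by
    intro x y hx hy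
    have h1 := abs_apply_self_le_bilNorm A (x + y)
    have h2 := abs_apply_self_le_bilNorm A (x - y)
    have e : A x y = (A (x + y) (x + y) - A (x - y) (x - y)) / 4 := by
      simp only [map_add, map_sub, add_apply, sub_apply]
      rw [hA y x]; ring
    have n1 : ‖x + y‖ ≤ 2 := (norm_add_le _ _).trans (by rw [hx, hy]; norm_num)
    have n2 : ‖x - y‖ ≤ 2 := (norm_sub_le _ _).trans (by rw [hx, hy]; norm_num)
    have m1 : bilNorm A * ‖x + y‖ ^ 2 ≤ bilNorm A * 2 ^ 2 := by gcongr
    have m2 : bilNorm A * ‖x - y‖ ^ 2 ≤ bilNorm A * 2 ^ 2 := by gcongr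
    rw [e, abs_le]
    have := abs_le.1 h1
    have := abs_le.1 h2
    constructor <;> linarith
  refine A.opNorm_le_bound₂ (by positivity) fun x y => ?_
  rcases eq_or_ne x 0 with rfl | hx
  · simp
  rcases eq_or_ne y 0 with rfl | hy
  · simp
  have hx' : ‖x‖ ≠ 0 := norm_ne_zero_iff.2 hx
  have hy' : ‖y‖ ≠ 0 := norm_ne_zero_iff.2 hy
  have h := key (‖x‖⁻¹ • x) (‖y‖⁻¹ • y) (by simp [norm_smul, hx']) (by simp [norm_smul, hy'])
  have h' : ‖y‖⁻¹ * (‖x‖⁻¹ * |A x y|) ≤ 2 * bilNorm A := by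
    simpa [abs_mul, mul_left_comm] using h
  calc ‖A x y‖ = (‖y‖⁻¹ * (‖x‖⁻¹ * |A x y|)) * ‖x‖ * ‖y‖ := by
        rw [Real.norm_eq_abs]; field_simp
    _ ≤ _ := by gcongr

theorem bilNorm_D2_sub_le {g : E → ℝ} (hg : lipD2 g ≠ ∞) (w h : E) :
    bilNorm (D2 g (w + h) - D2 g w) ≤ (lipD2 g).toReal * ‖h‖ := by
  rcases eq_or_ne h 0 with rfl | hh
  · simp [bilNorm]
  have h1 : ENNReal.ofReal (bilNorm (D2 g (w + h) - D2 g w) / ‖h‖) ≤ lipD2 g :=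
    le_iSup₂ (f := fun w h : E => ENNReal.ofReal (bilNorm (D2 g (w + h) - D2 g w) / ‖h‖)) w h
  have h2 := (ENNReal.ofReal_le_iff_le_toReal hg).1 h1
  rwa [div_le_iff₀ (norm_pos_iff.2 hh)] at h2

theorem norm_D2_sub_le {g : E → ℝ} (hg : TwiceFrechetDifferentiable g) (hlip : lipD2 g ≠ ∞)
    (w h : E) : ‖D2 g (w + h) - D2 g w‖ ≤ 2 * (lipD2 g).toReal * ‖h‖ := by
  have := norm_le_two_mul_bilNorm (A := D2 g (w + h) - D2 g w)
    (fun x y => by simp [hg.D2_symm w x y, hg.D2_symm (w + h) x y])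
  have := bilNorm_D2_sub_le hlip w h
  linarith

theorem continuous_D2 {g : E → ℝ} {K : ℝ} (hK : ∀ w h, ‖D2 g (w + h) - D2 g w‖ ≤ K * ‖h‖) :
    Continuous (D2 g) := by
  have hL : LipschitzWith K.toNNReal (D2 g) := by
    refine LipschitzWith.of_dist_le_mul fun x y => ?_
    rw [dist_eq_norm, dist_eq_norm]
    have := hK y (x - y)
    rw [add_sub_cancel] at this
    exact this.trans (mul_le_mul_of_nonneg_right (Real.le_coe_toNNReal K) (norm_nonneg _))
  exact hL.continuous

/-- A bound for the derivative that is nondecreasing in the norm of the argument integrates to a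
bound for the function. -/
theorem norm_le_of_norm_fderiv_le {F : Type*} [NormedAddCommGroup F] [NormedSpace ℝ F]
    {f : E → F} (hf : Differentiable ℝ f) {C : ℝ} {k : ℕ} (hC : 0 ≤ C)
    (hb : ∀ w, ‖fderiv ℝ f w‖ ≤ C * (1 + ‖w‖) ^ k) (w : E) :
    ‖f w‖ ≤ (‖f 0‖ + C) * (1 + ‖w‖) ^ (k + 1) := by
  have h := (convex_closedBall (0 : E) ‖w‖).norm_image_sub_le_of_norm_fderiv_le
    (f := f) (C := C * (1 + ‖w‖) ^ k) (x := 0) (y := w) (fun x _ => hf x)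
    (fun x hx => (hb x).trans (by
      have : ‖x‖ ≤ ‖w‖ := by simpa using hx
      gcongr)) (by simp) (by simp)
  have h1 : (1 : ℝ) ≤ (1 + ‖w‖) ^ (k + 1) := one_le_pow₀ (by linarith [norm_nonneg w])
  have h2 : ‖f w‖ ≤ ‖f 0‖ + ‖f w - f 0‖ := by
    simpa using norm_add_le (f 0) (f w - f 0)
  rw [sub_zero] at h
  calc ‖f w‖ ≤ ‖f 0‖ * 1 + C * (1 + ‖w‖) ^ k * ‖w‖ := by linarith
    _ ≤ ‖f 0‖ * (1 + ‖w‖) ^ (k + 1) + C * (1 + ‖w‖) ^ k * (1 + ‖w‖) := by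
        gcongr
        linarith
    _ = _ := by ring

/-- A twice differentiable function whose second derivative is Lipschitz grows at most cubically,
with correspondingly slower growth of its derivatives. -/
theorem exists_growth {g : E → ℝ} (hg : TwiceFrechetDifferentiable g) {K : ℝ}
    (hK : ∀ w h, ‖D2 g (w + h) - D2 g w‖ ≤ K * ‖h‖) :
    ∃ C, 0 ≤ C ∧ (∀ w, |g w| ≤ C * (1 + ‖w‖) ^ 3) ∧ (∀ w, ‖fderiv ℝ g w‖ ≤ C * (1 + ‖w‖) ^ 2) ∧
      ∀ w, ‖D2 g w‖ ≤ C * (1 + ‖w‖) := by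
  have h2 : ∀ w, ‖D2 g w‖ ≤ (‖D2 g 0‖ + |K|) * (1 + ‖w‖) ^ 1 := by
    intro w
    have h := hK 0 w
    rw [zero_add] at h
    have h' : ‖D2 g w‖ ≤ ‖D2 g 0‖ + ‖D2 g w - D2 g 0‖ :=
      norm_le_norm_add_norm_sub' (D2 g w) (D2 g 0)
    have : K * ‖w‖ ≤ |K| * ‖w‖ := by gcongr; exact le_abs_self K
    nlinarith [norm_nonneg w, abs_nonneg K, norm_nonneg (D2 g 0),
      mul_nonneg (norm_nonneg (D2 g 0)) (norm_nonneg w)]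
  have h1 := norm_le_of_norm_fderiv_le hg.2 (by positivity) h2
  have h0 := norm_le_of_norm_fderiv_le hg.1 (by positivity) h1
  refine ⟨‖g 0‖ + (‖fderiv ℝ g 0‖ + (‖D2 g 0‖ + |K|)), by positivity, fun w => h0 w,
    fun w => (h1 w).trans ?_, fun w => ((h2 w).trans_eq (by rw [pow_one])).trans ?_⟩
  · refine mul_le_mul_of_nonneg_right ?_ (by positivity)
    linarith [norm_nonneg (g 0)]
  · refine mul_le_mul_of_nonneg_right ?_ (by positivity)
    linarith [norm_nonneg (g 0), norm_nonneg (fderiv ℝ g 0)]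

theorem iSup_ofReal_lt_top {ι : Type*} {f : ι → ℝ} {C : ℝ} (h : ∀ i, f i ≤ C) :
    (⨆ i, ENNReal.ofReal (f i)) < ∞ :=
  (iSup_le fun i => ENNReal.ofReal_le_ofReal (h i)).trans_lt ENNReal.ofReal_lt_top

theorem lipD2_lt_top {g : E → ℝ} {K : ℝ} (hK0 : 0 ≤ K)
    (hK : ∀ w h, ‖D2 g (w + h) - D2 g w‖ ≤ K * ‖h‖) : lipD2 g < ∞ := by
  refine (iSup₂_le (a := ENNReal.ofReal K) fun w h => ENNReal.ofReal_le_ofReal ?_).trans_lt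
    ENNReal.ofReal_lt_top
  exact div_le_of_le_mul₀ (norm_nonneg _) hK0 ((bilNorm_le_norm _).trans (hK w h))

/-- Membership in `M` follows from the Lipschitz bound for the second derivative alone: the other
three terms of the norm are then finite. -/
theorem mem_spaceM_of_lipschitz {g : E → ℝ} (hg : TwiceFrechetDifferentiable g) {K : ℝ}
    (hK0 : 0 ≤ K) (hK : ∀ w h, ‖D2 g (w + h) - D2 g w‖ ≤ K * ‖h‖) : g ∈ spaceM E := by
  obtain ⟨C, hC, h0, h1, h2⟩ := exists_growth hg hK
  have hn : ∀ w : E, 0 ≤ ‖w‖ := fun w => norm_nonneg w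
  refine ⟨hg, ENNReal.add_lt_top.2 ⟨ENNReal.add_lt_top.2 ⟨ENNReal.add_lt_top.2
    ⟨iSup_ofReal_lt_top (C := 4 * C) fun w => ?_, iSup_ofReal_lt_top (C := 2 * C) fun w => ?_⟩,
    iSup_ofReal_lt_top (C := C) fun w => ?_⟩, lipD2_lt_top hK0 hK⟩⟩
  · have hw := hn w
    rw [div_le_iff₀ (by positivity)]
    have : (1 + ‖w‖) ^ 3 ≤ 4 * (1 + ‖w‖ ^ 3) := by
      nlinarith [mul_nonneg (add_nonneg zero_le_one hw) (sq_nonneg (‖w‖ - 1))]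
    calc _ ≤ C * (1 + ‖w‖) ^ 3 := h0 w
      _ ≤ C * (4 * (1 + ‖w‖ ^ 3)) := by gcongr
      _ = _ := by ring
  · have hw := hn w
    rw [div_le_iff₀ (by positivity)]
    have : (1 + ‖w‖) ^ 2 ≤ 2 * (1 + ‖w‖ ^ 2) := by nlinarith [sq_nonneg (‖w‖ - 1)]
    calc _ ≤ C * (1 + ‖w‖) ^ 2 := (linNorm_le_norm _).trans (h1 w)
      _ ≤ C * (2 * (1 + ‖w‖ ^ 2)) := by gcongr
      _ = _ := by ring
  · have hw := hn w
    rw [div_le_iff₀ (by positivity)]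
    exact (bilNorm_le_norm _).trans (h2 w)

theorem lipD2_ne_top {g : E → ℝ} (hg : g ∈ spaceM E) : lipD2 g ≠ ∞ :=
  (lt_of_le_of_lt le_add_self hg.2).ne

theorem lipD2_toReal_le_normM {g : E → ℝ} (hg : g ∈ spaceM E) :
    (lipD2 g).toReal ≤ (normM g).toReal :=
  ENNReal.toReal_mono hg.2.ne le_add_self

/-- The best bound for the second derivative on the diagonal is a real number for `g ∈ M'`. -/
theorem bilNorm_D2_le_of_mem_spaceM' {g : E → ℝ} (hg : g ∈ spaceM' E) (w : E) :
    bilNorm (D2 g w) ≤ (⨆ w : E, ENNReal.ofReal (bilNorm (D2 g w))).toReal :=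
  (ENNReal.ofReal_le_iff_le_toReal hg.2.ne).1
    (le_iSup (fun w : E => ENNReal.ofReal (bilNorm (D2 g w))) w)

theorem normM'_lt_top {g : E → ℝ} (hg : g ∈ spaceM' E) : normM' g < ∞ := by
  set b := (⨆ w : E, ENNReal.ofReal (bilNorm (D2 g w))).toReal with hb
  have hb0 : 0 ≤ b := ENNReal.toReal_nonneg
  have h2 : ∀ w, ‖fderiv ℝ (fderiv ℝ g) w‖ ≤ (2 * b) * (1 + ‖w‖) ^ 0 := fun w => by
    have := bilNorm_D2_le_of_mem_spaceM' hg w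
    have h := norm_le_two_mul_bilNorm (A := D2 g w) (hg.1.1.D2_symm w)
    change ‖D2 g w‖ ≤ _
    rw [pow_zero, mul_one]
    linarith
  have h1 := norm_le_of_norm_fderiv_le hg.1.1.2 (by positivity) h2
  have h0 := norm_le_of_norm_fderiv_le hg.1.1.1 (by positivity) h1
  set C := ‖fderiv ℝ g 0‖ + 2 * b with hC
  have hC0 : 0 ≤ C := by positivity
  refine ENNReal.add_lt_top.2 ⟨ENNReal.add_lt_top.2 ⟨ENNReal.add_lt_top.2
    ⟨iSup_ofReal_lt_top (C := 2 * (‖g 0‖ + C)) fun w => ?_,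
      iSup_ofReal_lt_top (C := C) fun w => ?_⟩, hg.2⟩, (lipD2_ne_top hg.1).lt_top⟩
  · rw [div_le_iff₀ (by positivity)]
    have : (1 + ‖w‖) ^ 2 ≤ 2 * (1 + ‖w‖ ^ 2) := by nlinarith [sq_nonneg (‖w‖ - 1)]
    calc _ ≤ (‖g 0‖ + C) * (1 + ‖w‖) ^ 2 := h0 w
      _ ≤ (‖g 0‖ + C) * (2 * (1 + ‖w‖ ^ 2)) := by gcongr
      _ = _ := by ring
  · rw [div_le_iff₀ (by positivity)]
    simpa using (linNorm_le_norm _).trans (h1 w)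

theorem toReal_iSup_bilNorm_le_normM' {g : E → ℝ} (hg : g ∈ spaceM' E) :
    (⨆ w : E, ENNReal.ofReal (bilNorm (D2 g w))).toReal ≤ (normM' g).toReal :=
  ENNReal.toReal_mono (normM'_lt_top hg).ne (le_add_self.trans le_self_add)

end Growth

/-! ### The Ornstein–Uhlenbeck interpolation -/

section OrnsteinUhlenbeck

variable {E : Type*} [NormedAddCommGroup E] [NormedSpace ℝ E]

/-- `w e^{-s} + √(1 - e^{-2s}) z` in a normed space. On càdlàg paths it is `ouPoint` by
definition. -/
def ouInterp (w z : E) (s : ℝ) : E :=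
  Real.exp (-s) • w + √(1 - Real.exp (-2 * s)) • z

theorem exp_neg_two_mul_eq (s : ℝ) : Real.exp (-2 * s) = Real.exp (-s) * Real.exp (-s) := by
  rw [← Real.exp_add]; ring_nf

theorem sqrt_one_sub_exp_le_one (s : ℝ) : √(1 - Real.exp (-2 * s)) ≤ 1 := by
  rw [Real.sqrt_le_one]
  linarith [Real.exp_pos (-2 * s)]

theorem norm_ouInterp_le (w z : E) {s : ℝ} (hs : 0 ≤ s) : ‖ouInterp w z s‖ ≤ ‖w‖ + ‖z‖ := by
  have h1 : Real.exp (-s) ≤ 1 := Real.exp_le_one_iff.2 (by linarith)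
  have h2 := sqrt_one_sub_exp_le_one s
  refine (norm_add_le _ _).trans (add_le_add ?_ ?_)
  · rw [norm_smul, Real.norm_of_nonneg (Real.exp_pos _).le]
    exact mul_le_of_le_one_left (norm_nonneg _) h1
  · rw [norm_smul, Real.norm_of_nonneg (Real.sqrt_nonneg _)]
    exact mul_le_of_le_one_left (norm_nonneg _) h2

theorem norm_ouInterp_sub_le (w z : E) {s : ℝ} (hs : 0 ≤ s) :
    ‖ouInterp w z s - z‖ ≤ Real.exp (-s) * (‖w‖ + ‖z‖) := by
  have h1 : Real.exp (-s) ≤ 1 := Real.exp_le_one_iff.2 (by linarith)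
  have h0 := Real.exp_pos (-s)
  have h2 := sqrt_one_sub_exp_le_one s
  -- `√(1 - y) ≥ 1 - y` for `0 ≤ y ≤ 1`, so the coefficient of `z` is at most `e^{-2s} ≤ e^{-s}`
  have h3 : 1 - Real.exp (-s) ≤ √(1 - Real.exp (-2 * s)) := by
    rw [exp_neg_two_mul_eq]
    exact Real.le_sqrt_of_sq_le (by nlinarith)
  have e : ouInterp w z s - z = Real.exp (-s) • w + (√(1 - Real.exp (-2 * s)) - 1) • z := by
    rw [ouInterp, sub_smul, one_smul]; abel
  rw [e, mul_add]
  refine (norm_add_le _ _).trans (add_le_add ?_ ?_)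
  · rw [norm_smul, Real.norm_of_nonneg h0.le]
  · rw [norm_smul, Real.norm_eq_abs]
    gcongr
    rw [abs_le]
    constructor <;> linarith

theorem continuous_ouInterp : Continuous fun x : E × E × ℝ => ouInterp x.1 x.2.1 x.2.2 := by
  unfold ouInterp
  fun_prop

theorem hasFDerivAt_comp_ouInterp {F : Type*} [NormedAddCommGroup F] [NormedSpace ℝ F]
    {G : E → F} (hG : Differentiable ℝ G) (w z : E) (s : ℝ) :
    HasFDerivAt (fun w => G (ouInterp w z s)) (Real.exp (-s) • fderiv ℝ G (ouInterp w z s)) w := by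
  have h1 : HasFDerivAt (fun w : E => ouInterp w z s)
      (Real.exp (-s) • ContinuousLinearMap.id ℝ (E)) w :=
    ((hasFDerivAt_id w).const_smul (Real.exp (-s))).add_const _
  have h2 := (hG (ouInterp w z s)).hasFDerivAt.comp w h1
  convert! h2 using 1
  ext x
  simp

end OrnsteinUhlenbeck

/-! ### Differentiating the Stein solution -/

section SteinSolution

variable {E : Type*} [NormedAddCommGroup E] {Ω : Type*} [MeasurableSpace Ω] {P : Measure Ω}
  {Z : Ω → E}

theorem integrable_add_norm_pow_three [IsProbabilityMeasure P] (hZ : MemLp Z 3 P) (R : ℝ) :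
    Integrable (fun ω => (R + 2 * ‖Z ω‖) ^ 3) P := by
  have h : MemLp (fun ω => R + 2 * ‖Z ω‖) 3 P :=
    (memLp_const R).add (hZ.norm.const_mul 2)
  have h3 := h.integrable_norm_pow (p := 3) (by norm_num)
  refine (integrable_norm_iff ?_).1 (h3.congr (Eventually.of_forall fun ω => ?_))
  · exact h.aestronglyMeasurable.pow 3
  · simp

theorem integrable_exp_mul_pow_three [IsProbabilityMeasure P] (hZ : MemLp Z 3 P) (R : ℝ) :
    Integrable (fun q : Ω × ℝ => (R + 2 * ‖Z q.1‖) ^ 3 * Real.exp (-q.2))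
      (P.prod (volume.restrict (Set.Ioi 0))) :=
  (integrable_add_norm_pow_three hZ R).mul_prod (integrableOn_exp_neg_Ioi 0)

theorem ae_snd_pos : ∀ᵐ q : Ω × ℝ ∂P.prod (volume.restrict (Set.Ioi 0)), 0 < q.2 :=
  Measure.quasiMeasurePreserving_snd.ae (ae_restrict_mem measurableSet_Ioi)

theorem integrable_prod_of_norm_le [IsProbabilityMeasure P] {F : Type*}
    [NormedAddCommGroup F] (hZ : MemLp Z 3 P)
    {f : Ω × ℝ → F} {C R : ℝ}
    (hf : AEStronglyMeasurable f (P.prod (volume.restrict (Set.Ioi 0))))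
    (hb : ∀ ω s, 0 < s → ‖f (ω, s)‖ ≤ C * ((R + 2 * ‖Z ω‖) ^ 3 * Real.exp (-s))) :
    Integrable f (P.prod (volume.restrict (Set.Ioi 0))) := by
  refine ((integrable_exp_mul_pow_three hZ R).const_mul C).mono' hf ?_
  filter_upwards [ae_snd_pos] with q hq using hb q.1 q.2 hq

theorem integrable_comp_of_cubic [IsProbabilityMeasure P] {F : Type*}
    [NormedAddCommGroup F] (hZ : MemLp Z 3 P)
    {G : E → F} (hG : Continuous G) {C : ℝ} (hC : 0 ≤ C)
    (hb : ∀ x, ‖G x‖ ≤ C * (1 + ‖x‖) ^ 3) : Integrable (fun ω => G (Z ω)) P := by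
  refine ((integrable_add_norm_pow_three hZ 1).const_mul C).mono'
    (hG.comp_aestronglyMeasurable hZ.1) (Eventually.of_forall fun ω => (hb _).trans ?_)
  have := norm_nonneg (Z ω)
  gcongr
  linarith

variable [NormedSpace ℝ E]

theorem aestronglyMeasurable_ouInterp (hZ : AEStronglyMeasurable Z P) (w : E) (s : ℝ) :
    AEStronglyMeasurable (fun ω => ouInterp w (Z ω) s) P :=
  (continuous_ouInterp.comp
    (by fun_prop : Continuous fun z : E => (w, z, s))).comp_aestronglyMeasurable hZ

theorem aestronglyMeasurable_ouInterp_prod [IsProbabilityMeasure P]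
    (hZ : AEStronglyMeasurable Z P) (w : E) :
    AEStronglyMeasurable (fun q : Ω × ℝ => ouInterp w (Z q.1) q.2)
      (P.prod (volume.restrict (Set.Ioi 0))) := by
  have h1 : AEStronglyMeasurable (fun q : Ω × ℝ => (Z q.1, q.2))
      (P.prod (volume.restrict (Set.Ioi (0 : ℝ)))) :=
    hZ.comp_fst.prodMk measurable_snd.aestronglyMeasurable
  exact (continuous_ouInterp.comp
    (by fun_prop : Continuous fun x : E × ℝ => (w, x.1, x.2))).comp_aestronglyMeasurable h1

/-- A cubically growing continuous function of the Ornstein–Uhlenbeck interpolation is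
integrable. -/
theorem integrable_comp_ouInterp [IsProbabilityMeasure P] {F : Type*}
    [NormedAddCommGroup F] (hZ : MemLp Z 3 P)
    {G : E → F} (hG : Continuous G) {C : ℝ} (hC : 0 ≤ C)
    (hb : ∀ x, ‖G x‖ ≤ C * (1 + ‖x‖) ^ 3) (w : E) {s : ℝ} (hs : 0 ≤ s) :
    Integrable (fun ω => G (ouInterp w (Z ω) s)) P := by
  refine ((integrable_add_norm_pow_three hZ (1 + ‖w‖)).const_mul C).mono'
    (hG.comp_aestronglyMeasurable (aestronglyMeasurable_ouInterp hZ.1 w s))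
    (Eventually.of_forall fun ω => (hb _).trans ?_)
  have h1 := norm_ouInterp_le w (Z ω) hs
  have hz := norm_nonneg (Z ω)
  have h2 : 1 + ‖ouInterp w (Z ω) s‖ ≤ 1 + ‖w‖ + 2 * ‖Z ω‖ := by linarith
  gcongr C * ?_ ^ 3

theorem integrable_exp_smul_comp_ouInterp [IsProbabilityMeasure P] {F : Type*}
    [NormedAddCommGroup F] [NormedSpace ℝ F]
    (hZ : MemLp Z 3 P) {G : E → F} (hG : Continuous G) {C : ℝ} (hC : 0 ≤ C)
    (hb : ∀ x, ‖G x‖ ≤ C * (1 + ‖x‖) ^ 2) {c : ℝ → ℝ} (hc : Continuous c)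
    (hc' : ∀ s, 0 < s → |c s| ≤ Real.exp (-s)) (w : E) :
    Integrable (fun q : Ω × ℝ => c q.2 • G (ouInterp w (Z q.1) q.2))
      (P.prod (volume.restrict (Set.Ioi 0))) := by
  refine integrable_prod_of_norm_le hZ (C := C) (R := 1 + ‖w‖)
    ((hc.comp_aestronglyMeasurable measurable_snd.aestronglyMeasurable).smul
      (hG.comp_aestronglyMeasurable (aestronglyMeasurable_ouInterp_prod hZ.1 w)))
    fun ω s hs => ?_
  have h1 := norm_ouInterp_le w (Z ω) hs.le
  have hz := norm_nonneg (Z ω)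
  have hw := norm_nonneg w
  have h2 : (1 + ‖ouInterp w (Z ω) s‖) ^ 2 ≤ (1 + ‖w‖ + 2 * ‖Z ω‖) ^ 3 :=
    calc (1 + ‖ouInterp w (Z ω) s‖) ^ 2 ≤ (1 + ‖w‖ + 2 * ‖Z ω‖) ^ 2 :=
          pow_le_pow_left₀ (by positivity) (by linarith) 2
      _ ≤ _ := pow_le_pow_right₀ (by linarith) (by norm_num)
  rw [norm_smul, Real.norm_eq_abs]
  calc |c s| * ‖G (ouInterp w (Z ω) s)‖ ≤ Real.exp (-s) * (C * (1 + ‖w‖ + 2 * ‖Z ω‖) ^ 3) := by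
        gcongr
        · exact hc' s hs
        · exact (hb _).trans (by gcongr)
    _ = _ := by ring

/-- Differentiation of `∫ (c(s) G(w e^{-s} + √(1 - e^{-2s}) Z) - H)` in `w` under the integral
sign; each derivative produces one factor `e^{-s}`. -/
theorem hasFDerivAt_integral_ouInterp [IsProbabilityMeasure P] {F : Type*}
    [NormedAddCommGroup F] [NormedSpace ℝ F]
    (hZ : MemLp Z 3 P) {G : E → F} (hG : Differentiable ℝ G)
    (hG' : Continuous (fderiv ℝ G)) {C : ℝ} (hC : 0 ≤ C)
    (hb : ∀ x, ‖fderiv ℝ G x‖ ≤ C * (1 + ‖x‖) ^ 2) {c : ℝ → ℝ} (hc : Continuous c)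
    (hc' : ∀ s, 0 < s → |c s| ≤ 1) (H : Ω × ℝ → F)
    (hint : ∀ w, Integrable (fun q : Ω × ℝ => c q.2 • G (ouInterp w (Z q.1) q.2) - H q)
      (P.prod (volume.restrict (Set.Ioi 0)))) (w : E) :
    HasFDerivAt (fun w => ∫ q : Ω × ℝ, (c q.2 • G (ouInterp w (Z q.1) q.2) - H q)
        ∂P.prod (volume.restrict (Set.Ioi 0)))
      (∫ q : Ω × ℝ, (c q.2 * Real.exp (-q.2)) • fderiv ℝ G (ouInterp w (Z q.1) q.2)
        ∂P.prod (volume.restrict (Set.Ioi 0))) w := by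
  refine hasFDerivAt_integral_of_dominated_of_fderiv_le (𝕜 := ℝ)
    (s := Metric.ball w 1)
    (F' := fun w q => (c q.2 * Real.exp (-q.2)) • fderiv ℝ G (ouInterp w (Z q.1) q.2))
    (bound := fun q => C * ((2 + ‖w‖ + 2 * ‖Z q.1‖) ^ 3 * Real.exp (-q.2)))
    (Metric.ball_mem_nhds w one_pos) (Eventually.of_forall fun x => (hint x).1) (hint w) ?_ ?_
    ((integrable_exp_mul_pow_three hZ _).const_mul C) ?_
  · refine (integrable_exp_smul_comp_ouInterp hZ hG' hC hb
      (c := fun s => c s * Real.exp (-s)) (by fun_prop) (fun s hs => ?_) w).1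
    rw [abs_mul, abs_of_pos (Real.exp_pos _)]
    exact mul_le_of_le_one_left (Real.exp_pos _).le (hc' s hs)
  · filter_upwards [ae_snd_pos] with q hq x hx
    have hx' : ‖x‖ ≤ 1 + ‖w‖ := by
      have h1 : ‖x - w‖ < 1 := by simpa [dist_eq_norm] using hx
      linarith [norm_le_norm_add_norm_sub' x w]
    have h1 := norm_ouInterp_le x (Z q.1) hq.le
    have hz := norm_nonneg (Z q.1)
    have hw := norm_nonneg w
    have h2 : (1 + ‖ouInterp x (Z q.1) q.2‖) ^ 2 ≤ (2 + ‖w‖ + 2 * ‖Z q.1‖) ^ 3 :=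
      calc (1 + ‖ouInterp x (Z q.1) q.2‖) ^ 2 ≤ (2 + ‖w‖ + 2 * ‖Z q.1‖) ^ 2 :=
          pow_le_pow_left₀ (by positivity) (by linarith) 2
        _ ≤ _ := pow_le_pow_right₀ (by linarith) (by norm_num)
    rw [norm_smul, norm_mul, Real.norm_eq_abs, Real.norm_of_nonneg (Real.exp_pos _).le]
    calc |c q.2| * Real.exp (-q.2) * ‖fderiv ℝ G (ouInterp x (Z q.1) q.2)‖
        ≤ 1 * Real.exp (-q.2) * (C * (2 + ‖w‖ + 2 * ‖Z q.1‖) ^ 3) := by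
          gcongr
          · exact hc' _ hq
          · exact (hb _).trans (by gcongr)
      _ = _ := by ring
  · refine Eventually.of_forall fun q x _ => ?_
    have h := ((hasFDerivAt_comp_ouInterp hG x (Z q.1) q.2).const_smul (c q.2)).sub_const (H q)
    rwa [smul_smul] at h

/-- The Stein solution for a random element of a normed space. On càdlàg paths it is `steinSol` by
definition. -/
def steinIntegral (P : Measure Ω) (Z : Ω → E) (g : E → ℝ) (w : E) : ℝ :=
  -∫ s in Set.Ioi (0 : ℝ), ((∫ ω, g (ouInterp w (Z ω) s) ∂P) - ∫ ω, g (Z ω) ∂P)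

variable {g : E → ℝ} {C : ℝ}

theorem integrable_comp_ouInterp_sub [IsProbabilityMeasure P] (hZ : MemLp Z 3 P)
    (hg : Differentiable ℝ g) (hC : 0 ≤ C)
    (hb : ∀ x, ‖fderiv ℝ g x‖ ≤ C * (1 + ‖x‖) ^ 2) (w : E) :
    Integrable (fun q : Ω × ℝ => g (ouInterp w (Z q.1) q.2) - g (Z q.1))
      (P.prod (volume.restrict (Set.Ioi 0))) := by
  refine integrable_prod_of_norm_le hZ (C := C) (R := 1 + ‖w‖) ?_ fun ω s hs => ?_
  · exact (hg.continuous.comp_aestronglyMeasurable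
      (aestronglyMeasurable_ouInterp_prod hZ.1 w)).sub
        (hg.continuous.comp_aestronglyMeasurable hZ.1.comp_fst)
  have hz := norm_nonneg (Z ω)
  have hw := norm_nonneg w
  have h1 := (convex_closedBall (0 : E) (‖w‖ + ‖Z ω‖)).norm_image_sub_le_of_norm_fderiv_le
    (f := g) (C := C * (1 + (‖w‖ + ‖Z ω‖)) ^ 2) (x := Z ω) (y := ouInterp w (Z ω) s)
    (fun x _ => hg x)
    (fun x hx => (hb x).trans (by
      have : ‖x‖ ≤ ‖w‖ + ‖Z ω‖ := by simpa using hx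
      gcongr)) (by simp) (by simpa using norm_ouInterp_le w (Z ω) hs.le)
  refine h1.trans ?_
  calc C * (1 + (‖w‖ + ‖Z ω‖)) ^ 2 * ‖ouInterp w (Z ω) s - Z ω‖
      ≤ C * (1 + ‖w‖ + 2 * ‖Z ω‖) ^ 2 * (Real.exp (-s) * (1 + ‖w‖ + 2 * ‖Z ω‖)) := by
        refine mul_le_mul (mul_le_mul_of_nonneg_left
          (pow_le_pow_left₀ (by positivity) (by linarith) 2) hC) ?_ (norm_nonneg _) (by positivity)
        exact (norm_ouInterp_sub_le w (Z ω) hs.le).trans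
          (mul_le_mul_of_nonneg_left (by linarith) (Real.exp_pos _).le)
    _ = _ := by ring

/-- The Stein solution as one integral over the product space. -/
theorem steinIntegral_eq_integral_prod [IsProbabilityMeasure P] (hZ : MemLp Z 3 P)
    (hg : Differentiable ℝ g) (hC : 0 ≤ C)
    (h0 : ∀ x, |g x| ≤ C * (1 + ‖x‖) ^ 3)
    (hb : ∀ x, ‖fderiv ℝ g x‖ ≤ C * (1 + ‖x‖) ^ 2) (w : E) :
    steinIntegral P Z g w = -∫ q : Ω × ℝ, (g (ouInterp w (Z q.1) q.2) - g (Z q.1))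
      ∂P.prod (volume.restrict (Set.Ioi 0)) := by
  rw [steinIntegral, integral_prod_symm _ (integrable_comp_ouInterp_sub hZ hg hC hb w)]
  congr 1
  refine setIntegral_congr_fun measurableSet_Ioi fun s hs => ?_
  exact (integral_sub (integrable_comp_ouInterp hZ hg.continuous hC h0 w (le_of_lt hs))
    (integrable_comp_of_cubic hZ hg.continuous hC h0)).symm

theorem hasFDerivAt_steinIntegral [IsProbabilityMeasure P] (hZ : MemLp Z 3 P)
    (hg : Differentiable ℝ g)
    (hg' : Continuous (fderiv ℝ g)) (hC : 0 ≤ C)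
    (h0 : ∀ x, |g x| ≤ C * (1 + ‖x‖) ^ 3)
    (hb : ∀ x, ‖fderiv ℝ g x‖ ≤ C * (1 + ‖x‖) ^ 2) (w : E) :
    HasFDerivAt (steinIntegral P Z g)
      (-∫ q : Ω × ℝ, Real.exp (-q.2) • fderiv ℝ g (ouInterp w (Z q.1) q.2)
        ∂P.prod (volume.restrict (Set.Ioi 0))) w := by
  have h := hasFDerivAt_integral_ouInterp hZ hg hg' hC hb (c := fun _ => 1) continuous_const
    (fun _ _ => by simp) (fun q => g (Z q.1))
    (by simpa using integrable_comp_ouInterp_sub hZ hg hC hb) w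
  simp only [one_smul, one_mul] at h
  rw [funext (steinIntegral_eq_integral_prod hZ hg hC h0 hb)]
  exact h.neg

theorem hasFDerivAt_fderiv_steinIntegral [IsProbabilityMeasure P] (hZ : MemLp Z 3 P)
    (hg : TwiceFrechetDifferentiable g)
    (hg' : Continuous (D2 g)) (hC : 0 ≤ C)
    (h0 : ∀ x, |g x| ≤ C * (1 + ‖x‖) ^ 3)
    (h1 : ∀ x, ‖fderiv ℝ g x‖ ≤ C * (1 + ‖x‖) ^ 2)
    (h2 : ∀ x, ‖D2 g x‖ ≤ C * (1 + ‖x‖)) (w : E) :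
    HasFDerivAt (fderiv ℝ (steinIntegral P Z g))
      (-∫ q : Ω × ℝ, Real.exp (-2 * q.2) • D2 g (ouInterp w (Z q.1) q.2)
        ∂P.prod (volume.restrict (Set.Ioi 0))) w := by
  have h2' : ∀ x, ‖fderiv ℝ (fderiv ℝ g) x‖ ≤ C * (1 + ‖x‖) ^ 2 := fun x =>
    (h2 x).trans (by
      have := norm_nonneg x
      gcongr
      exact le_self_pow₀ (by linarith) (by norm_num))
  have hint := integrable_exp_smul_comp_ouInterp hZ hg.2.continuous hC h1
    (c := fun s => Real.exp (-s)) (by fun_prop) (fun s _ => by simp)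
  have h := hasFDerivAt_integral_ouInterp hZ hg.2 hg' hC h2' (c := fun s => Real.exp (-s))
    (by fun_prop) (fun s hs => by simpa using hs.le) (fun _ => 0) (by simpa using hint) w
  simp only [sub_zero, ← exp_neg_two_mul_eq] at h
  rw [funext fun x => (hasFDerivAt_steinIntegral hZ hg.1 hg.2.continuous hC h0 h1 x).fderiv]
  exact h.neg

end SteinSolution

/-! ### Gaussian integration by parts -/

section IntegrationByParts

variable {E : Type*} [NormedAddCommGroup E] {Ω : Type*} [MeasurableSpace Ω]
  {P : Measure Ω} {Z : Ω → E}

theorem integrable_one_add_norm_add_norm_pow_three [IsProbabilityMeasure P] (hZ : MemLp Z 3 P) :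
    Integrable (fun q : Ω × Ω => (1 + (‖Z q.1‖ + ‖Z q.2‖)) ^ 3) (P.prod P) := by
  have hm1 : MemLp (fun q : Ω × Ω => ‖Z q.1‖) 3 (P.prod P) := hZ.norm.comp_fst P
  have hm2 : MemLp (fun q : Ω × Ω => ‖Z q.2‖) 3 (P.prod P) := hZ.norm.comp_snd P
  have hm0 : MemLp (fun _ : Ω × Ω => (1 : ℝ)) 3 (P.prod P) := memLp_const 1
  have hm : MemLp (fun q : Ω × Ω => 1 + (‖Z q.1‖ + ‖Z q.2‖)) 3 (P.prod P) :=
    hm0.add (hm1.add hm2)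
  refine (hm.integrable_norm_pow (p := 3) (by norm_num)).congr (Eventually.of_forall fun q => ?_)
  have h : 0 ≤ 1 + (‖Z q.1‖ + ‖Z q.2‖) := by positivity
  change ‖1 + (‖Z q.1‖ + ‖Z q.2‖)‖ ^ 3 = _
  rw [Real.norm_of_nonneg h]

variable [NormedSpace ℝ E]

theorem continuous_apply_apply {X : Type*} [TopologicalSpace X] {A : X → E →L[ℝ] E →L[ℝ] ℝ}
    {u v : X → E} (hA : Continuous A) (hu : Continuous u) (hv : Continuous v) :
    Continuous fun x => A x (u x) (v x) := by
  have h1 : Continuous fun x => A x (u x) := hA.clm_apply hu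
  exact h1.clm_apply hv

theorem continuous_apply_rotated {A : E → E →L[ℝ] E →L[ℝ] ℝ} (hA : Continuous A) (a : E)
    (σ b c d e : ℝ) : Continuous fun x : E × E =>
      A (a + σ • (b • x.1 + c • x.2)) (σ • (d • x.1 + e • x.2)) (d • x.1 + e • x.2) := by
  have hu : Continuous fun x : E × E => a + σ • (b • x.1 + c • x.2) := by fun_prop
  have hv : Continuous fun x : E × E => d • x.1 + e • x.2 := by fun_prop
  exact continuous_apply_apply (hA.comp hu) (hv.const_smul σ) hv

theorem aestronglyMeasurable_apply_apply {α : Type*} [MeasurableSpace α] {μ : Measure α}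
    (B : E →L[ℝ] E →L[ℝ] ℝ) {X Y : α → E} (hX : AEStronglyMeasurable X μ)
    (hY : AEStronglyMeasurable Y μ) : AEStronglyMeasurable (fun ω => B (X ω) (Y ω)) μ :=
  (continuous_apply_apply continuous_const continuous_fst continuous_snd :
    Continuous fun x : E × E => B x.1 x.2).comp_aestronglyMeasurable (hX.prodMk hY)

theorem integrable_apply_apply {α : Type*} [MeasurableSpace α] {μ : Measure α}
    (B : E →L[ℝ] E →L[ℝ] ℝ) {X Y : α → E} (hX : MemLp X 2 μ)
    (hY : MemLp Y 2 μ) : Integrable (fun ω => B (X ω) (Y ω)) μ := by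
  refine ((hX.norm.integrable_mul hY.norm).const_mul ‖B‖).mono'
    (aestronglyMeasurable_apply_apply B hX.1 hY.1) (Eventually.of_forall fun ω => ?_)
  exact (B.le_opNorm₂ _ _).trans_eq (by simp [mul_assoc])

/-- The trace `B ↦ 𝔼 B[Z, Z]` of a bilinear form against the covariance of `Z`, a continuous linear
functional on the space of bounded bilinear forms. -/
def covTrace (hZ : MemLp Z 2 P) : (E →L[ℝ] E →L[ℝ] ℝ) →L[ℝ] ℝ :=
  LinearMap.mkContinuous
    { toFun := fun B => ∫ ω, B (Z ω) (Z ω) ∂P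
      map_add' := fun A B => by
        simp only [add_apply]
        exact integral_add (integrable_apply_apply A hZ hZ) (integrable_apply_apply B hZ hZ)
      map_smul' := fun c B => by
        simp only [smul_apply, smul_eq_mul, RingHom.id_apply]
        exact integral_const_mul c _ }
    (∫ ω, ‖Z ω‖ ^ 2 ∂P) (fun B => by
      refine (norm_integral_le_integral_norm _).trans ?_
      rw [mul_comm, ← integral_const_mul]
      refine integral_mono (integrable_apply_apply B hZ hZ).norm
        ((hZ.integrable_norm_pow (by norm_num)).const_mul _) fun ω => ?_
      exact (B.le_opNorm₂ _ _).trans_eq (by ring))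

theorem covTrace_apply (hZ : MemLp Z 2 P) (B : E →L[ℝ] E →L[ℝ] ℝ) :
    covTrace hZ B = ∫ ω, B (Z ω) (Z ω) ∂P := rfl

/-- Two independent copies of `Z` may be rotated without changing their joint law. This is all that
integration by parts needs of Gaussianity. It is tested on continuous functions only, so that no
`σ`-algebra on `E` is involved. -/
def RotationInvariant (P : Measure Ω) (Z : Ω → E) : Prop :=
  ∀ Φ : E × E → ℝ, Continuous Φ → ∀ θ : ℝ,
    ∫ q : Ω × Ω, Φ (Real.cos θ • Z q.1 + Real.sin θ • Z q.2,
        -Real.sin θ • Z q.1 + Real.cos θ • Z q.2) ∂P.prod P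
      = ∫ q : Ω × Ω, Φ (Z q.1, Z q.2) ∂P.prod P

theorem norm_trig_smul_add_le {c d : ℝ} (hc : |c| ≤ 1) (hd : |d| ≤ 1) (x y : E) :
    ‖c • x + d • y‖ ≤ ‖x‖ + ‖y‖ := by
  refine (norm_add_le _ _).trans (add_le_add ?_ ?_) <;> rw [norm_smul, Real.norm_eq_abs]
  · exact mul_le_of_le_one_left (norm_nonneg _) hc
  · exact mul_le_of_le_one_left (norm_nonneg _) hd

set_option maxHeartbeats 1000000 in
/-- Gaussian integration by parts. By rotation invariance the expectation of
`G(a + σ(Z cos θ + Z' sin θ))[-Z sin θ + Z' cos θ]` does not depend on `θ`, and the vanishing of its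
derivative at `θ = 0` is the claim. -/
theorem integral_apply_eq_covTrace [IsProbabilityMeasure P] (hZ : MemLp Z 3 P) (hZ2 : MemLp Z 2 P)
    (hrot : RotationInvariant P Z) {G : E → E →L[ℝ] ℝ} (hG : Differentiable ℝ G)
    (hG' : Continuous (fderiv ℝ G)) {C : ℝ} (hC : 0 ≤ C)
    (h1 : ∀ x, ‖G x‖ ≤ C * (1 + ‖x‖) ^ 2) (h2 : ∀ x, ‖fderiv ℝ G x‖ ≤ C * (1 + ‖x‖))
    (a : E) (σ : ℝ) :
    ∫ ω, G (a + σ • Z ω) (Z ω) ∂P = σ * ∫ ω, covTrace hZ2 (fderiv ℝ G (a + σ • Z ω)) ∂P := by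
  set A : ℝ := 1 + ‖a‖ + |σ| with hA
  have hA0 : 0 ≤ A := by positivity
  have hσA : |σ| ≤ A := by rw [hA]; linarith [norm_nonneg a]
  let U : ℝ → Ω × Ω → E := fun θ q => Real.cos θ • Z q.1 + Real.sin θ • Z q.2
  let V : ℝ → Ω × Ω → E := fun θ q => -Real.sin θ • Z q.1 + Real.cos θ • Z q.2
  let F : ℝ → Ω × Ω → ℝ := fun θ q => G (a + σ • U θ q) (V θ q)
  let F' : ℝ → Ω × Ω → ℝ := fun θ q =>
    fderiv ℝ G (a + σ • U θ q) (σ • V θ q) (V θ q) + G (a + σ • U θ q) (-U θ q)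
  let n : Ω × Ω → ℝ := fun q => ‖Z q.1‖ + ‖Z q.2‖
  have hn : ∀ q, 0 ≤ n q := fun q => by positivity
  have hZ1m : AEStronglyMeasurable (fun q : Ω × Ω => Z q.1) (P.prod P) := hZ.1.comp_fst
  have hZ2m : AEStronglyMeasurable (fun q : Ω × Ω => Z q.2) (P.prod P) := hZ.1.comp_snd
  have hZZ := hZ1m.prodMk hZ2m
  have hbd : Integrable (fun q => 2 * C * A ^ 2 * (1 + n q) ^ 3) (P.prod P) :=
    (integrable_one_add_norm_add_norm_pow_three hZ).const_mul _
  have hU : ∀ θ q, ‖U θ q‖ ≤ n q := fun θ q =>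
    norm_trig_smul_add_le (Real.abs_cos_le_one θ) (Real.abs_sin_le_one θ) _ _
  have hV : ∀ θ q, ‖V θ q‖ ≤ n q := fun θ q =>
    norm_trig_smul_add_le (by rw [abs_neg]; exact Real.abs_sin_le_one θ)
      (Real.abs_cos_le_one θ) _ _
  have harg : ∀ θ q, 1 + ‖a + σ • U θ q‖ ≤ A * (1 + n q) := fun θ q => by
    have e1 : ‖a + σ • U θ q‖ ≤ ‖a‖ + |σ| * n q := by
      refine (norm_add_le _ _).trans ?_
      rw [norm_smul, Real.norm_eq_abs]
      have := hU θ q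
      gcongr
    have := hn q
    have := norm_nonneg a
    have := abs_nonneg σ
    rw [hA]
    nlinarith [mul_nonneg (norm_nonneg a) (hn q)]
  have hb1 : ∀ θ q, ‖G (a + σ • U θ q) (-U θ q)‖ ≤ C * A ^ 2 * (1 + n q) ^ 3 := fun θ q => by
    have := hn q
    calc ‖G (a + σ • U θ q) (-U θ q)‖ ≤ ‖G (a + σ • U θ q)‖ * ‖-U θ q‖ :=
          ContinuousLinearMap.le_opNorm _ _
      _ ≤ (C * (A * (1 + n q)) ^ 2) * (1 + n q) := by
          refine mul_le_mul ((h1 _).trans ?_) ?_ (norm_nonneg _) (by positivity)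
          · have := harg θ q
            gcongr
          · rw [norm_neg]; linarith [hU θ q]
      _ = _ := by ring
  have hb2 : ∀ θ q, ‖fderiv ℝ G (a + σ • U θ q) (σ • V θ q) (V θ q)‖
      ≤ C * A ^ 2 * (1 + n q) ^ 3 := fun θ q => by
    have := hn q
    calc ‖fderiv ℝ G (a + σ • U θ q) (σ • V θ q) (V θ q)‖
        ≤ ‖fderiv ℝ G (a + σ • U θ q)‖ * ‖σ • V θ q‖ * ‖V θ q‖ :=
          ContinuousLinearMap.le_opNorm₂ _ _ _
      _ ≤ (C * (A * (1 + n q))) * (A * (1 + n q)) * (1 + n q) := by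
          refine mul_le_mul (mul_le_mul ((h2 _).trans ?_) ?_ (norm_nonneg _) (by positivity)) ?_
            (norm_nonneg _) (by positivity)
          · have := harg θ q
            gcongr
          · rw [norm_smul, Real.norm_eq_abs]
            exact mul_le_mul hσA (by linarith [hV θ q]) (norm_nonneg _) hA0
          · linarith [hV θ q]
      _ = _ := by ring
  have hF1c : ∀ θ, Continuous fun x : E × E =>
      G (a + σ • (Real.cos θ • x.1 + Real.sin θ • x.2))
        (-Real.sin θ • x.1 + Real.cos θ • x.2) := fun θ => by
    exact (hG.continuous.comp (by fun_prop)).clm_apply (by fun_prop)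
  have hFm : ∀ θ, AEStronglyMeasurable (F θ) (P.prod P) := fun θ =>
    (hF1c θ).comp_aestronglyMeasurable hZZ
  have hm1 : ∀ θ, AEStronglyMeasurable
      (fun q => fderiv ℝ G (a + σ • U θ q) (σ • V θ q) (V θ q)) (P.prod P) := fun θ => by
    have h := (continuous_apply_rotated hG' a σ (Real.cos θ) (Real.sin θ) (-Real.sin θ)
      (Real.cos θ)).comp_aestronglyMeasurable hZZ
    exact h
  have hm2 : ∀ θ, AEStronglyMeasurable (fun q => G (a + σ • U θ q) (-U θ q)) (P.prod P) :=
    fun θ => by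
    have hc : Continuous fun x : E × E =>
        G (a + σ • (Real.cos θ • x.1 + Real.sin θ • x.2))
          (-(Real.cos θ • x.1 + Real.sin θ • x.2)) :=
      (hG.continuous.comp (by fun_prop)).clm_apply (by fun_prop)
    have h := hc.comp_aestronglyMeasurable hZZ
    exact h
  have hi0 : Integrable (fun q => C * A ^ 2 * (1 + n q) ^ 3) (P.prod P) := by
    refine (hbd.const_mul (1 / 2)).congr (Eventually.of_forall fun q => ?_)
    ring
  have hi1 := hi0.mono' (hm1 0) (Eventually.of_forall (hb2 0))
  have hi2 := hi0.mono' (hm2 0) (Eventually.of_forall (hb1 0))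
  have hFint : Integrable (F 0) (P.prod P) := by
    refine hi0.mono' (hFm 0) (Eventually.of_forall fun q => ?_)
    have := hn q
    calc ‖G (a + σ • U 0 q) (V 0 q)‖ ≤ ‖G (a + σ • U 0 q)‖ * ‖V 0 q‖ :=
          ContinuousLinearMap.le_opNorm _ _
      _ ≤ (C * (A * (1 + n q)) ^ 2) * (1 + n q) := by
          refine mul_le_mul ((h1 _).trans ?_) ?_ (norm_nonneg _) (by positivity)
          · have := harg 0 q
            gcongr
          · linarith [hV 0 q]
      _ = _ := by ring
  have hder : ∀ q θ, HasDerivAt (fun θ => F θ q) (F' θ q) θ := fun q θ => by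
    have hUd : HasDerivAt (fun θ => U θ q) (V θ q) θ :=
      ((Real.hasDerivAt_cos θ).smul_const (Z q.1)).add
        ((Real.hasDerivAt_sin θ).smul_const (Z q.2))
    have hVd : HasDerivAt (fun θ => V θ q) (-U θ q) θ := by
      have := ((Real.hasDerivAt_sin θ).neg.smul_const (Z q.1)).add
        ((Real.hasDerivAt_cos θ).smul_const (Z q.2))
      convert! this using 1
      simp only [U, neg_add, neg_smul]
    have hGd := (hG (a + σ • U θ q)).hasFDerivAt.comp_hasDerivAt θ
      ((hUd.const_smul σ).const_add a)
    exact hGd.clm_apply hVd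
  have hconst : ∀ θ, ∫ q, F θ q ∂P.prod P = ∫ q : Ω × Ω, G (a + σ • Z q.1) (Z q.2) ∂P.prod P :=
    fun θ => hrot (fun x => G (a + σ • x.1) x.2)
      ((hG.continuous.comp (by fun_prop)).clm_apply (by fun_prop)) θ
  obtain ⟨-, hd⟩ := hasDerivAt_integral_of_dominated_loc_of_deriv_le (𝕜 := ℝ) (F := F) (F' := F')
    (x₀ := 0) (s := Set.univ) univ_mem (Eventually.of_forall hFm) hFint ((hm1 0).add (hm2 0))
    (Eventually.of_forall fun q θ _ => (norm_add_le _ _).trans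
      ((add_le_add (hb2 θ q) (hb1 θ q)).trans_eq (by ring))) hbd
    (Eventually.of_forall fun q θ _ => hder q θ)
  rw [funext hconst] at hd
  have hzero := hd.unique (hasDerivAt_const (0 : ℝ) _)
  rw [show (∫ q, F' 0 q ∂P.prod P) = _ from integral_add hi1 hi2, integral_prod _ hi1,
    integral_prod _ hi2] at hzero
  simp only [U, V, Real.cos_zero, Real.sin_zero, one_smul, zero_smul, add_zero, neg_zero, zero_add,
    map_neg, integral_const, map_smul, smul_apply, smul_eq_mul, integral_const_mul,
    integral_neg, probReal_univ, one_mul] at hzero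
  simp only [covTrace_apply]
  linarith

end IntegrationByParts

/-! ### The Stein equation in trace form -/

section SteinEquation

variable {E : Type*} [NormedAddCommGroup E] [NormedSpace ℝ E] {Ω : Type*} [MeasurableSpace Ω]
  {P : Measure Ω} [IsProbabilityMeasure P] {Z : Ω → E} {g : E → ℝ} {C : ℝ}

theorem hasDerivAt_ouInterp (w z : E) {s : ℝ} (hs : 0 < s) :
    HasDerivAt (ouInterp w z) (-(Real.exp (-s) • w)
      + (Real.exp (-2 * s) / √(1 - Real.exp (-2 * s))) • z) s := by
  have h0 : Real.exp (-2 * s) < 1 := Real.exp_lt_one_iff.2 (by linarith)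
  have e1 : HasDerivAt (fun s : ℝ => Real.exp (-s)) (-Real.exp (-s)) s := by
    simpa using (hasDerivAt_neg s).exp
  have e2 : HasDerivAt (fun s : ℝ => √(1 - Real.exp (-2 * s)))
      (Real.exp (-2 * s) / √(1 - Real.exp (-2 * s))) s := by
    have h := ((((hasDerivAt_id s).const_mul (-2)).exp).const_sub 1).sqrt
      (by simp only [id]; linarith)
    convert! h using 1
    simp only [id]
    field_simp
  have := (e1.smul_const w).add (e2.smul_const z)
  rw [neg_smul] at this
  exact this

/-- Along the Ornstein–Uhlenbeck semigroup, `d/ds 𝔼 g(w e^{-s} + √(1 - e^{-2s}) Z)` is the generator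
applied to the semigroup. -/
theorem hasDerivAt_integral_ouInterp (hZ : MemLp Z 3 P) (hZ2 : MemLp Z 2 P)
    (hrot : RotationInvariant P Z) (hg : TwiceFrechetDifferentiable g)
    (hg' : Continuous (D2 g)) (hC : 0 ≤ C) (h0 : ∀ x, |g x| ≤ C * (1 + ‖x‖) ^ 3)
    (h1 : ∀ x, ‖fderiv ℝ g x‖ ≤ C * (1 + ‖x‖) ^ 2) (h2 : ∀ x, ‖D2 g x‖ ≤ C * (1 + ‖x‖))
    (w : E) {s : ℝ} (hs : 0 < s) :
    HasDerivAt (fun s => ∫ ω, g (ouInterp w (Z ω) s) ∂P)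
      (∫ ω, (Real.exp (-2 * s) * covTrace hZ2 (D2 g (ouInterp w (Z ω) s))
        - Real.exp (-s) * fderiv ℝ g (ouInterp w (Z ω) s) w) ∂P) s := by
  let r : ℝ → ℝ := fun s => √(1 - Real.exp (-2 * s))
  have hr : ∀ s, 0 < s → 0 < r s := fun s hs =>
    Real.sqrt_pos.2 (by linarith [Real.exp_lt_one_iff.2 (show -2 * s < 0 by linarith)])
  set M : ℝ := 1 / r (s / 2) with hM
  have hM0 : 0 ≤ M := by have := hr (s / 2) (by linarith); positivity
  have hc1 := hg.2.continuous
  have hint1 : Integrable (fun ω => fderiv ℝ g (ouInterp w (Z ω) s)) P :=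
    integrable_comp_ouInterp hZ hc1 hC (fun x => (h1 x).trans (by
      have := norm_nonneg x
      gcongr <;> linarith)) w hs.le
  have hint2 : Integrable (fun ω => D2 g (ouInterp w (Z ω) s)) P :=
    integrable_comp_ouInterp hZ hg' hC (fun x => (h2 x).trans (by
      have := norm_nonneg x
      gcongr
      exact le_self_pow₀ (by linarith) (by norm_num))) w hs.le
  let F' : ℝ → Ω → ℝ := fun s ω => fderiv ℝ g (ouInterp w (Z ω) s)
    (-(Real.exp (-s) • w) + (Real.exp (-2 * s) / r s) • Z ω)
  have hF'm : AEStronglyMeasurable (F' s) P := by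
    have hc : Continuous fun z : E => fderiv ℝ g (ouInterp w z s)
        (-(Real.exp (-s) • w) + (Real.exp (-2 * s) / r s) • z) := by
      exact (hc1.comp (continuous_ouInterp.comp
        (by fun_prop : Continuous fun z : E => (w, z, s)))).clm_apply (by fun_prop)
    exact hc.comp_aestronglyMeasurable hZ.1
  have hbound : ∀ ω, ∀ x ∈ Set.Ioi (s / 2),
      ‖F' x ω‖ ≤ C * (1 + M) * (1 + ‖w‖ + 2 * ‖Z ω‖) ^ 3 := by
    intro ω x hx
    have hx' : s / 2 < x := hx
    have hx0 : 0 < x := by linarith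
    have hz := norm_nonneg (Z ω)
    have hw := norm_nonneg w
    have hle := norm_ouInterp_le w (Z ω) hx0.le
    have hrx : r (s / 2) ≤ r x := Real.sqrt_le_sqrt (by
      have : Real.exp (-2 * x) ≤ Real.exp (-2 * (s / 2)) := Real.exp_le_exp.2 (by linarith)
      linarith)
    have hcoef : Real.exp (-2 * x) / r x ≤ M := by
      have := hr (s / 2) (by linarith)
      have h1 : Real.exp (-2 * x) ≤ 1 := Real.exp_le_one_iff.2 (by linarith)
      rw [hM]
      gcongr
    have hv : ‖-(Real.exp (-x) • w) + (Real.exp (-2 * x) / r x) • Z ω‖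
        ≤ (1 + M) * (1 + ‖w‖ + 2 * ‖Z ω‖) := by
      refine (norm_add_le _ _).trans ?_
      have h1 : Real.exp (-x) ≤ 1 := Real.exp_le_one_iff.2 (by linarith)
      have h3 := Real.exp_pos (-x)
      rw [norm_neg, norm_smul, norm_smul, Real.norm_of_nonneg h3.le,
        Real.norm_of_nonneg (div_nonneg (Real.exp_pos _).le (hr x hx0).le)]
      have h4 : Real.exp (-x) * ‖w‖ ≤ 1 * ‖w‖ := by gcongr
      have h5 : Real.exp (-2 * x) / r x * ‖Z ω‖ ≤ M * ‖Z ω‖ := by gcongr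
      nlinarith [mul_nonneg hM0 hw, mul_nonneg hM0 hz]
    calc ‖F' x ω‖ ≤ ‖fderiv ℝ g (ouInterp w (Z ω) x)‖ * _ := ContinuousLinearMap.le_opNorm _ _
      _ ≤ (C * (1 + ‖w‖ + 2 * ‖Z ω‖) ^ 2) * ((1 + M) * (1 + ‖w‖ + 2 * ‖Z ω‖)) := by
          refine mul_le_mul ((h1 _).trans (mul_le_mul_of_nonneg_left
            (pow_le_pow_left₀ (by positivity) (by linarith) 2) hC)) hv (norm_nonneg _)
            (by positivity)
      _ = _ := by ring
  have hderiv : ∀ ω, ∀ x ∈ Set.Ioi (s / 2),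
      HasDerivAt (fun s => g (ouInterp w (Z ω) s)) (F' x ω) x := by
    intro ω x hx
    have hx' : s / 2 < x := hx
    exact (hg.1 _).hasFDerivAt.comp_hasDerivAt x (hasDerivAt_ouInterp w (Z ω) (by linarith))
  obtain ⟨hF'i, hd⟩ := hasDerivAt_integral_of_dominated_loc_of_deriv_le (𝕜 := ℝ)
    (F := fun s ω => g (ouInterp w (Z ω) s)) (F' := F') (x₀ := s) (s := Set.Ioi (s / 2)) (μ := P)
    (bound := fun ω => C * (1 + M) * (1 + ‖w‖ + 2 * ‖Z ω‖) ^ 3)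
    (Ioi_mem_nhds (by linarith))
    (Eventually.of_forall fun s => hg.1.continuous.comp_aestronglyMeasurable
      (aestronglyMeasurable_ouInterp hZ.1 w s))
    (integrable_comp_ouInterp hZ hg.1.continuous hC h0 w hs.le) hF'm
    (Eventually.of_forall hbound)
    ((integrable_add_norm_pow_three hZ _).const_mul _)
    (Eventually.of_forall hderiv)
  convert! hd using 1
  have hI1 : Integrable (fun ω => fderiv ℝ g (ouInterp w (Z ω) s) w) P :=
    hint1.apply_continuousLinearMap w
  have hI2 : Integrable (fun ω => covTrace hZ2 (D2 g (ouInterp w (Z ω) s))) P :=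
    (covTrace hZ2).integrable_comp hint2
  have hrs := hr s hs
  have hI3 : Integrable (fun ω => fderiv ℝ g (ouInterp w (Z ω) s) (Z ω)) P := by
    have h := (hF'i.add (hI1.const_mul (Real.exp (-s)))).const_mul (r s / Real.exp (-2 * s))
    refine h.congr (Eventually.of_forall fun ω => ?_)
    have := Real.exp_pos (-2 * s)
    simp only [F', Pi.add_apply, map_add, map_neg, map_smul, smul_eq_mul]
    field_simp
    ring
  have e : ∀ ω, F' s ω = (Real.exp (-2 * s) / r s) * fderiv ℝ g (ouInterp w (Z ω) s) (Z ω)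
      - Real.exp (-s) * fderiv ℝ g (ouInterp w (Z ω) s) w := fun ω => by
    simp only [F', map_add, map_neg, map_smul, smul_eq_mul]
    ring
  rw [integral_congr_ae (Eventually.of_forall e),
    integral_sub (hI3.const_mul _) (hI1.const_mul _),
    integral_sub (hI2.const_mul _) (hI1.const_mul _), integral_const_mul, integral_const_mul,
    integral_const_mul]
  have hibp := integral_apply_eq_covTrace hZ hZ2 hrot hg.2 hg' hC h1 h2
    (Real.exp (-s) • w) (r s)
  change ∫ ω, fderiv ℝ g (ouInterp w (Z ω) s) (Z ω) ∂P = _ * ∫ ω, covTrace hZ2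
    (D2 g (ouInterp w (Z ω) s)) ∂P at hibp
  rw [hibp, ← mul_assoc, div_mul_cancel₀ _ hrs.ne']

/-- The Stein equation, with the second order term written as a trace against the covariance
of `Z`. It is the fundamental theorem of calculus for `s ↦ 𝔼 g(w e^{-s} + √(1 - e^{-2s}) Z)`, which
runs from `g(w)` at `s = 0` to `𝔼 g(Z)` at `s = ∞`. -/
theorem covTrace_D2_steinIntegral_sub (hZ : MemLp Z 3 P) (hZ2 : MemLp Z 2 P)
    (hrot : RotationInvariant P Z) (hg : TwiceFrechetDifferentiable g)
    (hg' : Continuous (D2 g)) (hC : 0 ≤ C) (h0 : ∀ x, |g x| ≤ C * (1 + ‖x‖) ^ 3)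
    (h1 : ∀ x, ‖fderiv ℝ g x‖ ≤ C * (1 + ‖x‖) ^ 2) (h2 : ∀ x, ‖D2 g x‖ ≤ C * (1 + ‖x‖)) (w : E) :
    covTrace hZ2 (D2 (steinIntegral P Z g) w) - fderiv ℝ (steinIntegral P Z g) w w
      = g w - ∫ ω, g (Z ω) ∂P := by
  have h2' : ∀ x, ‖D2 g x‖ ≤ C * (1 + ‖x‖) ^ 2 := fun x =>
    (h2 x).trans (by
      have := norm_nonneg x
      gcongr
      exact le_self_pow₀ (by linarith) (by norm_num))
  have hi1 := integrable_exp_smul_comp_ouInterp hZ hg.2.continuous hC h1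
    (c := fun s => Real.exp (-s)) (by fun_prop) (fun s _ => by simp) w
  have hi2 := integrable_exp_smul_comp_ouInterp hZ hg' hC h2'
    (c := fun s => Real.exp (-2 * s)) (by fun_prop) (fun s hs => by
      rw [abs_of_pos (Real.exp_pos _)]
      exact Real.exp_le_exp.2 (by linarith)) w
  have hj1 := hi1.apply_continuousLinearMap w
  have hj2 := (covTrace hZ2).integrable_comp hi2
  have hj := hj2.sub hj1
  have hj' : Integrable (fun q : Ω × ℝ =>
      Real.exp (-2 * q.2) * covTrace hZ2 (D2 g (ouInterp w (Z q.1) q.2))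
        - Real.exp (-q.2) * fderiv ℝ g (ouInterp w (Z q.1) q.2) w)
      (P.prod (volume.restrict (Set.Ioi 0))) :=
    hj.congr (Eventually.of_forall fun q => by simp [-neg_mul])
  have hcont : ∀ s, 0 ≤ s → ContinuousWithinAt (fun s => ∫ ω, g (ouInterp w (Z ω) s) ∂P)
      (Set.Ici 0) s := fun s hs => by
    refine continuousWithinAt_of_dominated
      (bound := fun ω => C * (1 + ‖w‖ + 2 * ‖Z ω‖) ^ 3)
      (Eventually.of_forall fun s => hg.1.continuous.comp_aestronglyMeasurable
        (aestronglyMeasurable_ouInterp hZ.1 w s)) ?_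
      ((integrable_add_norm_pow_three hZ _).const_mul _) (Eventually.of_forall fun ω => ?_)
    · filter_upwards [self_mem_nhdsWithin] with x hx
      refine Eventually.of_forall fun ω => (h0 _).trans ?_
      have := norm_ouInterp_le w (Z ω) hx
      have hz := norm_nonneg (Z ω)
      exact mul_le_mul_of_nonneg_left (pow_le_pow_left₀ (by positivity) (by linarith) 3) hC
    · exact (hg.1.continuous.comp (continuous_ouInterp.comp
        (by fun_prop : Continuous fun s : ℝ => (w, Z ω, s)))).continuousWithinAt
  have hlim : Tendsto (fun s => ∫ ω, g (ouInterp w (Z ω) s) ∂P) atTop (𝓝 (∫ ω, g (Z ω) ∂P)) := by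
    refine tendsto_integral_filter_of_dominated_convergence
      (fun ω => C * (1 + ‖w‖ + 2 * ‖Z ω‖) ^ 3)
      (Eventually.of_forall fun s => hg.1.continuous.comp_aestronglyMeasurable
        (aestronglyMeasurable_ouInterp hZ.1 w s)) ?_
      ((integrable_add_norm_pow_three hZ _).const_mul _) (Eventually.of_forall fun ω => ?_)
    · filter_upwards [eventually_ge_atTop 0] with x hx
      refine Eventually.of_forall fun ω => (h0 _).trans ?_
      have := norm_ouInterp_le w (Z ω) hx
      have hz := norm_nonneg (Z ω)
      exact mul_le_mul_of_nonneg_left (pow_le_pow_left₀ (by positivity) (by linarith) 3) hC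
    · refine (hg.1.continuous.tendsto (Z ω)).comp (tendsto_iff_norm_sub_tendsto_zero.2 ?_)
      have hexp : Tendsto (fun s : ℝ => Real.exp (-s) * (‖w‖ + ‖Z ω‖)) atTop (𝓝 0) := by
        simpa using (Real.tendsto_exp_neg_atTop_nhds_zero).mul_const (‖w‖ + ‖Z ω‖)
      refine squeeze_zero' (Eventually.of_forall fun s => norm_nonneg _) ?_ hexp
      filter_upwards [eventually_ge_atTop 0] with s hs using norm_ouInterp_sub_le w (Z ω) hs
  have hftc := integral_Ioi_of_hasDerivAt_of_tendsto (hcont 0 le_rfl)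
    (fun s hs => hasDerivAt_integral_ouInterp hZ hZ2 hrot hg hg' hC h0 h1 h2 w hs)
    (f' := fun s => ∫ ω, (Real.exp (-2 * s) * covTrace hZ2 (D2 g (ouInterp w (Z ω) s))
        - Real.exp (-s) * fderiv ℝ g (ouInterp w (Z ω) s) w) ∂P)
    hj'.integral_prod_right hlim
  have hD1 := (hasFDerivAt_steinIntegral hZ hg.1 hg.2.continuous hC h0 h1 w).fderiv
  have hD2 : D2 (steinIntegral P Z g) w = _ :=
    (hasFDerivAt_fderiv_steinIntegral hZ hg hg' hC h0 h1 h2 w).fderiv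
  have hval : ∫ q : Ω × ℝ, (covTrace hZ2 (Real.exp (-2 * q.2) • D2 g (ouInterp w (Z q.1) q.2))
        - (Real.exp (-q.2) • fderiv ℝ g (ouInterp w (Z q.1) q.2)) w)
        ∂P.prod (volume.restrict (Set.Ioi 0))
      = (∫ ω, g (Z ω) ∂P) - g w := by
    simp only [map_smul, smul_apply, smul_eq_mul]
    rw [integral_prod_symm _ hj', hftc]
    simp [ouInterp]
  rw [integral_sub hj2 hj1, ContinuousLinearMap.integral_comp_comm _ hi2,
    ← ContinuousLinearMap.integral_apply hi1 w] at hval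
  rw [hD1, hD2, map_neg, neg_apply]
  linarith

end SteinEquation

/-! ### Step functions in the space of càdlàg paths -/

section StepFunctions

variable {T : ℝ} {p : ℕ}

namespace Dp

theorem ext {x y : Dp T p} (h : ∀ t, x t = y t) : x = y :=
  Subtype.ext (lp.ext (funext h))

theorem add_apply (x y : Dp T p) (t : Set.Icc (0 : ℝ) T) : (x + y) t = x t + y t := rfl

theorem sub_apply (x y : Dp T p) (t : Set.Icc (0 : ℝ) T) : (x - y) t = x t - y t := rfl

theorem smul_apply (c : ℝ) (x : Dp T p) (t : Set.Icc (0 : ℝ) T) : (c • x) t = c • x t := rfl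

theorem sum_apply {ι : Type*} (s : Finset ι) (x : ι → Dp T p) (t : Set.Icc (0 : ℝ) T) :
    (∑ i ∈ s, x i) t = ∑ i ∈ s, x i t := by
  classical
  induction s using Finset.induction_on with
  | empty => rfl
  | insert a s ha ih => rw [Finset.sum_insert ha, Finset.sum_insert ha, add_apply, ih]

theorem norm_apply_le (x : Dp T p) (t : Set.Icc (0 : ℝ) T) : ‖x t‖ ≤ ‖x‖ :=
  lp.norm_apply_le_norm ENNReal.top_ne_zero x.1 t

theorem norm_le {x : Dp T p} {C : ℝ} (hC : 0 ≤ C) (h : ∀ t, ‖x t‖ ≤ C) : ‖x‖ ≤ C :=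
  lp.norm_le_of_forall_le hC h

theorem isCadlag (x : Dp T p) : IsCadlag (fun t => x t) := x.2

end Dp

/-- The left end point of `[0, T]`. -/
def leftPt (hT : 0 ≤ T) : Set.Icc (0 : ℝ) T := ⟨0, Set.left_mem_Icc.2 hT⟩

/-- The right end point of `[0, T]`. -/
def rightPt (hT : 0 ≤ T) : Set.Icc (0 : ℝ) T := ⟨T, Set.right_mem_Icc.2 hT⟩

theorem leftPt_le (hT : 0 ≤ T) (u : Set.Icc (0 : ℝ) T) : leftPt hT ≤ u := u.2.1

theorem le_rightPt (hT : 0 ≤ T) (u : Set.Icc (0 : ℝ) T) : u ≤ rightPt hT := u.2.2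

theorem isCadlag_comp_filter (π : Finset (Set.Icc (0 : ℝ) T))
    (F : Finset (Set.Icc (0 : ℝ) T) → EuclideanSpace ℝ (Fin p)) :
    IsCadlag fun u => F (π.filter (· ≤ u)) := by
  intro t
  constructor
  · have h : ∀ᶠ u in 𝓝[≥] t, ∀ s ∈ π, (s ≤ u ↔ s ≤ t) := by
      rw [eventually_all_finset]
      intro s _
      rcases le_or_gt s t with hs | hs
      · filter_upwards [self_mem_nhdsWithin] with u hu
        exact iff_of_true (hs.trans hu) hs
      · filter_upwards [mem_nhdsWithin_of_mem_nhds (Iio_mem_nhds hs)] with u hu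
        exact iff_of_false (not_le.2 hu) (not_le.2 hs)
    refine (tendsto_const_nhds (x := F (π.filter (· ≤ t)))).congr' ?_
    filter_upwards [h] with u hu
    rw [Finset.filter_congr hu]
  · refine ⟨F (π.filter (· < t)), ?_⟩
    have h : ∀ᶠ u in 𝓝[<] t, ∀ s ∈ π, (s ≤ u ↔ s < t) := by
      rw [eventually_all_finset]
      intro s _
      rcases lt_or_ge s t with hs | hs
      · filter_upwards [mem_nhdsWithin_of_mem_nhds (Ioi_mem_nhds hs)] with u hu
        exact iff_of_true (le_of_lt hu) hs
      · filter_upwards [self_mem_nhdsWithin] with u hu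
        exact iff_of_false (not_le.2 (lt_of_lt_of_le hu hs)) (not_lt.2 hs)
    refine (tendsto_const_nhds (x := F (π.filter (· < t)))).congr' ?_
    filter_upwards [h] with u hu
    rw [Finset.filter_congr hu]

/-- A step function with jumps in the finite set `π`: its value at `u` depends only on the set of
points of `π` up to `u`. -/
def finStep (π : Finset (Set.Icc (0 : ℝ) T))
    (F : Finset (Set.Icc (0 : ℝ) T) → EuclideanSpace ℝ (Fin p)) : Dp T p :=
  (isCadlag_comp_filter π F).toDp

theorem finStep_apply (π : Finset (Set.Icc (0 : ℝ) T))
    (F : Finset (Set.Icc (0 : ℝ) T) → EuclideanSpace ℝ (Fin p)) (u : Set.Icc (0 : ℝ) T) :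
    finStep π F u = F (π.filter (· ≤ u)) := rfl

/-- The jump function `1_{[τ, T]} v`. -/
def jump (τ : Set.Icc (0 : ℝ) T) (v : EuclideanSpace ℝ (Fin p)) : Dp T p :=
  finStep {τ} fun A => if τ ∈ A then v else 0

theorem jump_apply (τ : Set.Icc (0 : ℝ) T) (v : EuclideanSpace ℝ (Fin p))
    (u : Set.Icc (0 : ℝ) T) : jump τ v u = if τ ≤ u then v else 0 := by
  rw [jump, finStep_apply]
  simp

theorem jump_add (τ : Set.Icc (0 : ℝ) T) (v w : EuclideanSpace ℝ (Fin p)) :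
    jump τ (v + w) = jump τ v + jump τ w := by
  refine Dp.ext fun u => ?_
  rw [Dp.add_apply, jump_apply, jump_apply, jump_apply]
  split_ifs <;> simp

theorem jump_smul (τ : Set.Icc (0 : ℝ) T) (c : ℝ) (v : EuclideanSpace ℝ (Fin p)) :
    jump τ (c • v) = c • jump τ v := by
  refine Dp.ext fun u => ?_
  rw [Dp.smul_apply, jump_apply, jump_apply]
  split_ifs <;> simp

/-- The step function that at `u` takes the value of `v` at the last point of `π` up to `u`, and
vanishes before the first point of `π`. -/
def stepFun (π : Finset (Set.Icc (0 : ℝ) T))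
    (v : Set.Icc (0 : ℝ) T → EuclideanSpace ℝ (Fin p)) : Dp T p :=
  finStep π fun A => if h : A.Nonempty then v (A.max' h) else 0

theorem exists_stepFun_apply_eq {π : Finset (Set.Icc (0 : ℝ) T)} {u : Set.Icc (0 : ℝ) T}
    (h : ∃ s ∈ π, s ≤ u) : ∃ σ ∈ π, σ ≤ u ∧ (∀ r ∈ π, r ≤ u → r ≤ σ) ∧
      ∀ v : Set.Icc (0 : ℝ) T → EuclideanSpace ℝ (Fin p), stepFun π v u = v σ := by
  obtain ⟨s, hs, hsu⟩ := h
  have hne : (π.filter (· ≤ u)).Nonempty := ⟨s, Finset.mem_filter.2 ⟨hs, hsu⟩⟩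
  have hmem := Finset.mem_filter.1 (Finset.max'_mem _ hne)
  refine ⟨(π.filter (· ≤ u)).max' hne, hmem.1, hmem.2,
    fun r hr hru => Finset.le_max' _ _ (Finset.mem_filter.2 ⟨hr, hru⟩), fun v => ?_⟩
  rw [stepFun, finStep_apply, dif_pos hne]

theorem stepFun_apply_eq_zero {π : Finset (Set.Icc (0 : ℝ) T)} {u : Set.Icc (0 : ℝ) T}
    (h : ¬∃ s ∈ π, s ≤ u) (v : Set.Icc (0 : ℝ) T → EuclideanSpace ℝ (Fin p)) :
    stepFun π v u = 0 := by
  have hne : ¬(π.filter (· ≤ u)).Nonempty := fun ⟨s, hs⟩ =>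
    h ⟨s, (Finset.mem_filter.1 hs).1, (Finset.mem_filter.1 hs).2⟩
  rw [stepFun, finStep_apply, dif_neg hne]

/-- `stepFun` as a linear map. -/
def stepLin (π : Finset (Set.Icc (0 : ℝ) T)) :
    (Set.Icc (0 : ℝ) T → EuclideanSpace ℝ (Fin p)) →ₗ[ℝ] Dp T p where
  toFun := stepFun π
  map_add' v w := by
    refine Dp.ext fun u => ?_
    rw [Dp.add_apply]
    by_cases h : ∃ s ∈ π, s ≤ u
    · obtain ⟨σ, -, -, -, hσ⟩ := exists_stepFun_apply_eq (p := p) h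
      simp [hσ]
    · simp [stepFun_apply_eq_zero h]
  map_smul' c v := by
    refine Dp.ext fun u => ?_
    rw [RingHom.id_apply, Dp.smul_apply]
    by_cases h : ∃ s ∈ π, s ≤ u
    · obtain ⟨σ, -, -, -, hσ⟩ := exists_stepFun_apply_eq (p := p) h
      simp [hσ]
    · simp [stepFun_apply_eq_zero h]

theorem norm_stepFun_le (π : Finset (Set.Icc (0 : ℝ) T)) (x : Dp T p) :
    ‖stepFun π fun t => x t‖ ≤ ‖x‖ := by
  refine Dp.norm_le (norm_nonneg _) fun u => ?_
  by_cases h : ∃ s ∈ π, s ≤ u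
  · obtain ⟨σ, -, -, -, hσ⟩ := exists_stepFun_apply_eq (p := p) h
    rw [hσ]
    exact Dp.norm_apply_le x σ
  · rw [stepFun_apply_eq_zero h, norm_zero]
    exact norm_nonneg _

/-- The discretization `x ↦ x ∘ σ`, where `σ` rounds down to the finite set `π`, as a contraction
of the space of càdlàg paths. -/
def discr (π : Finset (Set.Icc (0 : ℝ) T)) : Dp T p →L[ℝ] Dp T p :=
  LinearMap.mkContinuous
    { toFun := fun x => stepFun π fun t => x t
      map_add' := fun x y => (stepLin π).map_add (fun t => x t) fun t => y t
      map_smul' := fun c x => (stepLin π).map_smul c fun t => x t } 1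
    fun x => by rw [one_mul]; exact norm_stepFun_le π x

theorem discr_apply (π : Finset (Set.Icc (0 : ℝ) T)) (x : Dp T p) :
    discr π x = stepFun π fun t => x t := rfl

theorem norm_discr_apply_le (π : Finset (Set.Icc (0 : ℝ) T)) (x : Dp T p) :
    ‖discr π x‖ ≤ ‖x‖ := norm_stepFun_le π x

/-- Discretization rounds the position of a jump up to the next point of `π`. -/
theorem discr_jump {π : Finset (Set.Icc (0 : ℝ) T)} {τ c : Set.Icc (0 : ℝ) T} (hc : c ∈ π)
    (hτc : τ ≤ c) (hmin : ∀ r ∈ π, τ ≤ r → c ≤ r) (v : EuclideanSpace ℝ (Fin p)) :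
    discr π (jump τ v) = jump c v := by
  refine Dp.ext fun u => ?_
  rw [discr_apply, jump_apply]
  by_cases h : ∃ s ∈ π, s ≤ u
  · obtain ⟨σ, hσπ, hσu, hσ, he⟩ := exists_stepFun_apply_eq (p := p) h
    rw [he, jump_apply]
    have hiff : τ ≤ σ ↔ c ≤ u :=
      ⟨fun h => (hmin σ hσπ h).trans hσu, fun h => hτc.trans (hσ c hc h)⟩
    simp only [hiff]
  · rw [stepFun_apply_eq_zero h, if_neg fun hcu => h ⟨c, hc, hcu⟩]

/-- A càdlàg function oscillates little on the cells of a fine enough finite partition. -/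
theorem exists_partition_norm_sub_le (x : Dp T p) {ε : ℝ} (hε : 0 < ε) :
    ∃ π : Finset (Set.Icc (0 : ℝ) T), ∀ u u', (∀ s ∈ π, (s ≤ u ↔ s ≤ u')) → ‖x u - x u'‖ ≤ ε := by
  classical
  have hloc : ∀ t : Set.Icc (0 : ℝ) T, t ∈ (Set.univ : Set (Set.Icc (0 : ℝ) T)) →
      ∃ U ∈ 𝓝[Set.univ] t, ∃ π : Finset (Set.Icc (0 : ℝ) T), ∀ u ∈ U, ∀ u',
        (∀ s ∈ π, (s ≤ u ↔ s ≤ u')) → ‖x u - x u'‖ ≤ ε := by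
    intro t _
    obtain ⟨hr, l, hl⟩ := x.isCadlag t
    have h1 : ∀ᶠ u in 𝓝[≥] t, ‖x u - x t‖ < ε / 2 := by
      have := (hr.sub_const (x t)).norm
      rw [sub_self, norm_zero] at this
      exact this.eventually_lt_const (by positivity)
    have h2 : ∀ᶠ u in 𝓝[<] t, ‖x u - l‖ < ε / 2 := by
      have := (hl.sub_const l).norm
      rw [sub_self, norm_zero] at this
      exact this.eventually_lt_const (by positivity)
    have hclose : ∀ {a b c : EuclideanSpace ℝ (Fin p)}, ‖a - c‖ < ε / 2 → ‖b - c‖ < ε / 2 →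
        ‖a - b‖ ≤ ε := fun {a b c} ha hb => by
      rw [norm_sub_rev] at hb
      linarith [norm_sub_le_norm_sub_add_norm_sub a c b]
    -- a right neighbourhood `[t, b)` and a point `b` that separates it from the rest
    obtain ⟨πr, Ur, hUr, hπr⟩ : ∃ (πr : Finset (Set.Icc (0 : ℝ) T)) (Ur : Set (Set.Icc (0 : ℝ) T)),
        Ur ∈ 𝓝[≥] t ∧ ∀ u ∈ Ur, t ≤ u → ∀ u', t ≤ u' → (∀ s ∈ πr, (s ≤ u ↔ s ≤ u')) →
          ‖x u - x u'‖ ≤ ε := by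
      by_cases hb : ∃ b, t < b
      · obtain ⟨b, hb, hsub⟩ := (mem_nhdsGE_iff_exists_Ico_subset' hb.choose_spec).1 h1
        refine ⟨{b}, Set.Ico t b, Ico_mem_nhdsGE hb, fun u hu htu u' htu' hs => ?_⟩
        have hu' : u' < b := by
          by_contra hcon
          exact absurd ((hs b (Finset.mem_singleton_self b)).2 (not_lt.1 hcon)) (not_le.2 hu.2)
        exact hclose (hsub hu) (hsub ⟨htu', hu'⟩)
      · push Not at hb
        refine ⟨∅, Set.univ, univ_mem, fun u _ htu u' htu' _ => ?_⟩
        rw [le_antisymm (hb u) htu, le_antisymm (hb u') htu', sub_self, norm_zero]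
        exact hε.le
    obtain ⟨πl, Ul, hUl, hπl⟩ : ∃ (πl : Finset (Set.Icc (0 : ℝ) T)) (Ul : Set (Set.Icc (0 : ℝ) T)),
        Ul ∈ 𝓝[<] t ∧ ∀ u ∈ Ul, u < t → ∀ u', u' < t → (∀ s ∈ πl, (s ≤ u ↔ s ≤ u')) →
          ‖x u - x u'‖ ≤ ε := by
      by_cases ha : ∃ a, a < t
      · obtain ⟨a, ha, hsub⟩ := (mem_nhdsLT_iff_exists_Ioo_subset' ha.choose_spec).1 h2
        obtain ⟨a', haa', ha't⟩ := exists_between (show a < t from ha)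
        refine ⟨{a'}, Set.Ico a' t, Ico_mem_nhdsLT ha't, fun u hu hut u' hut' hs => ?_⟩
        have hu' : a' ≤ u' := (hs a' (Finset.mem_singleton_self a')).1 hu.1
        exact hclose (hsub ⟨haa'.trans_le hu.1, hut⟩) (hsub ⟨haa'.trans_le hu', hut'⟩)
      · refine ⟨∅, Set.univ, univ_mem, fun u _ hu => absurd ⟨u, hu⟩ ha⟩
    refine ⟨(Ur ∩ Set.Ici t) ∪ (Ul ∩ Set.Iio t), ?_, insert t (πr ∪ πl), fun u hu u' hs => ?_⟩
    · rw [nhdsWithin_univ, ← nhdsLT_sup_nhdsGE]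
      exact mem_sup.2
        ⟨mem_of_superset (inter_mem hUl self_mem_nhdsWithin) Set.subset_union_right,
          mem_of_superset (inter_mem hUr self_mem_nhdsWithin) Set.subset_union_left⟩
    · have ht := hs t (Finset.mem_insert_self _ _)
      rcases hu with ⟨hu, htu⟩ | ⟨hu, htu⟩
      · exact hπr u hu htu u' (ht.1 htu) fun s hsm =>
          hs s (Finset.mem_insert_of_mem (Finset.mem_union_left _ hsm))
      · exact hπl u hu htu u' (not_le.1 fun h => absurd (ht.2 h) (not_le.2 htu)) fun s hsm =>
          hs s (Finset.mem_insert_of_mem (Finset.mem_union_right _ hsm))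
  have := isCompact_univ.induction_on (p := fun U => ∃ π : Finset (Set.Icc (0 : ℝ) T), ∀ u ∈ U,
      ∀ u', (∀ s ∈ π, (s ≤ u ↔ s ≤ u')) → ‖x u - x u'‖ ≤ ε)
    ⟨∅, by simp⟩ (fun s t hst ⟨π, h⟩ => ⟨π, fun u hu => h u (hst hu)⟩)
    (fun s t ⟨π, h⟩ ⟨π', h'⟩ => ⟨π ∪ π', fun u hu u' hs => by
      rcases hu with hu | hu
      · exact h u hu u' fun r hr => hs r (Finset.mem_union_left _ hr)
      · exact h' u hu u' fun r hr => hs r (Finset.mem_union_right _ hr)⟩) hloc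
  obtain ⟨π, h⟩ := this
  exact ⟨π, fun u u' => h u (Set.mem_univ u) u'⟩

theorem finStep_mem_of_jump_mem (hT : 0 ≤ T) {Y : Submodule ℝ (Dp T p)}
    (hY : ∀ τ v, jump τ v ∈ Y) (π : Finset (Set.Icc (0 : ℝ) T)) :
    ∀ F : Finset (Set.Icc (0 : ℝ) T) → EuclideanSpace ℝ (Fin p), finStep π F ∈ Y := by
  classical
  induction π using Finset.induction_on_max with
  | empty =>
    intro F
    have h : finStep ∅ F = jump (leftPt hT) (F ∅) := by
      refine Dp.ext fun u => ?_
      rw [finStep_apply, jump_apply, if_pos (leftPt_le hT u)]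
      simp
    rw [h]
    exact hY _ _
  | insert a π ha ih =>
    intro F
    have h : finStep (insert a π) F = finStep π F + jump a (F (insert a π) - F π) := by
      refine Dp.ext fun u => ?_
      rw [Dp.add_apply, finStep_apply, finStep_apply, jump_apply, Finset.filter_insert]
      by_cases hau : a ≤ u
      · have hf : π.filter (· ≤ u) = π :=
          Finset.filter_true_of_mem fun s hs => ((ha s hs).trans_le hau).le
        rw [if_pos hau, if_pos hau, hf]
        abel
      · rw [if_neg hau, if_neg hau, add_zero]
    rw [h]
    exact Y.add_mem (ih F) (hY _ _)

/-- The jump functions span a dense subspace. -/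
theorem mem_of_jump_mem (hT : 0 ≤ T) {Y : Submodule ℝ (Dp T p)} (hc : IsClosed (Y : Set (Dp T p)))
    (hY : ∀ τ v, jump τ v ∈ Y) (x : Dp T p) : x ∈ Y := by
  classical
  refine hc.closure_subset (Metric.mem_closure_iff.2 fun ε hε => ?_)
  obtain ⟨π, hπ⟩ := exists_partition_norm_sub_le x (half_pos hε)
  refine ⟨stepFun (insert (leftPt hT) π) fun t => x t, finStep_mem_of_jump_mem hT hY _ _, ?_⟩
  rw [dist_eq_norm]
  refine lt_of_le_of_lt (Dp.norm_le (half_pos hε).le fun u => ?_) (half_lt_self hε)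
  obtain ⟨σ, -, hσu, hσ, he⟩ := exists_stepFun_apply_eq (p := p)
    (π := insert (leftPt hT) π) (u := u) ⟨leftPt hT, Finset.mem_insert_self _ _, leftPt_le hT u⟩
  rw [Dp.sub_apply, he]
  exact hπ u σ fun s hs =>
    ⟨fun h => hσ s (Finset.mem_insert_of_mem hs) h, fun h => h.trans hσu⟩

/-- Discretizations of a continuous path along partitions that exhaust a dense set converge
uniformly. -/
theorem tendsto_discr_of_continuous (hT : 0 ≤ T) {π : ℕ → Finset (Set.Icc (0 : ℝ) T)}
    (hmono : Monotone π) (hdense : Dense {t | ∃ n, t ∈ π n})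
    (h0 : ∃ n, leftPt hT ∈ π n) {z : Dp T p}
    (hz : Continuous fun t => z t) : Tendsto (fun n => discr (π n) z) atTop (𝓝 z) := by
  rw [Metric.tendsto_atTop']
  intro ε hε
  have hloc : ∀ t : Set.Icc (0 : ℝ) T, t ∈ (Set.univ : Set (Set.Icc (0 : ℝ) T)) →
      ∃ U ∈ 𝓝[Set.univ] t, ∃ N, ∀ n ≥ N, ∀ u ∈ U, ‖discr (π n) z u - z u‖ ≤ ε / 2 := by
    intro t _
    have hball : {u | ‖z u - z t‖ < ε / 4} ∈ 𝓝 t := by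
      have := (hz.continuousAt (x := t)).tendsto.sub_const (z t) |>.norm
      rw [sub_self, norm_zero] at this
      exact this.eventually_lt_const (by positivity)
    obtain ⟨b, c, htm, hmem, hsub⟩ := exists_Icc_mem_subset_of_mem_nhds hball
    obtain ⟨s, ⟨N, hsN⟩, hs⟩ : ∃ s, (∃ n, s ∈ π n) ∧
        ∃ U ∈ 𝓝 t, ∀ u ∈ U, s ≤ u ∧ ∀ r, s ≤ r → r ≤ u → r ∈ Set.Icc b c := by
      by_cases ht : ∃ a, a < t
      · obtain ⟨a, hat, ha⟩ := exists_Ioc_subset_of_mem_nhds hmem ht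
        obtain ⟨s, hsS, has, hst⟩ := hdense.exists_between hat
        refine ⟨s, hsS, Set.Ioi s ∩ Set.Icc b c, inter_mem (Ioi_mem_nhds hst) hmem,
          fun u hu => ⟨le_of_lt hu.1, fun r hsr hru => ⟨(ha ⟨has, hst.le⟩).1.trans hsr,
            hru.trans hu.2.2⟩⟩⟩
      · push Not at ht
        have hb : b = leftPt hT :=
          le_antisymm (htm.1.trans (ht _)) (leftPt_le hT b)
        exact ⟨leftPt hT, h0, Set.Icc b c, hmem, fun u hu => ⟨leftPt_le hT u,
          fun r hr hru => ⟨hb.trans_le hr, hru.trans hu.2⟩⟩⟩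
    obtain ⟨U, hU, hUs⟩ := hs
    refine ⟨U, by rwa [nhdsWithin_univ], N, fun n hn u hu => ?_⟩
    obtain ⟨hsu, hr⟩ := hUs u hu
    have hsn := hmono hn hsN
    obtain ⟨σ, -, hσu, hσ, he⟩ := exists_stepFun_apply_eq (p := p) ⟨s, hsn, hsu⟩
    rw [discr_apply, he]
    have e1 : ‖z σ - z t‖ < ε / 4 := hsub (hr σ (hσ s hsn hsu) hσu)
    have e2 : ‖z u - z t‖ < ε / 4 := hsub (hr u hsu le_rfl)
    rw [norm_sub_rev] at e2
    linarith [norm_sub_le_norm_sub_add_norm_sub (z σ) (z t) (z u)]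
  obtain ⟨N, hN⟩ := isCompact_univ.induction_on
    (p := fun U => ∃ N, ∀ n ≥ N, ∀ u ∈ U, ‖discr (π n) z u - z u‖ ≤ ε / 2)
    ⟨0, by simp⟩ (fun s t hst ⟨N, h⟩ => ⟨N, fun n hn u hu => h n hn u (hst hu)⟩)
    (fun s t ⟨N, h⟩ ⟨N', h'⟩ => ⟨max N N', fun n hn u hu => by
      rcases hu with hu | hu
      · exact h n ((le_max_left _ _).trans hn) u hu
      · exact h' n ((le_max_right _ _).trans hn) u hu⟩) hloc
  refine ⟨N, fun n hn => ?_⟩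
  rw [dist_eq_norm]
  exact lt_of_le_of_lt (Dp.norm_le (half_pos hε).le fun u => by
    rw [Dp.sub_apply]; exact hN n hn.le u (Set.mem_univ u)) (half_lt_self hε)

end StepFunctions

/-! ### Discretization of bilinear forms on càdlàg paths -/

section General

variable {E : Type*} [NormedAddCommGroup E] [NormedSpace ℝ E]

/-- The vectors on which a uniformly bounded family of functionals tends to zero. -/
def nullSubmodule {α : Type*} (A : α → E →L[ℝ] ℝ) (l : Filter α) : Submodule ℝ E where
  carrier := {y | Tendsto (fun a => A a y) l (𝓝 0)}
  zero_mem' := by simpa using tendsto_const_nhds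
  add_mem' := fun {x y} hx hy => by simpa using Tendsto.add hx hy
  smul_mem' := fun c x hx => by simpa using Tendsto.const_mul c hx

theorem mem_nullSubmodule {α : Type*} {A : α → E →L[ℝ] ℝ} {l : Filter α} {y : E} :
    y ∈ nullSubmodule A l ↔ Tendsto (fun a => A a y) l (𝓝 0) := Iff.rfl

theorem isClosed_nullSubmodule {α : Type*} {A : α → E →L[ℝ] ℝ} {K : ℝ}
    (hA : ∀ a y, |A a y| ≤ K * ‖y‖) (l : Filter α) :
    IsClosed (nullSubmodule A l : Set E) := by
  refine isClosed_of_closure_subset fun y hy => ?_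
  change Tendsto (fun a => A a y) l (𝓝 0)
  rw [Metric.tendsto_nhds]
  intro ε hε
  obtain ⟨z, hz, hyz⟩ := Metric.mem_closure_iff.1 hy (ε / (2 * (|K| + 1))) (by positivity)
  have hz' := Metric.tendsto_nhds.1 (mem_nullSubmodule.1 hz) (ε / 2) (half_pos hε)
  filter_upwards [hz'] with a ha
  rw [dist_zero_right, Real.norm_eq_abs] at ha ⊢
  rw [dist_eq_norm] at hyz
  have h1 : |A a (y - z)| ≤ ε / 2 :=
    calc |A a (y - z)| ≤ K * ‖y - z‖ := hA a _
      _ ≤ (|K| + 1) * (ε / (2 * (|K| + 1))) := by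
          gcongr
          linarith [le_abs_self K]
      _ = ε / 2 := by field_simp
  have h2 : A a y = A a (y - z) + A a z := by rw [← map_add, sub_add_cancel]
  rw [h2]
  linarith [abs_add_le (A a (y - z)) (A a z)]

/-- Signs can be chosen such that the off-diagonal terms of a bilinear form do not hurt. -/
theorem exists_sign_sum_abs_le {ι : Type*} (B : E →L[ℝ] E →L[ℝ] ℝ) (h h' : ι → E) (F : Finset ι) :
    ∃ ε δ : ι → ℝ, (∀ i, |ε i| ≤ 1) ∧ (∀ i, |δ i| ≤ 1) ∧
      ∑ i ∈ F, |B (h i) (h' i)| ≤ B (∑ i ∈ F, ε i • h i) (∑ i ∈ F, δ i • h' i) := by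
  classical
  induction F using Finset.induction_on with
  | empty => exact ⟨0, 0, by simp, by simp, by simp⟩
  | insert a F ha ih =>
    obtain ⟨ε, δ, hε, hδ, hle⟩ := ih
    set X := ∑ i ∈ F, ε i • h i
    set Y := ∑ i ∈ F, δ i • h' i
    obtain ⟨d, hd, hdB⟩ : ∃ d : ℝ, |d| ≤ 1 ∧ d * B (h a) (h' a) = |B (h a) (h' a)| := by
      rcases le_total 0 (B (h a) (h' a)) with h0 | h0
      · exact ⟨1, by simp, by rw [one_mul, abs_of_nonneg h0]⟩
      · exact ⟨-1, by simp, by rw [abs_of_nonpos h0]; ring⟩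
    obtain ⟨e, he, hee, hcross⟩ : ∃ e : ℝ, |e| ≤ 1 ∧ e * e = 1 ∧
        0 ≤ e * (d * B X (h' a) + B (h a) Y) := by
      rcases le_total 0 (d * B X (h' a) + B (h a) Y) with h0 | h0
      · exact ⟨1, by simp, by ring, by linarith⟩
      · exact ⟨-1, by simp, by ring, by linarith⟩
    refine ⟨Function.update ε a e, Function.update δ a (e * d), fun i => ?_, fun i => ?_, ?_⟩
    · rcases eq_or_ne i a with rfl | hi
      · simpa using he
      · simpa [hi] using hε i
    · rcases eq_or_ne i a with rfl | hi
      · rw [Function.update_self, abs_mul]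
        exact mul_le_one₀ he (abs_nonneg d) hd
      · simpa [hi] using hδ i
    · have hne : ∀ i ∈ F, i ≠ a := fun i hi hia => ha (hia ▸ hi)
      have eX : ∑ i ∈ F, Function.update ε a e i • h i = X :=
        Finset.sum_congr rfl fun i hi => by rw [Function.update_of_ne (hne i hi)]
      have eY : ∑ i ∈ F, Function.update δ a (e * d) i • h' i = Y :=
        Finset.sum_congr rfl fun i hi => by rw [Function.update_of_ne (hne i hi)]
      rw [Finset.sum_insert ha, Finset.sum_insert ha, Finset.sum_insert ha, eX, eY,
        Function.update_self, Function.update_self]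
      have expand : B (e • h a + X) ((e * d) • h' a + Y)
          = (e * e) * (d * B (h a) (h' a)) + e * (d * B X (h' a) + B (h a) Y) + B X Y := by
        simp only [map_add, map_smul, add_apply, smul_apply, smul_eq_mul]
        ring
      rw [expand, hee, hdB]
      linarith

end General

section Jumps

variable {T : ℝ} {p : ℕ}

theorem norm_jump_le (τ : Set.Icc (0 : ℝ) T) (v : EuclideanSpace ℝ (Fin p)) :
    ‖jump τ v‖ ≤ ‖v‖ := by
  refine Dp.norm_le (norm_nonneg _) fun u => ?_
  rw [jump_apply]
  split_ifs <;> simp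

theorem jump_sub_jump_apply {τ s : Set.Icc (0 : ℝ) T} (h : τ ≤ s) (v : EuclideanSpace ℝ (Fin p))
    (u : Set.Icc (0 : ℝ) T) :
    (jump τ v - jump s v) u = if τ ≤ u ∧ u < s then v else 0 := by
  rw [Dp.sub_apply, jump_apply, jump_apply]
  by_cases h1 : s ≤ u
  · rw [if_pos (h.trans h1), if_pos h1, if_neg fun h2 => absurd h2.2 (not_lt.2 h1), sub_self]
  · rw [if_neg h1, sub_zero]
    simp only [not_le.1 h1, and_true]

/-- Bumps `1_{[τᵢ, sᵢ)} vᵢ` over disjoint intervals add up without increasing the norm. -/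
theorem norm_sum_bump_le {ι : Type*} (F : Finset ι) {τ s : ι → Set.Icc (0 : ℝ) T}
    {v : ι → EuclideanSpace ℝ (Fin p)} {ε : ι → ℝ} (hε : ∀ i, |ε i| ≤ 1) (hv : ∀ i ∈ F, ‖v i‖ ≤ 1)
    (hinj : Set.InjOn τ F)
    (hs : ∀ i ∈ F, τ i ≤ s i ∧ ∀ j ∈ F, τ i < τ j → s i ≤ τ j) :
    ‖∑ i ∈ F, ε i • (jump (τ i) (v i) - jump (s i) (v i))‖ ≤ 1 := by
  refine Dp.norm_le zero_le_one fun u => ?_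
  rw [Dp.sum_apply]
  have hval : ∀ i ∈ F, (ε i • (jump (τ i) (v i) - jump (s i) (v i))) u
      = if τ i ≤ u ∧ u < s i then ε i • v i else 0 := fun i hi => by
    rw [Dp.smul_apply, jump_sub_jump_apply (hs i hi).1]
    split_ifs <;> simp
  by_cases h : ∃ i ∈ F, τ i ≤ u ∧ u < s i
  · obtain ⟨i, hi, hui⟩ := h
    have hsingle : ∑ j ∈ F, (ε j • (jump (τ j) (v j) - jump (s j) (v j))) u
        = (ε i • (jump (τ i) (v i) - jump (s i) (v i))) u := by
      refine Finset.sum_eq_single_of_mem i hi fun j hj hji => ?_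
      rw [hval j hj, if_neg]
      rintro ⟨h1, h2⟩
      rcases lt_trichotomy (τ i) (τ j) with hlt | heq | hlt
      · exact absurd (((hs i hi).2 j hj hlt).trans h1) (not_le.2 hui.2)
      · exact hji (hinj hj hi heq.symm)
      · exact absurd (((hs j hj).2 i hi hlt).trans hui.1) (not_le.2 h2)
    rw [hsingle, hval i hi, if_pos hui, norm_smul, Real.norm_eq_abs]
    exact mul_le_one₀ (hε i) (norm_nonneg _) (hv i hi)
  · rw [Finset.sum_eq_zero fun i hi => by rw [hval i hi, if_neg fun hc => h ⟨i, hi, hc⟩],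
      norm_zero]
    exact zero_le_one

theorem eventually_nhdsGT_le {ι : Type*} (F : Finset ι) (τ : ι → Set.Icc (0 : ℝ) T)
    (a : Set.Icc (0 : ℝ) T) :
    ∀ᶠ s in 𝓝[>] a, a ≤ s ∧ ∀ j ∈ F, a < τ j → s ≤ τ j := by
  have h1 : ∀ᶠ s in 𝓝[>] a, ∀ j ∈ F, a < τ j → s ≤ τ j := by
    rw [eventually_all_finset]
    intro j _
    by_cases h : a < τ j
    · filter_upwards [Ioc_mem_nhdsGT h] with s hs _ using hs.2
    · exact Eventually.of_forall fun s h' => absurd h' h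
  filter_upwards [h1, self_mem_nhdsWithin] with s hs ha using ⟨le_of_lt ha, hs⟩

/-- At `τ` the functional `ℓ` sees bumps `1_{[τ, s)} v` of arbitrarily small support with value
beyond `ε`. -/
def BadPoint (ℓ : Dp T p →L[ℝ] ℝ) (ε : ℝ) (τ : Set.Icc (0 : ℝ) T) : Prop :=
  ∃ v : EuclideanSpace ℝ (Fin p), ‖v‖ ≤ 1 ∧ ∃ᶠ s in 𝓝[>] τ, ε < |ℓ (jump τ v - jump s v)|

/-- At the pair of times `q` the bilinear form `B` sees pairs of bumps of arbitrarily small support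
with value beyond `ε`. -/
def BadPair (B : Dp T p →L[ℝ] Dp T p →L[ℝ] ℝ) (ε : ℝ)
    (q : Set.Icc (0 : ℝ) T × Set.Icc (0 : ℝ) T) : Prop :=
  ∃ v v' : EuclideanSpace ℝ (Fin p), ‖v‖ ≤ 1 ∧ ‖v'‖ ≤ 1 ∧ ∃ᶠ s in 𝓝[>] q.1 ×ˢ 𝓝[>] q.2,
    ε < |B (jump q.1 v - jump s.1 v) (jump q.2 v' - jump s.2 v')|

/-- A family of bad pairs, no two of which share a first or a second time, is bounded in number:
the bumps can be taken disjoint in both arguments, and their sums with suitable signs have norm at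
most one. -/
theorem card_mul_le_of_badPair (B : Dp T p →L[ℝ] Dp T p →L[ℝ] ℝ) {ε : ℝ}
    {F : Finset (Set.Icc (0 : ℝ) T × Set.Icc (0 : ℝ) T)} (hF : ∀ q ∈ F, BadPair B ε q)
    (h1 : Set.InjOn Prod.fst (F : Set (Set.Icc (0 : ℝ) T × Set.Icc (0 : ℝ) T)))
    (h2 : Set.InjOn Prod.snd (F : Set (Set.Icc (0 : ℝ) T × Set.Icc (0 : ℝ) T))) :
    F.card * ε ≤ ‖B‖ := by
  have hchoose : ∀ q : Set.Icc (0 : ℝ) T × Set.Icc (0 : ℝ) T, ∃ (v v' : EuclideanSpace ℝ (Fin p))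
      (s : Set.Icc (0 : ℝ) T × Set.Icc (0 : ℝ) T), q ∈ F → ‖v‖ ≤ 1 ∧ ‖v'‖ ≤ 1 ∧
        ε < |B (jump q.1 v - jump s.1 v) (jump q.2 v' - jump s.2 v')| ∧
        (q.1 ≤ s.1 ∧ ∀ r ∈ F, q.1 < r.1 → s.1 ≤ r.1) ∧
        (q.2 ≤ s.2 ∧ ∀ r ∈ F, q.2 < r.2 → s.2 ≤ r.2) := by
    intro q
    by_cases hq : q ∈ F
    · obtain ⟨v, v', hv, hv', hfreq⟩ := hF q hq
      obtain ⟨s, hs, hs'⟩ := (hfreq.and_eventually ((eventually_nhdsGT_le F Prod.fst q.1).prod_mk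
        (eventually_nhdsGT_le F Prod.snd q.2))).exists
      exact ⟨v, v', s, fun _ => ⟨hv, hv', hs, hs'.1, hs'.2⟩⟩
    · exact ⟨0, 0, q, fun h => absurd h hq⟩
  choose v v' s hvs using hchoose
  obtain ⟨e, d, he, hd, hle⟩ := exists_sign_sum_abs_le B
    (fun q => jump q.1 (v q) - jump (s q).1 (v q))
    (fun q => jump q.2 (v' q) - jump (s q).2 (v' q)) F
  have n1 := norm_sum_bump_le F he (fun q hq => (hvs q hq).1) h1 fun q hq => (hvs q hq).2.2.2.1
  have n2 := norm_sum_bump_le F hd (fun q hq => (hvs q hq).2.1) h2 fun q hq => (hvs q hq).2.2.2.2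
  calc (F.card : ℝ) * ε = ∑ _q ∈ F, ε := by rw [Finset.sum_const, nsmul_eq_mul]
    _ ≤ _ := Finset.sum_le_sum fun q hq => (hvs q hq).2.2.1.le
    _ ≤ _ := hle
    _ ≤ _ := le_abs_self _
    _ ≤ _ := abs_apply_apply_le_norm B _ _
    _ ≤ ‖B‖ * 1 * 1 := by
        have := B.opNorm_nonneg
        gcongr
    _ = ‖B‖ := by ring

theorem card_mul_le_of_badPoint (ℓ : Dp T p →L[ℝ] ℝ) {ε : ℝ} {F : Finset (Set.Icc (0 : ℝ) T)}
    (hF : ∀ τ ∈ F, BadPoint ℓ ε τ) : F.card * ε ≤ ‖ℓ‖ := by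
  have hchoose : ∀ τ : Set.Icc (0 : ℝ) T, ∃ (v : EuclideanSpace ℝ (Fin p))
      (s : Set.Icc (0 : ℝ) T) (e : ℝ), |e| ≤ 1 ∧ (τ ∈ F → ‖v‖ ≤ 1 ∧
        ε < e * ℓ (jump τ v - jump s v) ∧ (τ ≤ s ∧ ∀ r ∈ F, τ < r → s ≤ r)) := by
    intro τ
    by_cases hτ : τ ∈ F
    · obtain ⟨v, hv, hfreq⟩ := hF τ hτ
      obtain ⟨s, hs, hs'⟩ := (hfreq.and_eventually (eventually_nhdsGT_le F id τ)).exists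
      rcases le_total 0 (ℓ (jump τ v - jump s v)) with h0 | h0
      · exact ⟨v, s, 1, by simp, fun _ => ⟨hv, by rwa [one_mul, ← abs_of_nonneg h0], hs'⟩⟩
      · exact ⟨v, s, -1, by simp, fun _ => ⟨hv, by rwa [neg_one_mul, ← abs_of_nonpos h0], hs'⟩⟩
    · exact ⟨0, τ, 0, by simp, fun h => absurd h hτ⟩
  choose v s e he hvs using hchoose
  have n1 := norm_sum_bump_le F (τ := id) he (fun q hq => (hvs q hq).1) Function.injective_id.injOn
    fun q hq => (hvs q hq).2.2
  calc (F.card : ℝ) * ε = ∑ _q ∈ F, ε := by rw [Finset.sum_const, nsmul_eq_mul]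
    _ ≤ ∑ q ∈ F, e q * ℓ (jump q (v q) - jump (s q) (v q)) :=
        Finset.sum_le_sum fun q hq => (hvs q hq).2.1.le
    _ = ℓ (∑ q ∈ F, e q • (jump q (v q) - jump (s q) (v q))) := by
        rw [map_sum]
        exact Finset.sum_congr rfl fun q _ => by rw [map_smul, smul_eq_mul]
    _ ≤ _ := le_abs_self _
    _ ≤ ‖ℓ‖ * ‖∑ q ∈ F, e q • (jump q (v q) - jump (s q) (v q))‖ := ℓ.le_opNorm _
    _ ≤ ‖ℓ‖ * 1 := by gcongr; exact n1
    _ = ‖ℓ‖ := mul_one _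

theorem finite_badPoint (ℓ : Dp T p →L[ℝ] ℝ) {ε : ℝ} (hε : 0 < ε) :
    {τ | BadPoint ℓ ε τ}.Finite := by
  by_contra hinf
  obtain ⟨n, hn⟩ := exists_nat_gt (‖ℓ‖ / ε)
  obtain ⟨F, hF, hcard⟩ := Set.Infinite.exists_subset_card_eq hinf n
  have := card_mul_le_of_badPoint ℓ (F := F) fun τ hτ => hF hτ
  rw [hcard] at this
  rw [div_lt_iff₀ hε] at hn
  linarith

/-- All bad pairs meet one finite set of times, namely the times that occur in a largest family of
bad pairs without common first or second times. -/
theorem exists_finset_of_badPair (B : Dp T p →L[ℝ] Dp T p →L[ℝ] ℝ) {ε : ℝ} (hε : 0 < ε) :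
    ∃ V : Finset (Set.Icc (0 : ℝ) T), ∀ q, BadPair B ε q → q.1 ∈ V ∨ q.2 ∈ V := by
  classical
  let M : Set (Finset (Set.Icc (0 : ℝ) T × Set.Icc (0 : ℝ) T)) :=
    {F | (∀ q ∈ F, BadPair B ε q) ∧
      Set.InjOn Prod.fst (F : Set (Set.Icc (0 : ℝ) T × Set.Icc (0 : ℝ) T)) ∧
      Set.InjOn Prod.snd (F : Set (Set.Icc (0 : ℝ) T × Set.Icc (0 : ℝ) T))}
  have hbdd : BddAbove (Finset.card '' M) := by
    refine ⟨⌈‖B‖ / ε⌉₊, ?_⟩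
    rintro _ ⟨F, hF, rfl⟩
    have := card_mul_le_of_badPair B hF.1 hF.2.1 hF.2.2
    rw [← le_div_iff₀ hε] at this
    exact_mod_cast this.trans (Nat.le_ceil _)
  have hne : (Finset.card '' M).Nonempty := ⟨_, ∅, by simp [M], rfl⟩
  obtain ⟨F, hF, hcard⟩ := Nat.sSup_mem hne hbdd
  refine ⟨F.image Prod.fst ∪ F.image Prod.snd, fun q hq => ?_⟩
  by_contra hcon
  push Not at hcon
  have hq1 : ∀ r ∈ F, r.1 ≠ q.1 := fun r hr h =>
    hcon.1 (Finset.mem_union_left _ (Finset.mem_image.2 ⟨r, hr, h⟩))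
  have hq2 : ∀ r ∈ F, r.2 ≠ q.2 := fun r hr h =>
    hcon.2 (Finset.mem_union_right _ (Finset.mem_image.2 ⟨r, hr, h⟩))
  have hqF : q ∉ F := fun h => hq1 q h rfl
  have hmem : insert q F ∈ M := by
    refine ⟨fun r hr => ?_, ?_, ?_⟩
    · rcases Finset.mem_insert.1 hr with rfl | hr
      · exact hq
      · exact hF.1 r hr
    · rw [Finset.coe_insert, Set.injOn_insert (by simpa using hqF)]
      exact ⟨hF.2.1, by rintro ⟨r, hr, h⟩; exact hq1 r hr h⟩
    · rw [Finset.coe_insert, Set.injOn_insert (by simpa using hqF)]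
      exact ⟨hF.2.2, by rintro ⟨r, hr, h⟩; exact hq2 r hr h⟩
  have := le_csSup hbdd ⟨_, hmem, rfl⟩
  rw [Finset.card_insert_of_notMem hqF, ← hcard] at this
  omega

theorem exists_smul_norm_le_one (v : EuclideanSpace ℝ (Fin p)) :
    ∃ (c : ℝ) (u : EuclideanSpace ℝ (Fin p)), 0 < c ∧ ‖u‖ ≤ 1 ∧ v = c • u := by
  have hc : 0 < ‖v‖ + 1 := by positivity
  refine ⟨‖v‖ + 1, (‖v‖ + 1)⁻¹ • v, hc, ?_, by rw [smul_smul, mul_inv_cancel₀ hc.ne', one_smul]⟩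
  rw [norm_smul, norm_inv, Real.norm_of_nonneg hc.le, inv_mul_le_iff₀ hc]
  linarith

/-- A functional on càdlàg paths is right continuous along the jump functions, except at countably
many times. -/
theorem countable_badPoint (ℓ : Dp T p →L[ℝ] ℝ) : {τ | ∃ v : EuclideanSpace ℝ (Fin p),
    ¬Tendsto (fun s => ℓ (jump s v - jump τ v)) (𝓝[>] τ) (𝓝 0)}.Countable := by
  refine (Set.countable_iUnion fun k : ℕ =>
    (finite_badPoint ℓ (ε := 1 / ((k : ℝ) + 1)) (by positivity)).countable).mono ?_
  rintro τ ⟨v, hv⟩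
  obtain ⟨c, u, hc, hu, rfl⟩ := exists_smul_norm_le_one v
  rw [Metric.tendsto_nhds] at hv
  push Not at hv
  obtain ⟨ε, hε, hfreq⟩ := hv
  obtain ⟨k, hk⟩ := exists_nat_one_div_lt (div_pos hε hc)
  refine Set.mem_iUnion.2 ⟨k, u, hu, hfreq.mono fun s hs => ?_⟩
  rw [dist_zero_right, jump_smul, jump_smul, ← smul_sub, map_smul, norm_smul,
    Real.norm_of_nonneg hc.le, Real.norm_eq_abs, ← neg_sub, map_neg, abs_neg] at hs
  exact hk.trans_le (by rw [div_le_iff₀' hc]; exact hs)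

theorem jump_eq_sum (τ : Set.Icc (0 : ℝ) T) (v : EuclideanSpace ℝ (Fin p)) :
    jump τ v = ∑ i, v i • jump τ (EuclideanSpace.basisFun (Fin p) ℝ i) := by
  have hv : ∑ i, v i • EuclideanSpace.basisFun (Fin p) ℝ i = v := by
    simpa using (EuclideanSpace.basisFun (Fin p) ℝ).sum_repr v
  let L : EuclideanSpace ℝ (Fin p) →ₗ[ℝ] Dp T p := ⟨⟨jump τ, jump_add τ⟩, jump_smul τ⟩
  have h := congrArg L hv
  rw [map_sum] at h
  rw [show jump τ v = L v from rfl, ← h]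
  exact Finset.sum_congr rfl fun i _ => map_smul L _ _

/-- A bounded bilinear form is right continuous along the jump functions in its first argument, for
each second argument, at all except countably many times. The exceptional set does not depend on the
second argument: second arguments that jump at a time in a countable set `S` contribute countably
many times, and `S` can be chosen such that `(τ, τ')` is not a bad pair for `τ, τ' ∉ S`. A jump at
`τ' ∉ S` is then compared with a jump at a time in `S` shortly after `τ'`. -/
theorem countable_not_tendsto_jump (hT : 0 ≤ T) (B : Dp T p →L[ℝ] Dp T p →L[ℝ] ℝ) :
    {τ | ∃ (v : EuclideanSpace ℝ (Fin p)) (y : Dp T p),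
      ¬Tendsto (fun s => B (jump s v - jump τ v) y) (𝓝[>] τ) (𝓝 0)}.Countable := by
  classical
  obtain ⟨D, hDc, hDd⟩ := TopologicalSpace.exists_countable_dense (Set.Icc (0 : ℝ) T)
  have hV : ∀ k : ℕ, ∃ V : Finset (Set.Icc (0 : ℝ) T), ∀ q,
      BadPair B (1 / ((k : ℝ) + 1)) q → q.1 ∈ V ∨ q.2 ∈ V := fun k =>
    exists_finset_of_badPair B (by positivity)
  choose V hV using hV
  set S : Set (Set.Icc (0 : ℝ) T) := insert (rightPt hT) D ∪ ⋃ k, (V k : Set _)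
  have hSc : S.Countable :=
    (hDc.insert _).union (Set.countable_iUnion fun k => (V k).countable_toSet)
  have hC : (S ∪ ⋃ σ ∈ S, ⋃ i : Fin p, {τ | ∃ v : EuclideanSpace ℝ (Fin p),
      ¬Tendsto (fun s => B.flip (jump σ (EuclideanSpace.basisFun (Fin p) ℝ i))
        (jump s v - jump τ v)) (𝓝[>] τ) (𝓝 0)}).Countable :=
    hSc.union (hSc.biUnion fun σ _ => Set.countable_iUnion fun i => countable_badPoint _)
  refine hC.mono ?_
  rintro τ ⟨v, y, hvy⟩
  by_contra hτ
  simp only [Set.mem_union, Set.mem_iUnion, not_or, not_exists, Set.mem_ofPred_eq, not_not] at hτ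
  obtain ⟨hτS, hτ⟩ := hτ
  refine hvy ?_
  let A : Set.Icc (0 : ℝ) T → Dp T p →L[ℝ] ℝ := fun s => B (jump s v - jump τ v)
  have hA : ∀ s y, |A s y| ≤ (‖B‖ * (2 * ‖v‖)) * ‖y‖ := fun s y => by
    refine (abs_apply_apply_le_norm B _ _).trans ?_
    have := B.opNorm_nonneg
    have : ‖jump s v - jump τ v‖ ≤ 2 * ‖v‖ :=
      (norm_sub_le _ _).trans (by linarith [norm_jump_le s v, norm_jump_le τ v])
    gcongr
  have hjS : ∀ σ ∈ S, ∀ v' : EuclideanSpace ℝ (Fin p),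
      jump σ v' ∈ nullSubmodule A (𝓝[>] τ) := fun σ hσ v' => by
    rw [jump_eq_sum]
    exact Submodule.sum_mem _ fun i _ => Submodule.smul_mem _ _ (hτ σ hσ i v)
  refine mem_of_jump_mem hT (isClosed_nullSubmodule hA _) (fun τ' v' => ?_) y
  by_cases hτ' : τ' ∈ S
  · exact hjS τ' hτ' v'
  have hright : τ' < rightPt hT := lt_of_le_of_ne (le_rightPt hT τ') fun h =>
    hτ' (Or.inl (h ▸ Set.mem_insert _ _))
  obtain ⟨c, u, hc, hu, hcu⟩ := exists_smul_norm_le_one v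
  obtain ⟨c', u', hc', hu', hcu'⟩ := exists_smul_norm_le_one v'
  rw [mem_nullSubmodule, Metric.tendsto_nhds]
  intro η hη
  obtain ⟨k, hk⟩ := exists_nat_one_div_lt (show 0 < η / 2 / (c * c') by positivity)
  have hgood : ¬BadPair B (1 / ((k : ℝ) + 1)) (τ, τ') := fun hbad => by
    rcases hV k _ hbad with h | h
    · exact hτS (Or.inr (Set.mem_iUnion.2 ⟨k, h⟩))
    · exact hτ' (Or.inr (Set.mem_iUnion.2 ⟨k, h⟩))
  have hev : ∀ᶠ s in 𝓝[>] τ ×ˢ 𝓝[>] τ',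
      |B (jump τ u - jump s.1 u) (jump τ' u' - jump s.2 u')| ≤ 1 / ((k : ℝ) + 1) := by
    by_contra hcon
    exact hgood ⟨u, u', hu, hu', (not_eventually.1 hcon).mono fun s hs => not_le.1 hs⟩
  obtain ⟨pa, hpa, pb, hpb, hab⟩ := eventually_prod_iff.1 hev
  obtain ⟨b, hb, hsub⟩ := (mem_nhdsGT_iff_exists_Ioo_subset' hright).1 hpb
  -- `s'` is a time in `S` shortly after `τ'`; it replaces `τ'` at the cost of a small bump
  obtain ⟨s', hs'D, hτs', hs'b⟩ := hDd.exists_between (show τ' < b from hb)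
  have hs'S : s' ∈ S := Or.inl (Set.mem_insert_of_mem _ hs'D)
  have hlim := Metric.tendsto_nhds.1 (mem_nullSubmodule.1 (hjS s' hs'S v')) (η / 2) (half_pos hη)
  filter_upwards [hpa, hlim] with s hs hs2
  rw [dist_zero_right, Real.norm_eq_abs] at hs2 ⊢
  have h3 := hab hs (hsub ⟨hτs', hs'b⟩)
  have e : A s (jump τ' v') = -(c * c') * B (jump τ u - jump s u) (jump τ' u' - jump s' u')
      + A s (jump s' v') := by
    simp only [A, hcu, hcu', jump_smul, map_sub, map_smul, sub_apply, smul_apply, smul_eq_mul]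
    ring
  rw [e]
  have h4 : |-(c * c') * B (jump τ u - jump s u) (jump τ' u' - jump s' u')| < η / 2 := by
    rw [abs_mul, abs_neg, abs_of_pos (by positivity : 0 < c * c')]
    calc _ ≤ (c * c') * (1 / ((k : ℝ) + 1)) := by gcongr
      _ < (c * c') * (η / 2 / (c * c')) := by gcongr
      _ = η / 2 := by field_simp
  linarith [abs_add_le (-(c * c') * B (jump τ u - jump s u) (jump τ' u' - jump s' u'))
    (A s (jump s' v'))]

/-- For every bounded bilinear form there are finer and finer discretizations along which it
converges in its first argument, for all pairs of càdlàg paths. -/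
theorem exists_tendsto_discr (hT : 0 ≤ T) (B : Dp T p →L[ℝ] Dp T p →L[ℝ] ℝ) :
    ∃ π : ℕ → Finset (Set.Icc (0 : ℝ) T), Monotone π ∧ Dense {t | ∃ n, t ∈ π n} ∧
      (∃ n, leftPt hT ∈ π n) ∧
      ∀ x y, Tendsto (fun n => B (discr (π n) x) y) atTop (𝓝 (B x y)) := by
  classical
  obtain ⟨D, hDc, hDd⟩ := TopologicalSpace.exists_countable_dense (Set.Icc (0 : ℝ) T)
  set bad := {τ | ∃ (v : EuclideanSpace ℝ (Fin p)) (y : Dp T p),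
      ¬Tendsto (fun s => B (jump s v - jump τ v) y) (𝓝[>] τ) (𝓝 0)}
  have hSc : (insert (leftPt hT) (insert (rightPt hT) (D ∪ bad))).Countable :=
    ((hDc.union (countable_not_tendsto_jump hT B)).insert _).insert _
  obtain ⟨f, hf⟩ := hSc.exists_eq_range (Set.insert_nonempty _ _)
  let π : ℕ → Finset (Set.Icc (0 : ℝ) T) := fun n => (Finset.range (n + 1)).image f
  have hmono : Monotone π := fun m n hmn =>
    Finset.image_subset_image (Finset.range_mono (by omega))
  have hmem : ∀ t, (∃ n, t ∈ π n) ↔ t ∈ insert (leftPt hT) (insert (rightPt hT) (D ∪ bad)) := by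
    intro t
    rw [hf]
    constructor
    · rintro ⟨n, hn⟩
      obtain ⟨k, -, hk⟩ := Finset.mem_image.1 hn
      exact ⟨k, hk⟩
    · rintro ⟨k, hk⟩
      exact ⟨k, Finset.mem_image.2 ⟨k, Finset.mem_range.2 (by omega), hk⟩⟩
  have hdense : Dense {t | ∃ n, t ∈ π n} := hDd.mono fun t ht =>
    (hmem t).2 (Or.inr (Or.inr (Or.inl ht)))
  obtain ⟨N, hN⟩ := (hmem (rightPt hT)).2 (Or.inr (Or.inl rfl))
  refine ⟨π, hmono, hdense, (hmem _).2 (Or.inl rfl), fun x y => ?_⟩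
  let A : ℕ → Dp T p →L[ℝ] ℝ := fun n => (B.flip y).comp (discr (π n) - ContinuousLinearMap.id ℝ _)
  have hAe : ∀ n x, A n x = B (discr (π n) x) y - B x y := fun n x => by simp [A]
  have hA : ∀ n x, |A n x| ≤ (2 * ‖B‖ * ‖y‖) * ‖x‖ := fun n x => by
    rw [hAe]
    have h1 := abs_apply_apply_le_norm B (discr (π n) x) y
    have h2 := abs_apply_apply_le_norm B x y
    have h3 : ‖B‖ * ‖discr (π n) x‖ * ‖y‖ ≤ ‖B‖ * ‖x‖ * ‖y‖ := by
      have := B.opNorm_nonneg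
      have := norm_discr_apply_le (π n) x
      gcongr
    have h4 := abs_sub (B (discr (π n) x) y) (B x y)
    linarith
  suffices h : x ∈ nullSubmodule A atTop by
    rw [mem_nullSubmodule] at h
    simpa [hAe] using h.add_const (B x y)
  refine mem_of_jump_mem hT (isClosed_nullSubmodule hA _) (fun τ v => ?_) x
  rw [mem_nullSubmodule]
  by_cases hτ : ∃ n, τ ∈ π n
  · obtain ⟨m, hm⟩ := hτ
    refine tendsto_const_nhds.congr' ?_
    filter_upwards [eventually_ge_atTop m] with n hn
    rw [hAe, discr_jump (hmono hn hm) le_rfl (fun r _ h => h), sub_self]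
  · have hgood : τ ∉ bad := fun h => hτ ((hmem τ).2 (Or.inr (Or.inr (Or.inr h))))
    have hlim : Tendsto (fun s => B (jump s v - jump τ v) y) (𝓝[>] τ) (𝓝 0) := by
      by_contra hcon
      exact hgood ⟨v, y, hcon⟩
    have hright : τ < rightPt hT := lt_of_le_of_ne (le_rightPt hT τ) fun h => hτ ⟨N, h ▸ hN⟩
    rw [Metric.tendsto_nhds] at hlim ⊢
    intro η hη
    obtain ⟨b, hb, hsub⟩ := (mem_nhdsGT_iff_exists_Ioo_subset' hright).1 (hlim η hη)
    obtain ⟨s, ⟨m, hsm⟩, hτs, hsb⟩ := hdense.exists_between (show τ < b from hb)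
    filter_upwards [eventually_ge_atTop m] with n hn
    have hsn := hmono hn hsm
    -- discretization moves the jump from `τ` to the next point `c` of the partition
    obtain ⟨c, hc, hcmin⟩ := Finset.exists_min_image ((π n).filter (τ ≤ ·)) id
      ⟨s, Finset.mem_filter.2 ⟨hsn, hτs.le⟩⟩
    obtain ⟨hcπ, hτc⟩ := Finset.mem_filter.1 hc
    have hmin : ∀ r ∈ π n, τ ≤ r → c ≤ r := fun r hr hτr =>
      hcmin r (Finset.mem_filter.2 ⟨hr, hτr⟩)
    have hτc' : τ < c := lt_of_le_of_ne hτc fun h => hτ ⟨n, h ▸ hcπ⟩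
    have h := hsub ⟨hτc', (hmin s hsn hτs.le).trans_lt hsb⟩
    rw [hAe, discr_jump hcπ hτc hmin]
    simpa using h

end Jumps

/-! ### Bilinear forms on Gaussian vectors with a given covariance -/

section FiniteDimensional

open scoped Matrix RealInnerProductSpace

variable {ι : Type*} [Fintype ι]

theorem integrable_coord_mul_coord {α : Type*} [MeasurableSpace α] {μ : Measure α}
    {X : α → EuclideanSpace ℝ ι} (hX : MemLp X 2 μ) (a c : ι) :
    Integrable (fun ω => X ω a * X ω c) μ :=
  ((EuclideanSpace.proj (𝕜 := ℝ) a).comp_memLp' hX).integrable_mul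
    ((EuclideanSpace.proj (𝕜 := ℝ) c).comp_memLp' hX)

theorem apply_apply_eq_sum (b : EuclideanSpace ℝ ι →L[ℝ] EuclideanSpace ℝ ι →L[ℝ] ℝ)
    (x y : EuclideanSpace ℝ ι) :
    b x y = ∑ a, ∑ c, x a * y c *
      b (EuclideanSpace.basisFun ι ℝ a) (EuclideanSpace.basisFun ι ℝ c) := by
  have hx : ∀ z : EuclideanSpace ℝ ι, ∑ a, z a • EuclideanSpace.basisFun ι ℝ a = z := fun z => by
    simpa using (EuclideanSpace.basisFun ι ℝ).sum_repr z
  conv_lhs => rw [← hx x, ← hx y]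
  simp only [map_sum, map_smul, sum_apply, smul_apply, smul_eq_mul]
  rw [Finset.sum_comm]
  refine Finset.sum_congr rfl fun a _ => ?_
  rw [Finset.mul_sum]
  exact Finset.sum_congr rfl fun c _ => by ring

theorem integral_apply_apply_eq_sum {α : Type*} [MeasurableSpace α] {μ : Measure α}
    {X : α → EuclideanSpace ℝ ι} (hX : MemLp X 2 μ)
    (b : EuclideanSpace ℝ ι →L[ℝ] EuclideanSpace ℝ ι →L[ℝ] ℝ) :
    ∫ ω, b (X ω) (X ω) ∂μ = ∑ a, ∑ c, (∫ ω, X ω a * X ω c ∂μ) *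
      b (EuclideanSpace.basisFun ι ℝ a) (EuclideanSpace.basisFun ι ℝ c) := by
  simp_rw [fun ω => apply_apply_eq_sum b (X ω) (X ω)]
  rw [integral_finsetSum _ fun a _ => integrable_finsetSum _ fun c _ =>
    (integrable_coord_mul_coord hX a c).mul_const _]
  refine Finset.sum_congr rfl fun a _ => ?_
  rw [integral_finsetSum _ fun c _ => (integrable_coord_mul_coord hX a c).mul_const _]
  exact Finset.sum_congr rfl fun c _ => integral_mul_const _ _

/-- The integral of a quadratic form depends on the second moments only. -/
theorem integral_apply_apply_congr {α β : Type*} [MeasurableSpace α] [MeasurableSpace β]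
    {μ : Measure α} {ν : Measure β} {X : α → EuclideanSpace ℝ ι} {Y : β → EuclideanSpace ℝ ι}
    (hX : MemLp X 2 μ) (hY : MemLp Y 2 ν)
    (h : ∀ a c, ∫ ω, X ω a * X ω c ∂μ = ∫ ω, Y ω a * Y ω c ∂ν)
    (b : EuclideanSpace ℝ ι →L[ℝ] EuclideanSpace ℝ ι →L[ℝ] ℝ) :
    ∫ ω, b (X ω) (X ω) ∂μ = ∫ ω, b (Y ω) (Y ω) ∂ν := by
  rw [integral_apply_apply_eq_sum hX, integral_apply_apply_eq_sum hY]
  simp_rw [h]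

/-- The matrix of second moments. -/
def momentMatrix {α : Type*} [MeasurableSpace α] (μ : Measure α) (X : α → EuclideanSpace ℝ ι) :
    Matrix ι ι ℝ :=
  Matrix.of fun a c => ∫ ω, X ω a * X ω c ∂μ

theorem dotProduct_momentMatrix {α : Type*} [MeasurableSpace α] {μ : Measure α}
    {X : α → EuclideanSpace ℝ ι} (hX : MemLp X 2 μ) (x : ι → ℝ) :
    x ⬝ᵥ momentMatrix μ X *ᵥ x = ∫ ω, (∑ a, x a * X ω a) ^ 2 ∂μ := by
  have h : ∀ ω, (∑ a, x a * X ω a) ^ 2 = ∑ a, ∑ c, x a * (X ω a * X ω c * x c) := fun ω => by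
    rw [sq, Finset.sum_mul_sum]
    exact Finset.sum_congr rfl fun a _ => Finset.sum_congr rfl fun c _ => by ring
  simp_rw [h]
  rw [integral_finsetSum _ fun a _ => integrable_finsetSum _ fun c _ =>
    ((integrable_coord_mul_coord hX a c).mul_const _).const_mul _]
  refine Finset.sum_congr rfl fun a _ => ?_
  rw [integral_finsetSum _ fun c _ =>
    ((integrable_coord_mul_coord hX a c).mul_const _).const_mul _, Matrix.mulVec, dotProduct,
    Finset.mul_sum]
  refine Finset.sum_congr rfl fun c _ => ?_
  rw [integral_const_mul, integral_mul_const]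
  rfl

theorem posSemidef_momentMatrix {α : Type*} [MeasurableSpace α] {μ : Measure α}
    {X : α → EuclideanSpace ℝ ι} (hX : MemLp X 2 μ) : (momentMatrix μ X).PosSemidef := by
  refine Matrix.PosSemidef.of_dotProduct_mulVec_nonneg ?_ fun x => ?_
  · ext a c
    simp [momentMatrix, mul_comm]
  · rw [star_trivial, dotProduct_momentMatrix hX]
    exact integral_nonneg fun ω => sq_nonneg _

variable [DecidableEq ι]

theorem momentMatrix_multivariateGaussian {M : Matrix ι ι ℝ} (hM : M.PosSemidef) (a c : ι) :
    ∫ x, x a * x c ∂(multivariateGaussian 0 M) = M a c := by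
  have h0 : ∀ a : ι, ∫ x : EuclideanSpace ℝ ι, x a ∂(multivariateGaussian 0 M) = 0 := fun a => by
    have := (EuclideanSpace.proj (𝕜 := ℝ) a).integral_comp_id_comm
      (IsGaussian.integrable_id (μ := multivariateGaussian (0 : EuclideanSpace ℝ ι) M))
    simpa using this
  rw [← covariance_eval_multivariateGaussian (μ := 0) hM a c, covariance_eq_sub]
  · simp [h0]
  · exact (EuclideanSpace.proj (𝕜 := ℝ) a).comp_memLp' IsGaussian.memLp_two_id
  · exact (EuclideanSpace.proj (𝕜 := ℝ) c).comp_memLp' IsGaussian.memLp_two_id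

/-- A centred Gaussian measure is determined by its matrix of second moments. -/
theorem eq_multivariateGaussian {ν : Measure (EuclideanSpace ℝ ι)} [IsGaussian ν]
    (h0 : ∫ x, x ∂ν = 0) : ν = multivariateGaussian 0 (momentMatrix ν id) := by
  have hL : MemLp (id : EuclideanSpace ℝ ι → EuclideanSpace ℝ ι) 2 ν := IsGaussian.memLp_two_id
  refine Measure.ext_of_charFun (funext fun t => ?_)
  rw [charFun_multivariateGaussian (posSemidef_momentMatrix hL), IsGaussian.charFun_eq',
    covarianceBilin_self hL, dotProduct_momentMatrix hL, variance_of_integral_eq_zero]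
  · have : ∫ x, id x ∂ν = 0 := h0
    rw [this]
    congr 4
    refine integral_congr_ae (Eventually.of_forall fun x => ?_)
    simp [PiLp.inner_apply, mul_comm]
  · fun_prop
  · rw [integral_inner IsGaussian.integrable_fun_id, h0, inner_zero_right]

theorem conv_multivariateGaussian {M₁ M₂ : Matrix ι ι ℝ} (h₁ : M₁.PosSemidef)
    (h₂ : M₂.PosSemidef) :
    (multivariateGaussian 0 M₁).conv (multivariateGaussian 0 M₂)
      = multivariateGaussian 0 (M₁ + M₂) := by
  refine Measure.ext_of_charFun (funext fun t => ?_)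
  rw [charFun_conv, charFun_multivariateGaussian h₁, charFun_multivariateGaussian h₂,
    charFun_multivariateGaussian (h₁.add h₂), ← Complex.exp_add, Matrix.add_mulVec, dotProduct_add]
  congr 1
  simp
  ring

theorem map_neg_multivariateGaussian {M : Matrix ι ι ℝ} (h : M.PosSemidef) :
    (multivariateGaussian 0 M).map (fun x => -x) = multivariateGaussian 0 M := by
  refine Measure.ext_of_charFun (funext fun t => ?_)
  have e : (fun x : EuclideanSpace ℝ ι => -x) = fun x => (-1 : ℝ) • x := by ext; simp
  rw [e, charFun_map_smul, charFun_multivariateGaussian h, charFun_multivariateGaussian h]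
  simp [Matrix.mulVec_neg]

theorem map_sub_multivariateGaussian {M₁ M₂ : Matrix ι ι ℝ} (h₁ : M₁.PosSemidef)
    (h₂ : M₂.PosSemidef) :
    ((multivariateGaussian 0 M₁).prod (multivariateGaussian 0 M₂)).map (fun q => q.1 - q.2)
      = multivariateGaussian 0 (M₁ + M₂) := by
  have e : (fun q : EuclideanSpace ℝ ι × EuclideanSpace ℝ ι => q.1 - q.2)
      = (fun q => q.1 + q.2) ∘ Prod.map id fun x => -x := by
    ext q; simp [sub_eq_add_neg]
  rw [e, ← Measure.map_map (by fun_prop) (by fun_prop), ← Measure.map_prod_map _ _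
    measurable_id (by fun_prop), Measure.map_id, map_neg_multivariateGaussian h₂,
    ← conv_multivariateGaussian h₁ h₂, Measure.conv]

theorem integral_mul_le_sqrt_mul_sqrt {α : Type*} [MeasurableSpace α] {μ : Measure α}
    {f g : α → ℝ} (hf0 : ∀ x, 0 ≤ f x) (hg0 : ∀ x, 0 ≤ g x) (hf : MemLp f 2 μ)
    (hg : MemLp g 2 μ) :
    ∫ x, f x * g x ∂μ ≤ √(∫ x, f x ^ 2 ∂μ) * √(∫ x, g x ^ 2 ∂μ) := by
  have h := integral_mul_le_Lp_mul_Lq_of_nonneg Real.HolderConjugate.two_two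
    (Eventually.of_forall hf0 : 0 ≤ᵐ[μ] f) (Eventually.of_forall hg0 : 0 ≤ᵐ[μ] g)
    (by simpa using hf) (by simpa using hg)
  simpa [Real.sqrt_eq_rpow] using h

variable {E : Type*} [NormedAddCommGroup E] [NormedSpace ℝ E]

/-- Let the centred Gaussian measure `ν` have the second moments of `j`. Then the `L¹`-norm of
`B[L₁ j, L₂ j]` is controlled by the second moments of `L₁` and `L₂` under `ν`, although `j`
need not be bounded in any norm. With `ε` the sign of `B[L₁ j, L₂ j]`, split `ν` into the
convolution of the centred Gaussian measures with the second moments of `j` on `ε ≥ 0` and on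
`ε < 0`. If `V₁`, `V₂` are independent with these laws, then the `L¹`-norm equals
`𝔼 B[L₁ V₁, L₂ V₁] - 𝔼 B[L₁ V₂, L₂ V₂] = 𝔼 B[L₁ (V₁ + V₂), L₂ (V₁ - V₂)]`, and both `V₁ + V₂` and
`V₁ - V₂` have law `ν`. -/
theorem integral_abs_apply_le {U : Type*} [MeasurableSpace U] {Λ : Measure U}
    {ν : Measure (EuclideanSpace ℝ ι)} [IsGaussian ν] (h0 : ∫ x, x ∂ν = 0)
    {j : U → EuclideanSpace ℝ ι} (hjm : Measurable j) (hj : MemLp j 2 Λ)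
    (hcov : ∀ a c, ∫ x, x a * x c ∂ν = ∫ u, j u a * j u c ∂Λ)
    (B : E →L[ℝ] E →L[ℝ] ℝ) (L₁ L₂ : EuclideanSpace ℝ ι →L[ℝ] E) :
    ∫ u, |B (L₁ (j u)) (L₂ (j u))| ∂Λ
      ≤ ‖B‖ * (√(∫ x, ‖L₁ x‖ ^ 2 ∂ν) * √(∫ x, ‖L₂ x‖ ^ 2 ∂ν)) := by
  set b : EuclideanSpace ℝ ι →L[ℝ] EuclideanSpace ℝ ι →L[ℝ] ℝ := B.bilinearComp L₁ L₂
  have hbj : Measurable fun u => b (j u) (j u) :=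
    (continuous_apply_apply (continuous_const (y := b)) continuous_id continuous_id).measurable.comp
      hjm
  have hbi : Integrable (fun u => b (j u) (j u)) Λ := integrable_apply_apply b hj hj
  set A : Set U := {u | 0 ≤ b (j u) (j u)}
  have hAm : MeasurableSet A := measurableSet_le measurable_const hbj
  set M₁ := momentMatrix (Λ.restrict A) j
  set M₂ := momentMatrix (Λ.restrict Aᶜ) j
  have hM₁ : M₁.PosSemidef := posSemidef_momentMatrix (hj.mono_measure Measure.restrict_le_self)
  have hM₂ : M₂.PosSemidef := posSemidef_momentMatrix (hj.mono_measure Measure.restrict_le_self)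
  have hν : ν = multivariateGaussian 0 (M₁ + M₂) := by
    rw [eq_multivariateGaussian h0]
    congr 1
    ext a c
    simp only [M₁, M₂, momentMatrix, Matrix.add_apply, Matrix.of_apply, id]
    rw [hcov, integral_add_compl hAm (integrable_coord_mul_coord hj a c)]
  set μ₁ := multivariateGaussian 0 M₁
  set μ₂ := multivariateGaussian 0 M₂
  have hadd : (μ₁.prod μ₂).map (fun q => q.1 + q.2) = ν := by
    rw [hν, ← conv_multivariateGaussian hM₁ hM₂, Measure.conv]
  have hsub : (μ₁.prod μ₂).map (fun q => q.1 - q.2) = ν := by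
    rw [hν, ← map_sub_multivariateGaussian hM₁ hM₂]
  have hid₁ : MemLp (id : EuclideanSpace ℝ ι → _) 2 μ₁ := IsGaussian.memLp_two_id
  have hid₂ : MemLp (id : EuclideanSpace ℝ ι → _) 2 μ₂ := IsGaussian.memLp_two_id
  have e1 : ∫ u in A, b (j u) (j u) ∂Λ = ∫ x, b x x ∂μ₁ :=
    integral_apply_apply_congr (hj.mono_measure Measure.restrict_le_self) hid₁
      (fun a c => (momentMatrix_multivariateGaussian hM₁ a c).symm) b
  have e2 : ∫ u in Aᶜ, b (j u) (j u) ∂Λ = ∫ x, b x x ∂μ₂ :=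
    integral_apply_apply_congr (hj.mono_measure Measure.restrict_le_self) hid₂
      (fun a c => (momentMatrix_multivariateGaussian hM₂ a c).symm) b
  have hf : MemLp (fun q : EuclideanSpace ℝ ι × EuclideanSpace ℝ ι => q.1) 2 (μ₁.prod μ₂) :=
    hid₁.comp_fst μ₂
  have hs : MemLp (fun q : EuclideanSpace ℝ ι × EuclideanSpace ℝ ι => q.2) 2 (μ₁.prod μ₂) :=
    hid₂.comp_snd μ₁
  have hcross : ∫ q, b q.1 q.2 ∂(μ₁.prod μ₂) = 0 := by
    rw [integral_prod _ (integrable_apply_apply b hf hs)]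
    refine integral_eq_zero_of_ae (Eventually.of_forall fun x => ?_)
    change ∫ y, b x y ∂μ₂ = 0
    rw [(b x).integral_comp_comm IsGaussian.integrable_fun_id, integral_id_multivariateGaussian,
      map_zero]
  have hcross' : ∫ q, b q.2 q.1 ∂(μ₁.prod μ₂) = 0 := by
    rw [integral_prod_symm _ (integrable_apply_apply b hs hf)]
    refine integral_eq_zero_of_ae (Eventually.of_forall fun x => ?_)
    change ∫ y, b x y ∂μ₁ = 0
    rw [(b x).integral_comp_comm IsGaussian.integrable_fun_id, integral_id_multivariateGaussian,
      map_zero]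
  have hprod : ∫ u, |b (j u) (j u)| ∂Λ = ∫ q, b (q.1 + q.2) (q.1 - q.2) ∂(μ₁.prod μ₂) := by
    have h3 : ∀ q : EuclideanSpace ℝ ι × EuclideanSpace ℝ ι, b (q.1 + q.2) (q.1 - q.2)
        = b q.1 q.1 - b q.2 q.2 - (b q.1 q.2 - b q.2 q.1) := fun q => by
      simp only [map_add, map_sub, add_apply]
      ring
    have h4 := integral_sub ((integrable_apply_apply b hf hf).sub (integrable_apply_apply b hs hs))
      ((integrable_apply_apply b hf hs).sub (integrable_apply_apply b hs hf))
    simp only [Pi.sub_apply] at h4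
    simp_rw [h3]
    rw [h4, integral_sub (integrable_apply_apply b hf hf) (integrable_apply_apply b hs hs),
      integral_sub (integrable_apply_apply b hf hs) (integrable_apply_apply b hs hf), hcross,
      hcross', integral_fun_fst (fun x => b x x), integral_fun_snd (fun x => b x x), ← e1, ← e2,
      ← integral_add_compl hAm hbi.abs]
    have p1 : ∫ u in A, |b (j u) (j u)| ∂Λ = ∫ u in A, b (j u) (j u) ∂Λ :=
      setIntegral_congr_fun hAm fun u hu => abs_of_nonneg hu
    have p2 : ∫ u in Aᶜ, |b (j u) (j u)| ∂Λ = -∫ u in Aᶜ, b (j u) (j u) ∂Λ := by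
      rw [← integral_neg]
      exact setIntegral_congr_fun hAm.compl fun u hu => abs_of_neg (not_le.1 hu)
    rw [p1, p2]
    simp
    ring
  have hL₁ : MemLp (fun q : EuclideanSpace ℝ ι × EuclideanSpace ℝ ι => ‖L₁ (q.1 + q.2)‖) 2
      (μ₁.prod μ₂) := (L₁.comp_memLp' (hf.add hs)).norm
  have hL₂ : MemLp (fun q : EuclideanSpace ℝ ι × EuclideanSpace ℝ ι => ‖L₂ (q.1 - q.2)‖) 2
      (μ₁.prod μ₂) := (L₂.comp_memLp' (hf.sub hs)).norm
  have n1 : ∫ q, ‖L₁ (q.1 + q.2)‖ ^ 2 ∂(μ₁.prod μ₂) = ∫ x, ‖L₁ x‖ ^ 2 ∂ν := by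
    rw [← hadd, integral_map (by fun_prop)]
    exact (L₁.continuous.norm.pow 2).aestronglyMeasurable
  have n2 : ∫ q, ‖L₂ (q.1 - q.2)‖ ^ 2 ∂(μ₁.prod μ₂) = ∫ x, ‖L₂ x‖ ^ 2 ∂ν := by
    rw [← hsub, integral_map (by fun_prop)]
    exact (L₂.continuous.norm.pow 2).aestronglyMeasurable
  calc ∫ u, |B (L₁ (j u)) (L₂ (j u))| ∂Λ
      = ∫ q, b (q.1 + q.2) (q.1 - q.2) ∂(μ₁.prod μ₂) := hprod
    _ ≤ ∫ q, ‖B‖ * (‖L₁ (q.1 + q.2)‖ * ‖L₂ (q.1 - q.2)‖) ∂(μ₁.prod μ₂) := by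
        refine integral_mono (integrable_apply_apply b (hf.add hs) (hf.sub hs))
          ((hL₁.integrable_mul hL₂).const_mul _) fun q => ?_
        refine (le_abs_self _).trans ((abs_apply_apply_le_norm B _ _).trans_eq ?_)
        simp [mul_assoc]
    _ ≤ _ := by
        rw [integral_const_mul, ← n1, ← n2]
        exact mul_le_mul_of_nonneg_left (integral_mul_le_sqrt_mul_sqrt
          (fun _ => norm_nonneg _) (fun _ => norm_nonneg _) hL₁ hL₂) B.opNorm_nonneg

end FiniteDimensional

/-! ### Gaussian random elements of a Banach space -/

section GaussianElement

variable {Ω : Type*} [MeasurableSpace Ω] {P : Measure Ω}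

/-- An almost sure limit of centred Gaussian random variables is centred Gaussian: the
characteristic functions `exp (-v_n t² / 2)` converge to a function that is continuous at `0`,
hence the variances `v_n` converge. -/
theorem exists_map_eq_gaussianReal_of_tendsto [IsProbabilityMeasure P]
    {X : ℕ → Ω → ℝ} {Y : Ω → ℝ} {v : ℕ → NNReal}
    (hXm : ∀ n, AEMeasurable (X n) P) (hX : ∀ n, P.map (X n) = gaussianReal 0 (v n))
    (hlim : ∀ᵐ ω ∂P, Tendsto (fun n => X n ω) atTop (𝓝 (Y ω))) :
    ∃ v : NNReal, P.map Y = gaussianReal 0 v := by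
  have hYm : AEMeasurable Y P := aemeasurable_of_tendsto_metrizable_ae atTop hXm hlim
  have : IsProbabilityMeasure (P.map Y) := Measure.isProbabilityMeasure_map hYm
  have hc : ∀ {W : Ω → ℝ}, AEMeasurable W P → ∀ t : ℝ, charFun (P.map W) t
      = ∫ ω, Complex.exp (t * W ω * Complex.I) ∂P := fun {W} hW t => by
    rw [charFun_apply_real, integral_map hW (by fun_prop)]
  have hφ : ∀ t : ℝ, Tendsto (fun n => Complex.exp (-((v n : ℝ) * t ^ 2 / 2 : ℝ))) atTop
      (𝓝 (charFun (P.map Y) t)) := fun t => by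
    have e : (fun n => Complex.exp (-((v n : ℝ) * t ^ 2 / 2 : ℝ)))
        = fun n => ∫ ω, Complex.exp (t * X n ω * Complex.I) ∂P := by
      funext n
      rw [← hc (hXm n), hX, charFun_gaussianReal]
      push_cast
      simp
    rw [e, hc hYm]
    refine tendsto_integral_of_dominated_convergence (fun _ => (1 : ℝ)) (fun n => ?_)
      (integrable_const _) (fun n => Eventually.of_forall fun ω => ?_) ?_
    · have h1 : Continuous fun x : ℝ => Complex.exp (t * x * Complex.I) := by fun_prop
      exact (h1.measurable.comp_aemeasurable (hXm n)).aestronglyMeasurable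
    · rw [show (t : ℂ) * X n ω * Complex.I = ((t * X n ω : ℝ) : ℂ) * Complex.I by push_cast; ring,
        Complex.norm_exp_ofReal_mul_I]
    · filter_upwards [hlim] with ω hω
      have h1 : Continuous fun x : ℝ => Complex.exp (t * x * Complex.I) := by fun_prop
      exact (h1.tendsto _).comp hω
  obtain ⟨t, ht0, ht⟩ : ∃ t : ℝ, t ≠ 0 ∧ 0 < ‖charFun (P.map Y) t‖ := by
    have h1 : Tendsto (fun t => ‖charFun (P.map Y) t‖) (𝓝 0) (𝓝 1) := by
      have := (continuous_charFun (μ := P.map Y)).norm.tendsto 0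
      simpa using this
    have h2 : ∀ᶠ t in 𝓝[≠] (0 : ℝ), 0 < ‖charFun (P.map Y) t‖ :=
      (h1.mono_left nhdsWithin_le_nhds).eventually_const_lt one_pos
    obtain ⟨t, h3, h4⟩ := (h2.and self_mem_nhdsWithin).exists
    exact ⟨t, h4, h3⟩
  set r := ‖charFun (P.map Y) t‖
  have hv : Tendsto (fun n => (v n : ℝ)) atTop (𝓝 (-2 * Real.log r / t ^ 2)) := by
    have h1 : Tendsto (fun n => Real.exp (-((v n : ℝ) * t ^ 2 / 2))) atTop (𝓝 r) := by
      have := (hφ t).norm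
      refine this.congr fun n => ?_
      rw [← Complex.ofReal_neg, Complex.norm_exp_ofReal]
    have h2 := (((Real.continuousAt_log ht.ne').tendsto.comp h1).const_mul (-2)).div_const (t ^ 2)
    refine h2.congr fun n => ?_
    simp only [Function.comp_apply, Real.log_exp]
    field_simp
  have hv0 : 0 ≤ -2 * Real.log r / t ^ 2 := ge_of_tendsto' hv fun n => (v n).2
  refine ⟨(-2 * Real.log r / t ^ 2).toNNReal, Measure.ext_of_charFun (funext fun s => ?_)⟩
  refine tendsto_nhds_unique (hφ s) ?_
  rw [charFun_gaussianReal, Real.coe_toNNReal _ hv0]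
  have h3 : Continuous fun x : ℝ => Complex.exp (-(x * s ^ 2 / 2 : ℝ)) := by fun_prop
  have h4 := (h3.tendsto _).comp hv
  convert! h4 using 2
  push_cast
  simp

variable {E : Type*} [NormedAddCommGroup E] [NormedSpace ℝ E]

/-- All functionals of `Z` are centred Gaussian random variables. -/
def CentredGaussian (P : Measure Ω) (Z : Ω → E) : Prop :=
  ∀ ℓ : E →L[ℝ] ℝ, ∃ v : NNReal, P.map (fun ω => ℓ (Z ω)) = gaussianReal 0 v

/-- A Gaussian random element of a Banach space lives in a separable closed subspace. -/
theorem CentredGaussian.exists_separable [CompleteSpace E] {Z : Ω → E} (hZ : CentredGaussian P Z)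
    (hZm : AEStronglyMeasurable Z P) :
    ∃ (S : Submodule ℝ E) (_ : CompleteSpace S) (_ : SecondCountableTopology S)
      (_ : MeasurableSpace S) (_ : BorelSpace S) (W : Ω → S), Measurable W ∧
      (∀ᵐ ω ∂P, Z ω = W ω) ∧ IsGaussian (P.map W) ∧
        ∀ L : S →L[ℝ] ℝ, ∫ x, L x ∂(P.map W) = 0 := by
  let Z' : Ω → E := hZm.mk Z
  have hZ' : StronglyMeasurable Z' := hZm.stronglyMeasurable_mk
  let S : Submodule ℝ E := (Submodule.span ℝ (Set.range Z')).topologicalClosure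
  have hmem : ∀ ω, Z' ω ∈ S := fun ω =>
    Submodule.le_topologicalClosure _ (Submodule.subset_span (Set.mem_range_self ω))
  have hsep : TopologicalSpace.IsSeparable (S : Set E) :=
    (hZ'.isSeparable_range.span (R := ℝ)).closure
  have : TopologicalSpace.SeparableSpace S := hsep.separableSpace
  have hS2 : SecondCountableTopology S := UniformSpace.secondCountable_of_separable S
  have hSc : CompleteSpace S :=
    (Submodule.isClosed_topologicalClosure _).completeSpace_coe
  let mE : MeasurableSpace E := borel E
  have bE : BorelSpace E := ⟨rfl⟩
  let W : Ω → S := fun ω => ⟨Z' ω, hmem ω⟩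
  have hW : Measurable W := hZ'.measurable.subtype_mk
  have key : ∀ L : S →L[ℝ] ℝ, ∃ v : NNReal, (P.map W).map L = gaussianReal 0 v := fun L => by
    obtain ⟨ℓ, hℓ, -⟩ := exists_extension_norm_eq (𝕜 := ℝ) S L
    obtain ⟨v, hv⟩ := hZ ℓ
    refine ⟨v, ?_⟩
    rw [← hv, Measure.map_map (by fun_prop) hW]
    refine Measure.map_congr ?_
    filter_upwards [hZm.ae_eq_mk] with ω hω
    rw [Function.comp_apply, ← hℓ, hω]
  refine ⟨S, hSc, hS2, inferInstance, inferInstance, W, hW, hZm.ae_eq_mk, ?_, fun L => ?_⟩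
  · exact isGaussian_of_map_eq_gaussianReal fun L => ⟨0, key L⟩
  · obtain ⟨v, hv⟩ := key L
    have := integral_map (μ := P.map W) (φ := L) (f := fun x : ℝ => x) (by fun_prop)
      (by fun_prop)
    rw [← this, hv, integral_id_gaussianReal]

/-- Fernique's theorem: a Gaussian random element has moments of all orders. -/
theorem CentredGaussian.memLp [CompleteSpace E] {Z : Ω → E} (hZ : CentredGaussian P Z)
    (hZm : AEStronglyMeasurable Z P) {r : ℝ≥0∞} (hr : r ≠ ∞) : MemLp Z r P := by
  obtain ⟨S, _, _, _, _, W, hW, hZW, hG, -⟩ := hZ.exists_separable hZm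
  have h1 : MemLp W r P :=
    (memLp_map_measure_iff (by fun_prop) hW.aemeasurable).1 (IsGaussian.memLp_id (P.map W) r hr)
  exact (S.subtypeL.comp_memLp' h1).ae_eq (hZW.mono fun ω h => h.symm)

theorem CentredGaussian.rotationInvariant [IsProbabilityMeasure P] [CompleteSpace E] {Z : Ω → E}
    (hZ : CentredGaussian P Z) (hZm : AEStronglyMeasurable Z P) : RotationInvariant P Z := by
  obtain ⟨S, _, _, _, _, W, hW, hZW, hG, h0⟩ := hZ.exists_separable hZm
  intro Φ hΦ θ
  have h1 : ∀ᵐ q ∂P.prod P, Z q.1 = W q.1 := Measure.quasiMeasurePreserving_fst.ae hZW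
  have h2 : ∀ᵐ q ∂P.prod P, Z q.2 = W q.2 := Measure.quasiMeasurePreserving_snd.ae hZW
  let Ψ : S × S → ℝ := fun x => Φ (x.1, x.2)
  have hΨ : Continuous Ψ := by fun_prop
  have hmap : (P.prod P).map (Prod.map W W) = (P.map W).prod (P.map W) :=
    (Measure.map_prod_map P P hW hW).symm
  have hrot := IsGaussian.map_rotation_eq_self_of_forall_strongDual_eq_zero h0 θ
  calc _ = ∫ q : Ω × Ω, Ψ (ContinuousLinearMap.rotation θ (Prod.map W W q)) ∂P.prod P := by
        refine integral_congr_ae ?_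
        filter_upwards [h1, h2] with q hq1 hq2
        rw [hq1, hq2, ContinuousLinearMap.rotation_apply]
        rfl
    _ = ∫ x, Ψ (ContinuousLinearMap.rotation θ x) ∂(P.map W).prod (P.map W) := by
        rw [← hmap, integral_map (by fun_prop) (by fun_prop)]
    _ = ∫ x, Ψ x ∂(P.map W).prod (P.map W) := by
        conv_rhs => rw [← hrot]
        rw [integral_map (by fun_prop) (by fun_prop)]
    _ = ∫ q : Ω × Ω, Ψ (Prod.map W W q) ∂P.prod P := by
        rw [← hmap, integral_map (by fun_prop) (by fun_prop)]
    _ = _ := by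
        refine integral_congr_ae ?_
        filter_upwards [h1, h2] with q hq1 hq2
        rw [hq1, hq2]
        rfl

end GaussianElement

/-! ### Completeness of the space of càdlàg paths -/

section Complete

variable {T : ℝ} {p : ℕ}

theorem isClosed_cadlagSubmodule : IsClosed (cadlagSubmodule T p : Set
    (lp (fun _ : Set.Icc (0 : ℝ) T => EuclideanSpace ℝ (Fin p)) ∞)) := by
  refine isClosed_of_closure_subset fun x hx t => ?_
  have happ : ∀ ε > 0, ∃ y ∈ cadlagSubmodule T p, ∀ u, dist (x u) (y u) < ε := fun ε hε => by
    obtain ⟨y, hy, hxy⟩ := Metric.mem_closure_iff.1 hx ε hε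
    refine ⟨y, hy, fun u => lt_of_le_of_lt ?_ hxy⟩
    rw [dist_eq_norm, dist_eq_norm]
    exact lp.norm_apply_le_norm ENNReal.top_ne_zero (x - y) u
  have htri : ∀ {ε : ℝ} {a b c d : EuclideanSpace ℝ (Fin p)}, dist a b < ε / 3 →
      dist b c < ε / 3 → dist d c < ε / 3 → dist a d < ε := fun {ε a b c d} h1 h2 h3 => by
    rw [dist_comm] at h3
    linarith [dist_triangle a b d, dist_triangle b c d]
  refine ⟨Metric.tendsto_nhds.2 fun ε hε => ?_, ?_⟩
  · obtain ⟨y, hy, hxy⟩ := happ (ε / 3) (by positivity)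
    filter_upwards [Metric.tendsto_nhds.1 (hy t).1 (ε / 3) (by positivity)] with u hu
    exact htri (hxy u) hu (hxy t)
  · -- at the left end point there is nothing to show; elsewhere the uniform approximations have
    -- left limits, so the path is Cauchy on the left of `t`
    rcases (𝓝[<] t).eq_or_neBot with hbot | hne
    · exact ⟨0, by rw [hbot]; exact tendsto_bot⟩
    · refine cauchy_map_iff_exists_tendsto.1 (Metric.cauchy_iff.2 ⟨hne.map _, fun ε hε => ?_⟩)
      obtain ⟨y, hy, hxy⟩ := happ (ε / 3) (by positivity)
      obtain ⟨l, hl⟩ := (hy t).2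
      refine ⟨_, image_mem_map (Metric.tendsto_nhds.1 hl (ε / 3 / 2) (by positivity)), ?_⟩
      rintro _ ⟨u, hu, rfl⟩ _ ⟨u', hu', rfl⟩
      refine htri (hxy u) ?_ (hxy u')
      have h1 : dist (y u) l < ε / 3 / 2 := hu
      have h2 : dist (y u') l < ε / 3 / 2 := hu'
      rw [dist_comm] at h2
      linarith [dist_triangle (y u) l (y u')]

instance : CompleteSpace (Dp T p) :=
  (isClosed_cadlagSubmodule (T := T) (p := p)).completeSpace_coe

end Complete

/-! ### Discretized paths as images of Gaussian vectors -/

section Coordinates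

variable {T : ℝ} {p : ℕ}

/-- The values at the times in `π`, as one vector. -/
def coordVec (π : Finset (Set.Icc (0 : ℝ) T)) :
    (π → EuclideanSpace ℝ (Fin p)) →L[ℝ] EuclideanSpace ℝ (π × Fin p) :=
  LinearMap.toContinuousLinearMap
    { toFun := fun v => WithLp.toLp 2 fun q => v q.1 q.2
      map_add' := fun _ _ => rfl
      map_smul' := fun _ _ => rfl }

theorem coordVec_apply (π : Finset (Set.Icc (0 : ℝ) T)) (v : π → EuclideanSpace ℝ (Fin p))
    (q : π × Fin p) : coordVec π v q = v q.1 q.2 := rfl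

/-- The discretization along `π`, as a function of the values at the times in a larger set `ρ`. -/
def discrVec (ρ π : Finset (Set.Icc (0 : ℝ) T)) : EuclideanSpace ℝ (ρ × Fin p) →L[ℝ] Dp T p :=
  LinearMap.toContinuousLinearMap (stepLin π ∘ₗ
    { toFun := fun v t => WithLp.toLp 2 fun i => if h : t ∈ ρ then v (⟨t, h⟩, i) else 0
      map_add' := fun v w => by ext t i; by_cases h : t ∈ ρ <;> simp [h]
      map_smul' := fun c v => by ext t i; by_cases h : t ∈ ρ <;> simp [h] })

theorem stepFun_congr {π : Finset (Set.Icc (0 : ℝ) T)}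
    {v w : Set.Icc (0 : ℝ) T → EuclideanSpace ℝ (Fin p)} (h : ∀ t ∈ π, v t = w t) :
    stepFun π v = stepFun π w := by
  refine Dp.ext fun u => ?_
  by_cases hu : ∃ s ∈ π, s ≤ u
  · obtain ⟨σ, hσ, -, -, he⟩ := exists_stepFun_apply_eq (p := p) hu
    rw [he, he, h σ hσ]
  · rw [stepFun_apply_eq_zero hu, stepFun_apply_eq_zero hu]

theorem discrVec_coordVec {ρ π : Finset (Set.Icc (0 : ℝ) T)} (h : π ⊆ ρ) (x : Dp T p) :
    discrVec ρ π (coordVec ρ (ρ.restrict fun t => x t)) = discr π x := by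
  rw [discr_apply]
  refine stepFun_congr fun t ht => ?_
  ext i
  simp [h ht, coordVec_apply]

end Coordinates

/-! ### Iterated limits in `L¹` -/

section IteratedLimit

variable {U : Type*} [MeasurableSpace U] {Λ : Measure U}

theorem lintegral_enorm_le_of_tendsto {f : ℕ → U → ℝ} {g : U → ℝ} {c : ℝ≥0∞}
    (hf : ∀ n, AEStronglyMeasurable (f n) Λ) (hlim : ∀ u, Tendsto (fun n => f n u) atTop (𝓝 (g u)))
    (hc : ∀ᶠ n in atTop, ∫⁻ u, ‖f n u‖ₑ ∂Λ ≤ c) : ∫⁻ u, ‖g u‖ₑ ∂Λ ≤ c := by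
  calc ∫⁻ u, ‖g u‖ₑ ∂Λ = ∫⁻ u, liminf (fun n => ‖f n u‖ₑ) atTop ∂Λ :=
        lintegral_congr fun u => ((hlim u).enorm.liminf_eq).symm
    _ ≤ liminf (fun n => ∫⁻ u, ‖f n u‖ₑ ∂Λ) atTop :=
        lintegral_liminf_le' fun n => (hf n).enorm
    _ ≤ c := liminf_le_of_frequently_le' hc.frequently

/-- If a double sequence is Cauchy in `L¹` and has a pointwise iterated limit, then the iterated
limit is its limit in `L¹`. -/
theorem integrable_and_tendsto_integral_of_iterated_limit {X : ℕ → ℕ → U → ℝ} {Y : ℕ → U → ℝ}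
    {W : U → ℝ} (hX : ∀ n m, Integrable (X n m) Λ)
    (hY : ∀ n u, Tendsto (fun m => X n m u) atTop (𝓝 (Y n u)))
    (hW : ∀ u, Tendsto (fun n => Y n u) atTop (𝓝 (W u)))
    (hC : ∀ ε : ℝ, 0 < ε → ∃ N, ∀ n ≥ N, ∀ m ≥ N, ∀ k ≥ N, ∫ u, |X n m u - X k k u| ∂Λ ≤ ε) :
    Integrable W Λ ∧ Tendsto (fun n => ∫ u, X n n u ∂Λ) atTop (𝓝 (∫ u, W u ∂Λ)) := by
  have hYm : ∀ n, AEStronglyMeasurable (Y n) Λ := fun n =>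
    aestronglyMeasurable_of_tendsto_ae atTop (fun m => (hX n m).1) (Eventually.of_forall (hY n))
  have hWm : AEStronglyMeasurable W Λ :=
    aestronglyMeasurable_of_tendsto_ae atTop hYm (Eventually.of_forall hW)
  have key : ∀ ε : ℝ, 0 < ε → ∃ N, ∀ k ≥ N, ∫⁻ u, ‖W u - X k k u‖ₑ ∂Λ ≤ ENNReal.ofReal ε := by
    intro ε hε
    obtain ⟨N, hN⟩ := hC ε hε
    refine ⟨N, fun k hk => ?_⟩
    refine lintegral_enorm_le_of_tendsto (f := fun n u => Y n u - X k k u)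
      (fun n => (hYm n).sub (hX k k).1) (fun u => (hW u).sub_const _) ?_
    filter_upwards [eventually_ge_atTop N] with n hn
    refine lintegral_enorm_le_of_tendsto (f := fun m u => X n m u - X k k u)
      (fun m => (hX n m).1.sub (hX k k).1) (fun u => (hY n u).sub_const _) ?_
    filter_upwards [eventually_ge_atTop N] with m hm
    have h1 := ofReal_integral_norm_eq_lintegral_enorm ((hX n m).sub (hX k k))
    simp only [Pi.sub_apply, Real.norm_eq_abs] at h1
    rw [← h1]
    exact ENNReal.ofReal_le_ofReal (hN n hn m hm k hk)
  have hint : ∀ k, ∫⁻ u, ‖W u - X k k u‖ₑ ∂Λ < ∞ → Integrable (fun u => W u - X k k u) Λ :=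
    fun k hk => ⟨hWm.sub (hX k k).1, hk⟩
  have hWi : Integrable W Λ := by
    obtain ⟨N, hN⟩ := key 1 one_pos
    have := (hint N ((hN N le_rfl).trans_lt ENNReal.ofReal_lt_top)).add (hX N N)
    refine this.congr (Eventually.of_forall fun u => ?_)
    simp
  refine ⟨hWi, Metric.tendsto_atTop'.2 fun ε hε => ?_⟩
  obtain ⟨N, hN⟩ := key (ε / 2) (half_pos hε)
  refine ⟨N, fun k hk => ?_⟩
  rw [dist_comm, dist_eq_norm, ← integral_sub hWi (hX k k)]
  refine lt_of_le_of_lt (norm_integral_le_integral_norm _) (lt_of_le_of_lt ?_ (half_lt_self hε))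
  have h1 := ofReal_integral_norm_eq_lintegral_enorm (hWi.sub (hX k k))
  simp only [Pi.sub_apply] at h1
  exact (ENNReal.ofReal_le_ofReal_iff (half_pos hε).le).1 (h1.trans_le (hN k hk.le))

end IteratedLimit

/-! ### The trace of a bilinear form against the covariance of a Gaussian process -/

section Trace

variable {T : ℝ} {p : ℕ} {Ω : Type*} [MeasurableSpace Ω] {P : Measure Ω}
  {Z : Ω → Dp T p}

theorem hasGaussianLaw_coordVec
    (hZ : IsGaussianProcess (fun (t : Set.Icc (0 : ℝ) T) ω => Z ω t) P)
    (ρ : Finset (Set.Icc (0 : ℝ) T)) :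
    HasGaussianLaw (fun ω => coordVec ρ (ρ.restrict fun t => Z ω t)) P :=
  (hZ.hasGaussianLaw ρ).map_fun (coordVec ρ)

theorem integral_coordVec
    (hZ : IsGaussianProcess (fun (t : Set.Icc (0 : ℝ) T) ω => Z ω t) P)
    (hmean : ∀ t, ∫ ω, Z ω t ∂P = 0) (ρ : Finset (Set.Icc (0 : ℝ) T)) :
    ∫ ω, coordVec ρ (ρ.restrict fun t => Z ω t) ∂P = 0 := by
  ext q
  rw [eval_integral_piLp fun q => integrable_piLp_iff.1 (hasGaussianLaw_coordVec hZ ρ).integrable q]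
  have h1 := (EuclideanSpace.proj (𝕜 := ℝ) q.2).integral_comp_comm
    (hZ.hasGaussianLaw_eval (q.1 : Set.Icc (0 : ℝ) T)).integrable
  rw [hmean, map_zero] at h1
  exact h1

theorem aestronglyMeasurable_discr
    (hZ : IsGaussianProcess (fun (t : Set.Icc (0 : ℝ) T) ω => Z ω t) P)
    (π : Finset (Set.Icc (0 : ℝ) T)) : AEStronglyMeasurable (fun ω => discr π (Z ω)) P := by
  have h := (discrVec (p := p) π π).continuous.comp_aestronglyMeasurable
    (hasGaussianLaw_coordVec hZ π).aemeasurable.aestronglyMeasurable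
  simpa only [discrVec_coordVec subset_rfl] using h

theorem exists_map_discr_eq_gaussianReal
    (hZ : IsGaussianProcess (fun (t : Set.Icc (0 : ℝ) T) ω => Z ω t) P)
    (hmean : ∀ t, ∫ ω, Z ω t ∂P = 0) (ℓ : Dp T p →L[ℝ] ℝ) (π : Finset (Set.Icc (0 : ℝ) T)) :
    ∃ v : NNReal, P.map (fun ω => ℓ (discr π (Z ω))) = gaussianReal 0 v := by
  have h := hasGaussianLaw_coordVec hZ π
  have h1 := (h.map_fun (ℓ.comp (discrVec (p := p) π π))).map_eq_gaussianReal
  have h2 := (ℓ.comp (discrVec (p := p) π π)).integral_comp_comm h.integrable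
  rw [integral_coordVec hZ hmean, map_zero] at h2
  rw [h2] at h1
  simp only [ContinuousLinearMap.comp_apply, discrVec_coordVec subset_rfl] at h1
  exact ⟨_, h1⟩

theorem ae_tendsto_discr (hT : 0 ≤ T)
    (hcont : ∀ᵐ ω ∂P, Continuous (fun t : Set.Icc (0 : ℝ) T => Z ω t))
    {π : ℕ → Finset (Set.Icc (0 : ℝ) T)} (hmono : Monotone π) (hdense : Dense {t | ∃ n, t ∈ π n})
    (h0 : ∃ n, leftPt hT ∈ π n) :
    ∀ᵐ ω ∂P, Tendsto (fun n => discr (π n) (Z ω)) atTop (𝓝 (Z ω)) :=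
  hcont.mono fun _ h => tendsto_discr_of_continuous hT hmono hdense h0 h

/-- A Gaussian process with continuous paths is a strongly measurable Gaussian random element of
the space of càdlàg paths. -/
theorem aestronglyMeasurable_and_centredGaussian [IsProbabilityMeasure P] (hT : 0 ≤ T)
    (hZ : IsGaussianProcess (fun (t : Set.Icc (0 : ℝ) T) ω => Z ω t) P)
    (hcont : ∀ᵐ ω ∂P, Continuous (fun t : Set.Icc (0 : ℝ) T => Z ω t))
    (hmean : ∀ t, ∫ ω, Z ω t ∂P = 0) : AEStronglyMeasurable Z P ∧ CentredGaussian P Z := by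
  obtain ⟨π, hmono, hdense, h0, -⟩ := exists_tendsto_discr (p := p) hT 0
  have hlim := ae_tendsto_discr hT hcont hmono hdense h0
  have hm : ∀ n, AEStronglyMeasurable (fun ω => discr (π n) (Z ω)) P := fun n =>
    aestronglyMeasurable_discr hZ (π n)
  refine ⟨aestronglyMeasurable_of_tendsto_ae atTop hm hlim, fun ℓ => ?_⟩
  choose v hv using fun n => exists_map_discr_eq_gaussianReal hZ hmean ℓ (π n)
  exact exists_map_eq_gaussianReal_of_tendsto
    (fun n => (ℓ.continuous.comp_aestronglyMeasurable (hm n)).aemeasurable) hv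
    (hlim.mono fun ω h => (ℓ.continuous.tendsto _).comp h)

variable {U : Type*} [MeasurableSpace U] {Λ : Measure U} {J : U → Dp T p}

theorem measurable_coordVec (hJm : ∀ t, Measurable fun u => J u t)
    (ρ : Finset (Set.Icc (0 : ℝ) T)) :
    Measurable fun u => coordVec ρ (ρ.restrict fun t => J u t) :=
  (coordVec ρ).continuous.measurable.comp (measurable_pi_lambda _ fun t => hJm t)

theorem memLp_coordVec (hJ : ∀ t, MemLp (fun u => J u t) 2 Λ) (ρ : Finset (Set.Icc (0 : ℝ) T)) :
    MemLp (fun u => coordVec ρ (ρ.restrict fun t => J u t)) 2 Λ :=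
  (coordVec ρ).comp_memLp' (memLp_pi_iff.2 fun t => hJ t)

/-- For linear functions of finitely many coordinates, the trace against `Λ` is the trace against
the covariance of `Z`, and the `L¹(Λ)`-norm is controlled by the second moments under `P`. -/
theorem integral_apply_coordVec
    (hZ : IsGaussianProcess (fun (t : Set.Icc (0 : ℝ) T) ω => Z ω t) P)
    (hmean : ∀ t, ∫ ω, Z ω t ∂P = 0) (hJm : ∀ t, Measurable fun u => J u t)
    (hJ : ∀ t, MemLp (fun u => J u t) 2 Λ)
    (hcov : ∀ (s t : Set.Icc (0 : ℝ) T) (i j : Fin p),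
      ∫ ω, Z ω s i * Z ω t j ∂P = ∫ u, J u s i * J u t j ∂Λ)
    (B : Dp T p →L[ℝ] Dp T p →L[ℝ] ℝ) (ρ : Finset (Set.Icc (0 : ℝ) T))
    (L₁ L₂ : EuclideanSpace ℝ (ρ × Fin p) →L[ℝ] Dp T p) :
    ∫ u, B (L₁ (coordVec ρ (ρ.restrict fun t => J u t)))
        (L₂ (coordVec ρ (ρ.restrict fun t => J u t))) ∂Λ
      = ∫ ω, B (L₁ (coordVec ρ (ρ.restrict fun t => Z ω t)))
        (L₂ (coordVec ρ (ρ.restrict fun t => Z ω t))) ∂P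
    ∧ ∫ u, |B (L₁ (coordVec ρ (ρ.restrict fun t => J u t)))
        (L₂ (coordVec ρ (ρ.restrict fun t => J u t)))| ∂Λ
      ≤ ‖B‖ * (√(∫ ω, ‖L₁ (coordVec ρ (ρ.restrict fun t => Z ω t))‖ ^ 2 ∂P)
        * √(∫ ω, ‖L₂ (coordVec ρ (ρ.restrict fun t => Z ω t))‖ ^ 2 ∂P)) := by
  classical
  have hG := hasGaussianLaw_coordVec hZ ρ
  have hGm := hG.aemeasurable
  constructor
  · exact integral_apply_apply_congr (memLp_coordVec hJ ρ) hG.memLp_two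
      (fun a c => (hcov a.1 c.1 a.2 c.2).symm) (B.bilinearComp L₁ L₂)
  · have := hG.isGaussian_map
    have h := integral_abs_apply_le (Λ := Λ)
      (ν := P.map fun ω => coordVec ρ (ρ.restrict fun t => Z ω t))
      (by rw [integral_map hGm (by fun_prop), integral_coordVec hZ hmean])
      (measurable_coordVec hJm ρ) (memLp_coordVec hJ ρ)
      (fun a c => by
        have hc : Continuous fun x : EuclideanSpace ℝ (ρ × Fin p) => x a * x c := by fun_prop
        rw [integral_map hGm hc.aestronglyMeasurable]
        exact hcov a.1 c.1 a.2 c.2) B L₁ L₂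
    have hn : ∀ L : EuclideanSpace ℝ (ρ × Fin p) →L[ℝ] Dp T p,
        ∫ x, ‖L x‖ ^ 2 ∂(P.map fun ω => coordVec ρ (ρ.restrict fun t => Z ω t))
          = ∫ ω, ‖L (coordVec ρ (ρ.restrict fun t => Z ω t))‖ ^ 2 ∂P := fun L =>
      integral_map hGm (L.continuous.norm.pow 2).aestronglyMeasurable
    rwa [hn, hn] at h

theorem memLp_discr (hJ : ∀ t, MemLp (fun u => J u t) 2 Λ) (π : Finset (Set.Icc (0 : ℝ) T)) :
    MemLp (fun u => discr π (J u)) 2 Λ := by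
  refine ((discrVec (p := p) π π).comp_memLp' (memLp_coordVec hJ π)).ae_eq
    (Eventually.of_forall fun u => discrVec_coordVec subset_rfl (J u))

theorem tendsto_integral_norm_discr_sub_sq (hT : 0 ≤ T) (hZ2 : MemLp Z 2 P)
    (hcont : ∀ᵐ ω ∂P, Continuous (fun t : Set.Icc (0 : ℝ) T => Z ω t))
    {π : ℕ → Finset (Set.Icc (0 : ℝ) T)} (hmono : Monotone π) (hdense : Dense {t | ∃ n, t ∈ π n})
    (h0 : ∃ n, leftPt hT ∈ π n) :
    Tendsto (fun n => ∫ ω, ‖discr (π n) (Z ω) - Z ω‖ ^ 2 ∂P) atTop (𝓝 0) := by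
  have h : Tendsto (fun n => ∫ ω, ‖discr (π n) (Z ω) - Z ω‖ ^ 2 ∂P) atTop
      (𝓝 (∫ _, (0 : ℝ) ∂P)) := by
    refine tendsto_integral_of_dominated_convergence (fun ω => 4 * ‖Z ω‖ ^ 2) (fun n => ?_)
      ((hZ2.integrable_norm_pow two_ne_zero).const_mul 4)
      (fun n => Eventually.of_forall fun ω => ?_) ?_
    · exact (((discr (π n)).continuous.comp_aestronglyMeasurable hZ2.1).sub hZ2.1).norm.pow 2
    · rw [Real.norm_of_nonneg (by positivity)]
      have h1 := norm_discr_apply_le (π n) (Z ω)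
      have h2 : ‖discr (π n) (Z ω) - Z ω‖ ≤ 2 * ‖Z ω‖ := (norm_sub_le _ _).trans (by linarith)
      calc ‖discr (π n) (Z ω) - Z ω‖ ^ 2 ≤ (2 * ‖Z ω‖) ^ 2 :=
            pow_le_pow_left₀ (norm_nonneg _) h2 2
        _ = 4 * ‖Z ω‖ ^ 2 := by ring
    · filter_upwards [ae_tendsto_discr hT hcont hmono hdense h0] with ω hω
      have h1 := ((hω.sub_const (Z ω)).norm).pow 2
      simpa using h1
  simpa using h

/-- The trace formula: the integral of `B[J_u, J_u]` against `Λ` exists and equals `𝔼 B[Z, Z]`.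
Since `u ↦ J_u` is only weakly measurable and not square integrable in norm, both the existence and
the value of the integral come from discretizations `B[π_n J_u, π_m J_u]`, which form a Cauchy
double sequence in `L¹(Λ)` because `π_n Z` converges in `L²`. -/
theorem integrable_apply_and_integral_eq_covTrace (hT : 0 ≤ T)
    (hZ : IsGaussianProcess (fun (t : Set.Icc (0 : ℝ) T) ω => Z ω t) P)
    (hcont : ∀ᵐ ω ∂P, Continuous (fun t : Set.Icc (0 : ℝ) T => Z ω t))
    (hmean : ∀ t, ∫ ω, Z ω t ∂P = 0) (hZ2 : MemLp Z 2 P)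
    (hJm : ∀ t, Measurable fun u => J u t) (hJ : ∀ t, MemLp (fun u => J u t) 2 Λ)
    (hcov : ∀ (s t : Set.Icc (0 : ℝ) T) (i j : Fin p),
      ∫ ω, Z ω s i * Z ω t j ∂P = ∫ u, J u s i * J u t j ∂Λ)
    (B : Dp T p →L[ℝ] Dp T p →L[ℝ] ℝ) (hB : ∀ x y, B x y = B y x) :
    Integrable (fun u => B (J u) (J u)) Λ ∧ ∫ u, B (J u) (J u) ∂Λ = covTrace hZ2 B := by
  obtain ⟨π, hmono, hdense, h0, hπ⟩ := exists_tendsto_discr hT B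
  have hZd := ae_tendsto_discr hT hcont hmono hdense h0
  have hB0 : 0 ≤ ‖B‖ := B.opNorm_nonneg
  set e : ℕ → ℝ := fun n => ∫ ω, ‖discr (π n) (Z ω) - Z ω‖ ^ 2 ∂P
  have he0 : Tendsto e atTop (𝓝 0) :=
    tendsto_integral_norm_discr_sub_sq hT hZ2 hcont hmono hdense h0
  set K : ℝ := √(∫ ω, ‖Z ω‖ ^ 2 ∂P)
  have hdZ : ∀ n, MemLp (fun ω => discr (π n) (Z ω)) 2 P := fun n =>
    (discr (π n)).comp_memLp' hZ2
  have hdJ : ∀ n, MemLp (fun u => discr (π n) (J u)) 2 Λ := fun n => memLp_discr hJ (π n)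
  have hi : ∀ n, Integrable (fun ω => ‖discr (π n) (Z ω) - Z ω‖ ^ 2) P := fun n =>
    ((hdZ n).sub hZ2).integrable_norm_pow two_ne_zero
  have hsq : ∀ n k, ∫ ω, ‖discr (π n) (Z ω) - discr (π k) (Z ω)‖ ^ 2 ∂P ≤ 2 * (e n + e k) := by
    intro n k
    rw [← integral_add (hi n) (hi k), ← integral_const_mul]
    refine integral_mono (((hdZ n).sub (hdZ k)).integrable_norm_pow two_ne_zero)
      (((hi n).add (hi k)).const_mul 2) fun ω => ?_
    have h1 : ‖discr (π n) (Z ω) - discr (π k) (Z ω)‖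
        ≤ ‖discr (π n) (Z ω) - Z ω‖ + ‖discr (π k) (Z ω) - Z ω‖ := by
      rw [← sub_sub_sub_cancel_right _ _ (Z ω)]
      exact norm_sub_le _ _
    have h2 := pow_le_pow_left₀ (norm_nonneg _) h1 2
    have h3 := sq_nonneg (‖discr (π n) (Z ω) - Z ω‖ - ‖discr (π k) (Z ω) - Z ω‖)
    beta_reduce
    nlinarith
  have hdK : ∀ m, √(∫ ω, ‖discr (π m) (Z ω)‖ ^ 2 ∂P) ≤ K := fun m =>
    Real.sqrt_le_sqrt (integral_mono ((hdZ m).integrable_norm_pow two_ne_zero)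
      (hZ2.integrable_norm_pow two_ne_zero) fun ω =>
        pow_le_pow_left₀ (norm_nonneg _) (norm_discr_apply_le (π m) (Z ω)) 2)
  have hsub : ∀ n k m, ∫ u, |B (discr (π n) (J u) - discr (π k) (J u)) (discr (π m) (J u))| ∂Λ
      ≤ ‖B‖ * (√(2 * (e n + e k)) * K) := by
    intro n k m
    set ρ := π (max (max n k) m)
    have hn : π n ⊆ ρ := hmono ((le_max_left _ _).trans (le_max_left _ _))
    have hk : π k ⊆ ρ := hmono ((le_max_right _ _).trans (le_max_left _ _))
    have hm : π m ⊆ ρ := hmono (le_max_right _ _)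
    have h := (integral_apply_coordVec hZ hmean hJm hJ hcov B ρ
      (discrVec ρ (π n) - discrVec ρ (π k)) (discrVec ρ (π m))).2
    simp only [sub_apply, discrVec_coordVec hn, discrVec_coordVec hk, discrVec_coordVec hm] at h
    exact h.trans (mul_le_mul_of_nonneg_left
      (mul_le_mul (Real.sqrt_le_sqrt (hsq n k)) (hdK m) (Real.sqrt_nonneg _)
        (Real.sqrt_nonneg _)) hB0)
  have hdiag : ∀ n, ∫ u, B (discr (π n) (J u)) (discr (π n) (J u)) ∂Λ
      = ∫ ω, B (discr (π n) (Z ω)) (discr (π n) (Z ω)) ∂P := by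
    intro n
    have h := (integral_apply_coordVec hZ hmean hJm hJ hcov B (π n)
      (discrVec (π n) (π n)) (discrVec (π n) (π n))).1
    simpa only [discrVec_coordVec subset_rfl] using h
  have hX : ∀ n m, Integrable (fun u => B (discr (π n) (J u)) (discr (π m) (J u))) Λ :=
    fun n m => integrable_apply_apply B (hdJ n) (hdJ m)
  obtain ⟨hint, hlim⟩ := integrable_and_tendsto_integral_of_iterated_limit (Λ := Λ)
    (X := fun n m u => B (discr (π n) (J u)) (discr (π m) (J u)))
    (Y := fun n u => B (discr (π n) (J u)) (J u)) (W := fun u => B (J u) (J u)) hX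
    (fun n u => by
      have := hπ (J u) (discr (π n) (J u))
      rw [hB (J u)] at this
      exact this.congr fun m => hB _ _)
    (fun u => hπ (J u) (J u))
    (fun ε hε => by
      have hη : 0 < ε / (4 * (‖B‖ * K + 1)) := by positivity
      obtain ⟨N, hN⟩ := (he0.eventually_lt_const (sq_pos_of_pos hη)).exists_forall_of_atTop
      refine ⟨N, fun n hn m hm k hk => ?_⟩
      have hsqrt : ∀ n ≥ N, ∀ k ≥ N, √(2 * (e n + e k)) ≤ 2 * (ε / (4 * (‖B‖ * K + 1))) :=
        fun n hn k hk => by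
          rw [Real.sqrt_le_left (by positivity)]
          linarith [hN n hn, hN k hk]
      have hBK : 0 ≤ ‖B‖ * K := mul_nonneg hB0 (Real.sqrt_nonneg _)
      have hb : ∀ n ≥ N, ∀ k ≥ N, ‖B‖ * (√(2 * (e n + e k)) * K) ≤ ε / 2 := fun n hn k hk => by
        calc ‖B‖ * (√(2 * (e n + e k)) * K) = (‖B‖ * K) * √(2 * (e n + e k)) := by ring
          _ ≤ (‖B‖ * K + 1) * (2 * (ε / (4 * (‖B‖ * K + 1)))) :=
              mul_le_mul (by linarith) (hsqrt n hn k hk) (Real.sqrt_nonneg _) (by positivity)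
          _ = ε / 2 := by field_simp; norm_num
      have i1 := integrable_apply_apply B ((hdJ n).sub (hdJ k)) (hdJ m)
      have i2 := integrable_apply_apply B ((hdJ m).sub (hdJ k)) (hdJ k)
      calc ∫ u, |B (discr (π n) (J u)) (discr (π m) (J u))
              - B (discr (π k) (J u)) (discr (π k) (J u))| ∂Λ
          ≤ ∫ u, (|B (discr (π n) (J u) - discr (π k) (J u)) (discr (π m) (J u))|
              + |B (discr (π m) (J u) - discr (π k) (J u)) (discr (π k) (J u))|) ∂Λ := by
            refine integral_mono ((hX n m).sub (hX k k)).abs (i1.abs.add i2.abs) fun u => ?_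
            refine le_trans (le_of_eq ?_) (abs_add_le _ _)
            simp only [map_sub, sub_apply]
            rw [hB (discr (π m) (J u)) (discr (π k) (J u))]
            congr 1
            ring
        _ = _ := integral_add i1.abs i2.abs
        _ ≤ ε / 2 + ε / 2 :=
            add_le_add ((hsub n k m).trans (hb n hn k hk)) ((hsub m k k).trans (hb m hm k hk))
        _ = ε := add_halves ε)
  refine ⟨hint, tendsto_nhds_unique hlim ?_⟩
  simp only [hdiag]
  rw [covTrace_apply]
  refine tendsto_integral_of_dominated_convergence (fun ω => ‖B‖ * ‖Z ω‖ ^ 2) (fun n => ?_)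
    ((hZ2.integrable_norm_pow two_ne_zero).const_mul _)
    (fun n => Eventually.of_forall fun ω => ?_) ?_
  · exact (integrable_apply_apply B (hdZ n) (hdZ n)).1
  · have h1 := norm_discr_apply_le (π n) (Z ω)
    calc ‖B (discr (π n) (Z ω)) (discr (π n) (Z ω))‖
        ≤ ‖B‖ * ‖discr (π n) (Z ω)‖ * ‖discr (π n) (Z ω)‖ := abs_apply_apply_le_norm B _ _
      _ ≤ ‖B‖ * ‖Z ω‖ * ‖Z ω‖ :=
          mul_le_mul (mul_le_mul_of_nonneg_left h1 hB0) h1 (norm_nonneg _)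
            (mul_nonneg hB0 (norm_nonneg _))
      _ = ‖B‖ * ‖Z ω‖ ^ 2 := by ring
  · filter_upwards [hZd] with ω hω
    have hc : Continuous fun x : Dp T p × Dp T p => B x.1 x.2 :=
      continuous_apply_apply continuous_const continuous_fst continuous_snd
    have h1 := (hc.tendsto (Z ω, Z ω)).comp (hω.prodMk_nhds hω)
    exact h1

end Trace

/-! ### Bounds for the second derivative of the Stein solution -/

section Bounds

variable {E : Type*} [NormedAddCommGroup E] [NormedSpace ℝ E] {Ω : Type*} [MeasurableSpace Ω]
  {P : Measure Ω} [IsProbabilityMeasure P] {Z : Ω → E} {g : E → ℝ} {C : ℝ}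

theorem norm_integral_exp_smul_le {F : Type*} [NormedAddCommGroup F] [NormedSpace ℝ F]
    {A : Ω × ℝ → F} {b : ℝ} (hA : ∀ q, 0 < q.2 → ‖A q‖ ≤ b) :
    ‖∫ q : Ω × ℝ, Real.exp (-2 * q.2) • A q ∂P.prod (volume.restrict (Set.Ioi 0))‖ ≤ b / 2 := by
  have hi : IntegrableOn (fun s : ℝ => Real.exp (-2 * s)) (Set.Ioi 0) :=
    integrableOn_exp_mul_Ioi (by norm_num) 0
  have hv : ∫ s in Set.Ioi (0 : ℝ), Real.exp (-2 * s) = 1 / 2 := by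
    rw [integral_exp_mul_Ioi (by norm_num)]
    norm_num
  refine (norm_integral_le_of_norm_le ((hi.comp_snd P).mul_const b) ?_).trans_eq ?_
  · filter_upwards [ae_snd_pos] with q hq
    rw [norm_smul, Real.norm_of_nonneg (Real.exp_pos _).le]
    exact mul_le_mul_of_nonneg_left (hA q hq) (Real.exp_pos _).le
  · rw [integral_mul_const, integral_fun_snd (fun s : ℝ => Real.exp (-2 * s)), hv]
    simp
    ring

theorem integrable_exp_smul_D2_ouInterp (hZ : MemLp Z 3 P) (hg' : Continuous (D2 g)) (hC : 0 ≤ C)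
    (h2 : ∀ x, ‖D2 g x‖ ≤ C * (1 + ‖x‖)) (w : E) :
    Integrable (fun q : Ω × ℝ => Real.exp (-2 * q.2) • D2 g (ouInterp w (Z q.1) q.2))
      (P.prod (volume.restrict (Set.Ioi 0))) :=
  integrable_exp_smul_comp_ouInterp hZ hg' hC
    (fun x => (h2 x).trans (by
      have := norm_nonneg x
      gcongr
      exact le_self_pow₀ (by linarith) (by norm_num)))
    (c := fun s => Real.exp (-2 * s)) (by fun_prop) (fun s hs => by
      rw [abs_of_pos (Real.exp_pos _)]
      exact Real.exp_le_exp.2 (by linarith)) w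

theorem D2_steinIntegral (hZ : MemLp Z 3 P) (hg : TwiceFrechetDifferentiable g)
    (hg' : Continuous (D2 g)) (hC : 0 ≤ C) (h0 : ∀ x, |g x| ≤ C * (1 + ‖x‖) ^ 3)
    (h1 : ∀ x, ‖fderiv ℝ g x‖ ≤ C * (1 + ‖x‖) ^ 2) (h2 : ∀ x, ‖D2 g x‖ ≤ C * (1 + ‖x‖)) (w : E) :
    D2 (steinIntegral P Z g) w
      = -∫ q : Ω × ℝ, Real.exp (-2 * q.2) • D2 g (ouInterp w (Z q.1) q.2)
        ∂P.prod (volume.restrict (Set.Ioi 0)) :=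
  (hasFDerivAt_fderiv_steinIntegral hZ hg hg' hC h0 h1 h2 w).fderiv

theorem norm_D2_steinIntegral_le (hZ : MemLp Z 3 P) (hg : TwiceFrechetDifferentiable g)
    (hg' : Continuous (D2 g)) (hC : 0 ≤ C) (h0 : ∀ x, |g x| ≤ C * (1 + ‖x‖) ^ 3)
    (h1 : ∀ x, ‖fderiv ℝ g x‖ ≤ C * (1 + ‖x‖) ^ 2) (h2 : ∀ x, ‖D2 g x‖ ≤ C * (1 + ‖x‖))
    {b : ℝ} (hb : ∀ x, ‖D2 g x‖ ≤ b) (w : E) : ‖D2 (steinIntegral P Z g) w‖ ≤ b / 2 := by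
  rw [D2_steinIntegral hZ hg hg' hC h0 h1 h2, norm_neg]
  exact norm_integral_exp_smul_le fun q _ => hb _

theorem norm_D2_steinIntegral_sub_le (hZ : MemLp Z 3 P) (hg : TwiceFrechetDifferentiable g)
    (hC : 0 ≤ C) (h0 : ∀ x, |g x| ≤ C * (1 + ‖x‖) ^ 3)
    (h1 : ∀ x, ‖fderiv ℝ g x‖ ≤ C * (1 + ‖x‖) ^ 2) (h2 : ∀ x, ‖D2 g x‖ ≤ C * (1 + ‖x‖))
    {K : ℝ} (hK0 : 0 ≤ K) (hK : ∀ w h, ‖D2 g (w + h) - D2 g w‖ ≤ K * ‖h‖) (w h : E) :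
    ‖D2 (steinIntegral P Z g) (w + h) - D2 (steinIntegral P Z g) w‖ ≤ K * ‖h‖ / 2 := by
  have hg' := continuous_D2 hK
  rw [D2_steinIntegral hZ hg hg' hC h0 h1 h2, D2_steinIntegral hZ hg hg' hC h0 h1 h2,
    neg_sub_neg, norm_sub_rev, ← integral_sub (integrable_exp_smul_D2_ouInterp hZ hg' hC h2 (w + h))
      (integrable_exp_smul_D2_ouInterp hZ hg' hC h2 w)]
  simp only [← smul_sub]
  refine norm_integral_exp_smul_le fun q hq => ?_
  have e : ouInterp (w + h) (Z q.1) q.2 = ouInterp w (Z q.1) q.2 + Real.exp (-q.2) • h := by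
    simp only [ouInterp, smul_add]
    abel
  rw [e]
  refine (hK _ _).trans (mul_le_mul_of_nonneg_left ?_ hK0)
  rw [norm_smul, Real.norm_of_nonneg (Real.exp_pos _).le]
  exact mul_le_of_le_one_left (norm_nonneg _) (Real.exp_le_one_iff.2 (by linarith))

end Bounds

end GaussStein

end

theorem theorem2p2 {d p : ℕ} {T : ℝ} (hT : 0 ≤ T)
    {Ω : Type*} [MeasurableSpace Ω] (P : Measure Ω) [IsProbabilityMeasure P]
    (Λ : Measure (EuclideanSpace ℝ (Fin d)))
    (J : EuclideanSpace ℝ (Fin d) → GaussStein.Dp T p)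
    (hJ_meas : Measurable
      (fun q : EuclideanSpace ℝ (Fin d) × Set.Icc (0 : ℝ) T => J q.1 q.2))
    (hJ_sq : ∀ s, MemLp (fun u => J u s) 2 Λ)
    (Z : Ω → GaussStein.Dp T p)
    (hZ_gauss : IsGaussianProcess (fun (t : Set.Icc (0 : ℝ) T) ω => Z ω t) P)
    (hZ_cont : ∀ᵐ ω ∂P, Continuous (fun t : Set.Icc (0 : ℝ) T => Z ω t))
    (hZ_mean : ∀ t, ∫ ω, Z ω t ∂P = 0)
    (hZ_cov : ∀ (s t : Set.Icc (0 : ℝ) T) (i j : Fin p),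
      ∫ ω, Z ω s i * Z ω t j ∂P = ∫ u, J u s i * J u t j ∂Λ)
    (g : GaussStein.Dp T p → ℝ) (hg : g ∈ GaussStein.spaceM (GaussStein.Dp T p)) :
    -- the integrals that define `f_g` converge absolutely
    Integrable (fun ω => g (Z ω)) P
    ∧ (∀ w, ∀ s : ℝ, 0 ≤ s → Integrable (fun ω => g (GaussStein.ouPoint w (Z ω) s)) P)
    ∧ (∀ w, IntegrableOn
        (fun s : ℝ => (∫ ω, g (GaussStein.ouPoint w (Z ω) s) ∂P) - ∫ ω, g (Z ω) ∂P)
        (Set.Ioi 0))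
    -- `f_g ∈ M`
    ∧ GaussStein.steinSol P Z g ∈ GaussStein.spaceM (GaussStein.Dp T p)
    -- the first two derivatives, as absolutely convergent integrals of (multi)linear forms
    ∧ (∀ w,
        GaussStein.BochnerIntegrable (fun q : Ω × ℝ =>
            Real.exp (-q.2) • fderiv ℝ g (GaussStein.ouPoint w (Z q.1) q.2))
          (P.prod (volume.restrict (Set.Ioi 0)))
        ∧ fderiv ℝ (GaussStein.steinSol P Z g) w
          = -∫ ω, (∫ s in Set.Ioi (0 : ℝ),
              Real.exp (-s) • fderiv ℝ g (GaussStein.ouPoint w (Z ω) s)) ∂P)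
    ∧ (∀ w,
        GaussStein.BochnerIntegrable (fun q : Ω × ℝ =>
            Real.exp (-2 * q.2) • GaussStein.D2 g (GaussStein.ouPoint w (Z q.1) q.2))
          (P.prod (volume.restrict (Set.Ioi 0)))
        ∧ GaussStein.D2 (GaussStein.steinSol P Z g) w
          = -∫ ω, (∫ s in Set.Ioi (0 : ℝ),
              Real.exp (-2 * s) • GaussStein.D2 g (GaussStein.ouPoint w (Z ω) s)) ∂P)
    -- Lipschitz bound for the second derivative
    ∧ (∀ w w' w₁ w₂,
        |GaussStein.D2 (GaussStein.steinSol P Z g) (w + w') w₁ w₂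
            - GaussStein.D2 (GaussStein.steinSol P Z g) w w₁ w₂|
          ≤ (GaussStein.normM g).toReal * ‖w₁‖ * ‖w₂‖ * ‖w'‖)
    -- uniform bound for the second derivative when `g ∈ M'`
    ∧ (g ∈ GaussStein.spaceM' (GaussStein.Dp T p) →
        GaussStein.normM' g < ∞
        ∧ ∀ w w₁ w₂,
          |GaussStein.D2 (GaussStein.steinSol P Z g) w w₁ w₂|
            ≤ (3 / 2) * (GaussStein.normM' g).toReal * ‖w₁‖ * ‖w₂‖)
    -- the Stein equation
    ∧ (∀ w,
        Integrable
          (fun u => GaussStein.D2 (GaussStein.steinSol P Z g) w (J u) (J u)) Λ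
        ∧ GaussStein.steinOp Λ J (GaussStein.steinSol P Z g) w
          = g w - ∫ ω, g (Z ω) ∂P) := by
  obtain ⟨hZm, hG⟩ :=
    GaussStein.aestronglyMeasurable_and_centredGaussian hT hZ_gauss hZ_cont hZ_mean
  have hZ3 : MemLp Z 3 P := hG.memLp hZm (by simp)
  have hZ2 : MemLp Z 2 P := hG.memLp hZm (by simp)
  have hrot := hG.rotationInvariant hZm
  have hg2 := hg.1
  have hlip : ∀ w h, ‖GaussStein.D2 g (w + h) - GaussStein.D2 g w‖
      ≤ 2 * (GaussStein.lipD2 g).toReal * ‖h‖ :=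
    GaussStein.norm_D2_sub_le hg2 (GaussStein.lipD2_ne_top hg)
  have hl0 : 0 ≤ (GaussStein.lipD2 g).toReal := ENNReal.toReal_nonneg
  have hg' := GaussStein.continuous_D2 hlip
  obtain ⟨C, hC, h0, h1, h2⟩ := GaussStein.exists_growth hg2 hlip
  have hf : GaussStein.TwiceFrechetDifferentiable (GaussStein.steinSol P Z g) :=
    ⟨fun w => (GaussStein.hasFDerivAt_steinIntegral hZ3 hg2.1 hg2.2.continuous hC h0 h1
      w).differentiableAt,
    fun w => (GaussStein.hasFDerivAt_fderiv_steinIntegral hZ3 hg2 hg' hC h0 h1 h2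
      w).differentiableAt⟩
  have hflip : ∀ w h, ‖GaussStein.D2 (GaussStein.steinSol P Z g) (w + h)
      - GaussStein.D2 (GaussStein.steinSol P Z g) w‖ ≤ (GaussStein.lipD2 g).toReal * ‖h‖ :=
    fun w h => (GaussStein.norm_D2_steinIntegral_sub_le hZ3 hg2 hC h0 h1 h2 (by positivity) hlip
      w h).trans_eq (by ring)
  have hi1 := fun w => GaussStein.integrable_exp_smul_comp_ouInterp hZ3 hg2.2.continuous hC h1
    (c := fun s => Real.exp (-s)) (by fun_prop) (fun s _ => by simp) w
  have hi2 := fun w => GaussStein.integrable_exp_smul_D2_ouInterp hZ3 hg' hC h2 w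
  refine ⟨GaussStein.integrable_comp_of_cubic hZ3 hg2.1.continuous hC h0,
    fun w s hs => GaussStein.integrable_comp_ouInterp hZ3 hg2.1.continuous hC h0 w hs,
    fun w => ?_, GaussStein.mem_spaceM_of_lipschitz hf hl0 hflip, fun w => ⟨hi1 w, ?_⟩,
    fun w => ⟨hi2 w, ?_⟩, fun w w' w₁ w₂ => ?_, fun hgM' => ⟨GaussStein.normM'_lt_top hgM',
    fun w w₁ w₂ => ?_⟩, fun w => ?_⟩
  · have h := (GaussStein.integrable_comp_ouInterp_sub hZ3 hg2.1 hC h1 w).integral_prod_right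
    refine h.congr ?_
    filter_upwards [ae_restrict_mem measurableSet_Ioi] with s hs
    exact integral_sub
      (GaussStein.integrable_comp_ouInterp hZ3 hg2.1.continuous hC h0 w (le_of_lt hs))
      (GaussStein.integrable_comp_of_cubic hZ3 hg2.1.continuous hC h0)
  · have h := (GaussStein.hasFDerivAt_steinIntegral hZ3 hg2.1 hg2.2.continuous hC h0 h1 w).fderiv
    rw [integral_prod _ (hi1 w)] at h
    exact h
  · have h := GaussStein.D2_steinIntegral hZ3 hg2 hg' hC h0 h1 h2 w
    rw [integral_prod _ (hi2 w)] at h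
    exact h
  · have h := GaussStein.abs_apply_apply_le_norm
      (GaussStein.D2 (GaussStein.steinSol P Z g) (w + w')
        - GaussStein.D2 (GaussStein.steinSol P Z g) w) w₁ w₂
    have hle := (hflip w w').trans
      (mul_le_mul_of_nonneg_right (GaussStein.lipD2_toReal_le_normM hg) (norm_nonneg w'))
    calc _ ≤ _ := h
      _ ≤ ((GaussStein.normM g).toReal * ‖w'‖) * ‖w₁‖ * ‖w₂‖ :=
          mul_le_mul_of_nonneg_right (mul_le_mul_of_nonneg_right hle (norm_nonneg _))
            (norm_nonneg _)
      _ = _ := by ring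
  · -- on the diagonal `D²g` is bounded by `‖g‖_{M'}`, so in operator norm by twice as much
    have hb : ∀ x, ‖GaussStein.D2 g x‖ ≤ 2 * (GaussStein.normM' g).toReal := fun x =>
      (GaussStein.norm_le_two_mul_bilNorm (hg2.D2_symm x)).trans
        (mul_le_mul_of_nonneg_left ((GaussStein.bilNorm_D2_le_of_mem_spaceM' hgM' x).trans
          (GaussStein.toReal_iSup_bilNorm_le_normM' hgM')) (by norm_num))
    have hM0 : 0 ≤ (GaussStein.normM' g).toReal := ENNReal.toReal_nonneg
    have hle : ‖GaussStein.D2 (GaussStein.steinSol P Z g) w‖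
        ≤ 3 / 2 * (GaussStein.normM' g).toReal :=
      (GaussStein.norm_D2_steinIntegral_le hZ3 hg2 hg' hC h0 h1 h2 hb w).trans (by linarith)
    exact (GaussStein.abs_apply_apply_le_norm _ w₁ w₂).trans
      (mul_le_mul_of_nonneg_right (mul_le_mul_of_nonneg_right hle (norm_nonneg _))
        (norm_nonneg _))
  · obtain ⟨hint, htr⟩ := GaussStein.integrable_apply_and_integral_eq_covTrace hT hZ_gauss hZ_cont
      hZ_mean hZ2 (fun t => hJ_meas.comp (measurable_id.prodMk measurable_const)) hJ_sq hZ_cov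
      (GaussStein.D2 (GaussStein.steinSol P Z g) w) (hf.D2_symm w)
    refine ⟨hint, ?_⟩
    rw [GaussStein.steinOp, htr]
    exact GaussStein.covTrace_D2_steinIntegral_sub hZ3 hZ2 hrot hg2 hg' hC h0 h1 h2 w
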